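/- **Theorem.** Let $X_1, X_2, \ldots$ be i.i.d. random variables with the symmetric Laplace density $\frac12 e^{-|x|}$, $x \in \mathbb{R}$, and let $S_0 = 0$, $S_k = X_1 + \cdots + X_k$. Let $\tau^- := \inf\{k : S_k < 0\}$ be the first descending ladder time, let $\nu := \tau^- - 1$, and let $$N_{\mathrm{des}}(v) := \sum_{k=1}^{\nu} 1(S_k \le v), \qquad v \ge 0 .$$ Let $(N_{\pm}(v),\, v \ge 0)$ be a birth and death process with state space $\{0,1,2,\ldots\}$, initial state $N_{\pm}(0) = 1$, and transitions $j \to j+1$ at rate $j/2$ and $j \to j-1$ at rate $j/2$. Let $N_{\mathrm{births}}(v)$ and $N_{\mathrm{deaths}}(v)$ be the numbers of upward and of downward jumps of $N_{\pm}$ during $(0,v]$; almost surely these are finite and $N_{\pm}(v) = 1 + N_{\mathrm{births}}(v) - N_{\mathrm{deaths}}(v)$ for all $v \ge 0$. Let $(N_{\mathrm{marks}}(v),\, v \ge 0)$ be a Cox process with intensity $(N_{\pm}(v),\, v \ge 0)$, that is, a counting process defined on the same probability space which, conditionally given $N_{\pm}$, is a Poisson process with intensity measure $N_{\pm}(v)\,dv$.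 Put $$N_{\mathrm{count}}(v) := N_{\mathrm{births}}(v) + N_{\mathrm{deaths}}(v) + N_{\mathrm{marks}}(v), \qquad v \ge 0 .$$ Then $\mathbb{P}(\nu \ge 1) > 0$, and conditionally on the event $\{\nu \ge 1\}$ there is the identity in law of counting processes $$\big(N_{\mathrm{des}}(v),\, v \ge 0 \,\big|\, \nu \ge 1\big) \stackrel{d}{=} \big(N_{\mathrm{count}}(v),\, v \ge 0\big).$$ -/

import Mathlib

open MeasureTheory ProbabilityTheory Filter Topology
open scoped NNReal ENNReal

noncomputable section

/-- The symmetric Laplace distribution on `ℝ`, with density `x ↦ (1/2) e^{-|x|}`. -/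
def laplaceMeasure : Measure ℝ :=
  volume.withDensity (fun x => ENNReal.ofReal (1 / 2 * Real.exp (-|x|)))

/-- The random walk `S_k = X_1 + ⋯ + X_k`, where the increment `X_{i+1}` is written `X i`. -/
def walk {Ω : Type*} (X : ℕ → Ω → ℝ) (k : ℕ) (ω : Ω) : ℝ :=
  ∑ i ∈ Finset.range k, X i ω

/-- The first descending ladder time `τ⁻ = inf {k : S_k < 0}`, equal to `⊤` if there is no such
`k`. -/
def ladderTime {Ω : Type*} (X : ℕ → Ω → ℝ) (ω : Ω) : ℕ∞ :=
  hittingAfter (walk X) (Set.Iio 0) 0 ω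

/-- `ν = τ⁻ - 1`. -/
def nu {Ω : Type*} (X : ℕ → Ω → ℝ) (ω : Ω) : ℕ∞ :=
  ladderTime X ω - 1

/-- `N_des(v) = ∑_{k=1}^{ν} 1(S_k ≤ v)`, the number of times `k ∈ {1, …, ν}` with `S_k ≤ v`. -/
def Ndes {Ω : Type*} (X : ℕ → Ω → ℝ) (v : ℝ≥0) (ω : Ω) : ℕ∞ :=
  Set.encard {k : ℕ | 1 ≤ k ∧ (k : ℕ∞) ≤ nu X ω ∧ walk X k ω ≤ v}

/-- Transition probabilities of the embedded jump chain of a birth and death process with birth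
rates `β` and death rates `δ`; a state whose total rate is zero is absorbing. -/
def jumpProb (β δ : ℕ → ℝ≥0) (i j : ℕ) : ℝ :=
  if β i + δ i = 0 then (if j = i then 1 else 0)
  else if j = i + 1 then β i / (β i + δ i)
  else if j + 1 = i then δ i / (β i + δ i)
  else 0

/-- `Z` is a (non-explosive) birth and death process on `ℕ` with birth rates `β`, death rates `δ`
and initial state `x₀`, under the probability measure `P`. This is the jump chain / holding time
definition: `Z` stays in `Y 0` for time `H 0`, then in `Y 1` for time `H 1`, and so on, where
`Y` is a Markov chain from `x₀` with transition matrix `jumpProb β δ` and, given `Y`, the holding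
times `H 0, H 1, …` are independent, `H k` being exponential with parameter
`β (Y k) + δ (Y k)` (so `H k = ∞` if this is zero). -/
structure IsBirthDeathProcess {Ω : Type*} [MeasurableSpace Ω] (P : Measure Ω)
    (β δ : ℕ → ℝ≥0) (x₀ : ℕ) (Z : ℝ≥0 → Ω → ℕ) : Prop where
  measurable : ∀ t, Measurable (Z t)
  jump_hold : ∃ (Y : ℕ → Ω → ℕ) (H : ℕ → Ω → ℝ≥0∞),
    (∀ k, Measurable (Y k)) ∧ (∀ k, Measurable (H k)) ∧
    (∀ (n : ℕ) (y : ℕ → ℕ) (t : ℕ → ℝ≥0),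
      P.real {ω | Y 0 ω = y 0 ∧ ∀ k < n, (t k : ℝ≥0∞) < H k ω ∧ Y (k + 1) ω = y (k + 1)} =
        (if y 0 = x₀ then 1 else 0) *
          ∏ k ∈ Finset.range n,
            Real.exp (-((β (y k) + δ (y k)) * t k)) * jumpProb β δ (y k) (y (k + 1))) ∧
    (∀ᵐ ω ∂P, ∀ t : ℝ≥0, ∃ n : ℕ,
      ∑ k ∈ Finset.range n, H k ω ≤ t ∧ t < ∑ k ∈ Finset.range (n + 1), H k ω ∧
        Z t ω = Y n ω)

/-- Number of births of the path `f` during `(0, v]`: times at which `f` exceeds its left limit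
by one. -/
def births (f : ℝ≥0 → ℕ) (v : ℝ≥0) : ℕ∞ :=
  Set.encard {s : ℝ≥0 | 0 < s ∧ s ≤ v ∧ ∀ᶠ u in 𝓝[<] s, f s = f u + 1}

/-- Number of deaths of the path `f` during `(0, v]`: times at which `f` is one less than its left
limit. -/
def deaths (f : ℝ≥0 → ℕ) (v : ℝ≥0) : ℕ∞ :=
  Set.encard {s : ℝ≥0 | 0 < s ∧ s ≤ v ∧ ∀ᶠ u in 𝓝[<] s, f s + 1 = f u}

/-- `∫_a^b X(s) ds`, as an extended nonnegative real. -/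
def cumIntensity {Ω : Type*} (X : ℝ≥0 → Ω → ℝ≥0) (a b : ℝ≥0) (ω : Ω) : ℝ≥0∞ :=
  ∫⁻ s in Set.Ioc (a : ℝ) (b : ℝ), (X (Real.toNNReal s) ω : ℝ≥0∞)

/-- The σ-algebra generated by the process `X`. -/
abbrev processSigma {Ω : Type*} (X : ℝ≥0 → Ω → ℝ≥0) : MeasurableSpace Ω :=
  MeasurableSpace.comap (fun ω t => X t ω) inferInstance

/-- `M` is a Cox process driven by the nonnegative right-continuous process `X`: a counting process
started at `0` which, conditionally given `X`, is a Poisson process with intensity `X(t) dt`, that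
is, its increments over successive intervals are conditionally independent Poisson variables with
means the integrals of `X` over these intervals. -/
structure IsCoxProcess {Ω : Type*} [MeasurableSpace Ω] (P : Measure Ω)
    (X : ℝ≥0 → Ω → ℝ≥0) (M : ℝ≥0 → Ω → ℕ) : Prop where
  measurable_intensity : ∀ t, Measurable (X t)
  rightCont_intensity : ∀ᵐ ω ∂P, ∀ t, ContinuousWithinAt (fun s => X s ω) (Set.Ici t) t
  cumIntensity_lt_top : ∀ᵐ ω ∂P, ∀ t, cumIntensity X 0 t ω < ∞
  measurable : ∀ t, Measurable (M t)
  zero : ∀ᵐ ω ∂P, M 0 ω = 0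
  monotone : ∀ᵐ ω ∂P, Monotone (fun t => M t ω)
  rightCont : ∀ᵐ ω ∂P, ∀ t, ContinuousWithinAt (fun s => M s ω) (Set.Ici t) t
  condLaw : ∀ (n : ℕ) (t : ℕ → ℝ≥0) (k : ℕ → ℕ), Monotone t →
    P⟦{ω | ∀ i < n, M (t (i + 1)) ω = M (t i) ω + k i} | processSigma X⟧ =ᵐ[P]
      fun ω => ∏ i ∈ Finset.range n,
        (poissonMeasure (cumIntensity X (t i) (t (i + 1)) ω).toNNReal).real {k i}

/-- `N_count(v) = N_births(v) + N_deaths(v) + N_marks(v)`. -/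
def Ncount {Ω : Type*} (Z M : ℝ≥0 → Ω → ℕ) (v : ℝ≥0) (ω : Ω) : ℕ∞ :=
  births (fun s => Z s ω) v + deaths (fun s => Z s ω) v + (M v ω : ℕ∞)

end

/-! Both processes have the same generating functional, expressed through one and the same Riccati
solution. Let `g` be the step function that carries a factor `b i` on `[0, t (i + 1)]`. Then the
product of the `b i ^ N (t (i + 1))` is the product of `g` over the points counted by `N`. With `b i
= 2 ^ (-m i)` the expectations of these products are the mixed moments of the variables `2 ^ (-N)`.
Those moments determine all finite-dimensional laws, hence the law of the process; since `2 ^ (-∞) =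
0`, infinite counts need no separate treatment.

Walk side. Let `u x` be the expected product of `g` over the points visited by the walk from `x`
until it becomes negative, and put `h = g * u`. Conditioning on the sign of the next Laplace step
gives `u = (down + up) / 2`, where `down' = -down + h` and `up' = up - h`. Hence `r = up / down`
satisfies `r' = 2 r - g (1 + r)² / 2`. Beyond the horizon `g = 1`, and boundedness of `down` forces
`up = down` there, so `r = 1` at the horizon. The expectation on `{S 1 ≥ 0}` is `r 0 / 2`.
Heuristically, by memorylessness, `r x` is the expected weight of one excursion above level `x`, and
`N_±(x)` counts these excursions, which are independent: this is why powers of `r` occur below.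

Birth-death side. Integrating out the Poisson marks turns them into the factor `exp (-∫ (1 - g)
N_±)`. For the weight that remains, `r ^ i` at level `t` is the value of being in state `i`: the
Riccati equation says exactly that `r ^ i` is harmonic. The weighted values at the jump times
therefore have constant expectation `r 0`, and they become the total weight once the horizon is
passed.

The second argument works for every solution in `IsRiccati`, so it applies to the one produced by
the walk and no uniqueness theorem is needed. The carrying results are `exists_isRiccati_walk`,
`IsRiccati.tsum_step`, `lintegral_totalWeight`, `lintegral_jumps_marks` and
`identDistrib_of_moments`. -/

/-! ### Deterministic jump paths: births, deaths and the number of jumps. -/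

/-- The time of the `n`-th jump of a path with successive holding times `H 0, H 1, …`. -/
noncomputable def jumpTime (H : ℕ → ℝ≥0∞) (n : ℕ) : ℝ≥0∞ := ∑ k ∈ Finset.range n, H k

/-- The number of jumps during `(0, t]` of a path with successive holding times `H 0, H 1, …`. -/
noncomputable def jumpIndex (H : ℕ → ℝ≥0∞) (t : ℝ≥0) : ℕ := sInf {n | (t : ℝ≥0∞) < jumpTime H (n + 1)}

/-- `f` is a path with unit jumps, started at `1` and absorbed at `0`, with successive states `Y`
and holding times `H`. -/
structure IsJumpPath (Y : ℕ → ℕ) (H : ℕ → ℝ≥0∞) (f : ℝ≥0 → ℕ) : Prop where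
  init : Y 0 = 1
  pos : ∀ k, 0 < H k
  step : ∀ k, Y k ≠ 0 → Y (k + 1) = Y k + 1 ∨ Y (k + 1) + 1 = Y k
  absorbed : ∀ k, Y k = 0 → H k = ⊤
  eval : ∀ t : ℝ≥0, ∃ n, jumpTime H n ≤ t ∧ t < jumpTime H (n + 1) ∧ f t = Y n

@[simp] lemma jumpTime_zero (H : ℕ → ℝ≥0∞) : jumpTime H 0 = 0 := by simp [jumpTime]

lemma jumpTime_succ (H : ℕ → ℝ≥0∞) (n : ℕ) : jumpTime H (n + 1) = jumpTime H n + H n := by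
  simp [jumpTime, Finset.sum_range_succ]

lemma jumpTime_mono (H : ℕ → ℝ≥0∞) : Monotone (jumpTime H) :=
  monotone_nat_of_le_succ fun n => by rw [jumpTime_succ]; exact le_self_add

lemma jumpIndex_eq {H : ℕ → ℝ≥0∞} {n : ℕ} {t : ℝ≥0} (h1 : jumpTime H n ≤ t)
    (h2 : t < jumpTime H (n + 1)) : jumpIndex H t = n := by
  refine le_antisymm (Nat.sInf_le h2) (le_csInf ⟨n, h2⟩ fun m hm => ?_)
  by_contra hlt
  exact absurd (hm.trans_le ((jumpTime_mono H (by omega : m + 1 ≤ n)).trans h1)) (lt_irrefl _)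

namespace IsJumpPath

variable {Y : ℕ → ℕ} {H : ℕ → ℝ≥0∞} {f : ℝ≥0 → ℕ}

lemma jumpTime_le (h : IsJumpPath Y H f) (t : ℝ≥0) : jumpTime H (jumpIndex H t) ≤ t := by
  obtain ⟨n, h1, h2, -⟩ := h.eval t
  rwa [jumpIndex_eq h1 h2]

lemma lt_jumpTime (h : IsJumpPath Y H f) (t : ℝ≥0) : t < jumpTime H (jumpIndex H t + 1) := by
  obtain ⟨n, h1, h2, -⟩ := h.eval t
  rwa [jumpIndex_eq h1 h2]

lemma apply_eq (h : IsJumpPath Y H f) (t : ℝ≥0) : f t = Y (jumpIndex H t) := by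
  obtain ⟨n, h1, h2, h3⟩ := h.eval t
  rwa [jumpIndex_eq h1 h2]

lemma jumpTime_le_iff (h : IsJumpPath Y H f) {n : ℕ} {t : ℝ≥0} :
    jumpTime H n ≤ t ↔ n ≤ jumpIndex H t := by
  refine ⟨fun hn => ?_, fun hn => (jumpTime_mono H hn).trans (h.jumpTime_le t)⟩
  by_contra hlt
  exact absurd ((h.lt_jumpTime t).trans_le ((jumpTime_mono H (by omega)).trans hn)) (lt_irrefl _)

lemma jumpIndex_mono (h : IsJumpPath Y H f) : Monotone (jumpIndex H) := fun s t hst =>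
  h.jumpTime_le_iff.1 ((h.jumpTime_le s).trans (by exact_mod_cast hst))

lemma jumpIndex_zero (h : IsJumpPath Y H f) : jumpIndex H 0 = 0 :=
  jumpIndex_eq (by simp) (by simpa [jumpTime_succ] using h.pos 0)

lemma jumpTime_lt_top (h : IsJumpPath Y H f) {n : ℕ} {t : ℝ≥0} (hn : n ≤ jumpIndex H t) :
    jumpTime H n < ⊤ := (h.jumpTime_le_iff.2 hn).trans_lt ENNReal.coe_lt_top

lemma jumpTime_lt_succ (h : IsJumpPath Y H f) {n : ℕ} (hn : jumpTime H n < ⊤) :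
    jumpTime H n < jumpTime H (n + 1) := by
  rw [jumpTime_succ]
  exact ENNReal.lt_add_right hn.ne (h.pos n).ne'

lemma jumpTime_lt (h : IsJumpPath Y H f) {m n : ℕ} (hmn : m < n) (hm : jumpTime H m < ⊤) :
    jumpTime H m < jumpTime H n :=
  (h.jumpTime_lt_succ hm).trans_le (jumpTime_mono H hmn)

/-- State `0` is held forever, so no jump out of it occurs at a finite time. -/
lemma state_ne_zero (h : IsJumpPath Y H f) {k : ℕ} {t : ℝ≥0} (hk : k < jumpIndex H t) :
    Y k ≠ 0 := fun h0 => by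
  have := h.jumpTime_lt_top (Nat.succ_le_of_lt hk)
  rw [Nat.succ_eq_add_one, jumpTime_succ, h.absorbed k h0] at this
  simp at this

lemma state_succ_ne (h : IsJumpPath Y H f) {k : ℕ} {t : ℝ≥0} (hk : k < jumpIndex H t) :
    Y k ≠ Y (k + 1) := by
  rcases h.step k (h.state_ne_zero hk) with h' | h' <;> omega

/-- The number of times during `(0, v]` at which the path and its left limit are in relation `R` is
the number of steps `k` with `R (Y k) (Y (k + 1))`. -/
lemma encard_jumps (h : IsJumpPath Y H f) (R : ℕ → ℕ → Prop) [DecidableRel R]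
    (hR : ∀ a, ¬ R a a) (v : ℝ≥0) :
    Set.encard {s : ℝ≥0 | 0 < s ∧ s ≤ v ∧ ∀ᶠ u in 𝓝[<] s, R (f u) (f s)} =
      (((Finset.range (jumpIndex H v)).filter fun k => R (Y k) (Y (k + 1))).card : ℕ∞) := by
  have key : {s : ℝ≥0 | 0 < s ∧ s ≤ v ∧ ∀ᶠ u in 𝓝[<] s, R (f u) (f s)} =
      (fun k => (jumpTime H (k + 1)).toNNReal) ''
        ((Finset.range (jumpIndex H v)).filter fun k => R (Y k) (Y (k + 1)) : Finset ℕ) := by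
    -- The left limit of `f` at a point of `(jumpTime H m, jumpTime H (m + 1)]` is `Y m`.
    have left : ∀ (s : ℝ≥0) (m : ℕ), jumpTime H m < s → s ≤ jumpTime H (m + 1) →
        ∀ᶠ u in 𝓝[<] s, f u = Y m := by
      intro s m h1 h2
      lift jumpTime H m to ℝ≥0 using (h1.trans ENNReal.coe_lt_top).ne with c hc
      have hcs : c < s := by exact_mod_cast h1
      filter_upwards [Ioo_mem_nhdsLT hcs] with u hu
      have hu2 : (u : ℝ≥0∞) < s := by exact_mod_cast hu.2
      rw [h.apply_eq, jumpIndex_eq (n := m) _ (hu2.trans_le h2)]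
      rw [← hc]; exact_mod_cast hu.1.le
    ext s
    simp only [Set.mem_ofPred_eq, Set.mem_image, Finset.coe_filter, Finset.mem_range]
    constructor
    · rintro ⟨h0, hsv, hev⟩
      have : (𝓝[<] s).NeBot := nhdsLT_neBot_of_exists_lt ⟨0, h0⟩
      have hT := (h.jumpTime_le s).lt_or_eq
      rcases hT with hT | hT
      -- Strictly between jump times the path equals its left limit, which irreflexivity of `R`
      -- excludes.
      · obtain ⟨u, hu1, hu2⟩ := (hev.and (left s _ hT (h.lt_jumpTime s).le)).exists
        rw [hu2, h.apply_eq s] at hu1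
        exact absurd hu1 (hR _)
      · obtain ⟨m, hm⟩ : ∃ m, jumpIndex H s = m + 1 := by
          refine Nat.exists_eq_succ_of_ne_zero fun hz => ?_
          rw [hz, jumpTime_zero] at hT
          exact h0.ne (by exact_mod_cast hT)
        have hlt : m + 1 ≤ jumpIndex H v := hm ▸ h.jumpIndex_mono hsv
        rw [hm] at hT
        obtain ⟨u, hu1, hu2⟩ := (hev.and (left s m (hT ▸ h.jumpTime_lt_succ
          (h.jumpTime_lt_top (by omega : m ≤ jumpIndex H v))) hT.ge)).exists
        rw [hu2, h.apply_eq s, hm] at hu1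
        exact ⟨m, ⟨by omega, hu1⟩, by simp [hT]⟩
    · rintro ⟨k, ⟨hk, hRk⟩, rfl⟩
      have hfin := h.jumpTime_lt_top (Nat.succ_le_of_lt hk)
      have hcoe := ENNReal.coe_toNNReal hfin.ne
      have hlt := h.jumpTime_lt_succ (h.jumpTime_lt_top hk.le)
      have hidx : jumpIndex H (jumpTime H (k + 1)).toNNReal = k + 1 :=
        jumpIndex_eq hcoe.ge (by rw [hcoe]; exact h.jumpTime_lt_succ hfin)
      refine ⟨?_, ?_, ?_⟩
      · exact ENNReal.toNNReal_pos (zero_le.trans_lt hlt).ne' hfin.ne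
      · have := h.jumpTime_le_iff.2 (Nat.succ_le_of_lt hk)
        rw [Nat.succ_eq_add_one, ← hcoe] at this
        exact_mod_cast this
      · filter_upwards [left _ k (by rw [hcoe]; exact hlt) hcoe.le] with u hu
        rwa [hu, h.apply_eq, hidx]
  rw [key, Set.InjOn.encard_image, Set.encard_coe_eq_coe_finsetCard]
  intro a ha b hb hab
  simp only [Finset.coe_filter, Finset.mem_range, Set.mem_ofPred_eq] at ha hb
  have ha' := h.jumpTime_lt_top (Nat.succ_le_of_lt ha.1)
  have hb' := h.jumpTime_lt_top (Nat.succ_le_of_lt hb.1)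
  have hab' : jumpTime H (a + 1) = jumpTime H (b + 1) :=
    (ENNReal.toNNReal_eq_toNNReal_iff' ha'.ne hb'.ne).1 hab
  rcases lt_trichotomy a b with hlt | rfl | hlt
  · exact absurd hab' (h.jumpTime_lt (by omega) ha').ne
  · rfl
  · exact absurd hab' (h.jumpTime_lt (by omega) hb').ne'

lemma births_eq (h : IsJumpPath Y H f) (v : ℝ≥0) :
    births f v = (((Finset.range (jumpIndex H v)).filter fun k => Y (k + 1) = Y k + 1).card : ℕ∞) :=
  h.encard_jumps (fun a b => b = a + 1) (by simp) v

lemma deaths_eq (h : IsJumpPath Y H f) (v : ℝ≥0) :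
    deaths f v = (((Finset.range (jumpIndex H v)).filter fun k => Y (k + 1) + 1 = Y k).card : ℕ∞) :=
  h.encard_jumps (fun a b => b + 1 = a) (by simp) v

/-- Every step made before time `v` leaves a nonzero state, hence is exactly one of the two kinds.
This reduces `Ncount` to the jump index plus the marks. -/
lemma births_add_deaths (h : IsJumpPath Y H f) (v : ℝ≥0) :
    births f v + deaths f v = (jumpIndex H v : ℕ∞) := by
  rw [h.births_eq, h.deaths_eq, ← Nat.cast_add, ← Finset.card_union_of_disjoint,
    ← Finset.filter_or, Finset.filter_true_of_mem, Finset.card_range]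
  · intro k hk
    exact h.step k (h.state_ne_zero (Finset.mem_range.1 hk))
  · rw [Finset.disjoint_filter]
    intro k _ h1 h2
    omega

lemma state_add_deaths (h : IsJumpPath Y H f) (v : ℝ≥0) :
    (f v : ℕ∞) + deaths f v = 1 + births f v := by
  rw [h.births_eq, h.deaths_eq, h.apply_eq]
  have : ∀ n ≤ jumpIndex H v, Y n + ((Finset.range n).filter fun k => Y (k + 1) + 1 = Y k).card =
      1 + ((Finset.range n).filter fun k => Y (k + 1) = Y k + 1).card := by
    intro n
    induction n with
    | zero => simp [h.init]
    | succ n ih =>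
      intro hn
      have ih := ih (by omega)
      have hs := h.step n (h.state_ne_zero hn)
      rw [Finset.range_add_one, Finset.filter_insert, Finset.filter_insert]
      rcases hs with hs | hs
      · rw [if_neg (by omega), if_pos hs, Finset.card_insert_of_notMem (by simp)]
        omega
      · rw [if_pos hs, if_neg (by omega), Finset.card_insert_of_notMem (by simp)]
        omega
  exact_mod_cast this _ le_rfl

end IsJumpPath

/-- The number of cells of the regular partition of `[a, b]` into `m` cells over which `f`
changes. -/
noncomputable def gridChanges (f : ℝ≥0 → ℕ) (a b : ℝ≥0) (m : ℕ) : ℕ :=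
  ∑ k ∈ Finset.range m,
    if f (a + k * ((b - a) / m)) = f (a + (k + 1 : ℕ) * ((b - a) / m)) then 0 else 1

/-- Once the mesh is smaller than all relevant holding times, a cell contains at most one jump, and
a jump changes the state. Thus the jump count is a limit of functions of the path at finitely many
times, which makes it accessible to conditioning on the σ-algebra of the process. -/
lemma IsJumpPath.eventually_gridChanges {Y : ℕ → ℕ} {H : ℕ → ℝ≥0∞} {f : ℝ≥0 → ℕ}
    (h : IsJumpPath Y H f) {a b : ℝ≥0} (hab : a ≤ b) :
    ∀ᶠ m in atTop, gridChanges f a b m = jumpIndex H b - jumpIndex H a := by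
  obtain ⟨δ, hδ0, hδ⟩ : ∃ δ : ℝ≥0∞, 0 < δ ∧ ∀ j ≤ jumpIndex H b, δ ≤ H j := by
    refine ⟨(Finset.range (jumpIndex H b + 1)).inf' Finset.nonempty_range_add_one H, ?_, fun j hj => ?_⟩
    · exact (Finset.lt_inf'_iff _).2 fun j _ => h.pos j
    · exact Finset.inf'_le _ (by simpa using Nat.lt_succ_of_le hj)
  have hlim : Tendsto (fun m : ℕ => (((b - a) / m : ℝ≥0) : ℝ≥0∞)) atTop (𝓝 0) := by
    have : Tendsto (fun m : ℕ => ((b - a) / m : ℝ≥0)) atTop (𝓝 0) :=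
      tendsto_const_div_atTop_nhds_zero_nat _
    simpa using ENNReal.tendsto_coe.2 this
  filter_upwards [hlim.eventually_lt_const hδ0, eventually_gt_atTop 0] with m hm hm0
  set w : ℝ≥0 := (b - a) / m
  have hmw : a + m * w = b := by
    rw [mul_div_cancel₀ _ (by positivity)]
    exact add_tsub_cancel_of_le hab
  let p : ℕ → ℝ≥0 := fun k => a + k * w
  have hp : Monotone p := fun i j hij => by
    have : (i : ℝ≥0) ≤ j := by exact_mod_cast hij
    simp only [p]; gcongr
  have hcell : ∀ k ∈ Finset.range m, (if f (p k) = f (p (k + 1)) then 0 else 1) =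
      jumpIndex H (p (k + 1)) - jumpIndex H (p k) := by
    intro k hk
    have hmono := h.jumpIndex_mono (hp (k.le_add_right 1))
    have hle : jumpIndex H (p (k + 1)) ≤ jumpIndex H b := h.jumpIndex_mono (by
      have := hp (show k + 1 ≤ m by simpa using hk)
      rwa [show p m = b from hmw] at this)
    -- Two jumps in one cell would fit a whole holding time, at least `δ`, into a cell of width `w <
    -- δ`.
    have hsucc : jumpIndex H (p (k + 1)) ≤ jumpIndex H (p k) + 1 := by
      by_contra hlt
      push Not at hlt
      have h1 := h.jumpTime_le_iff.2 (show jumpIndex H (p k) + 1 + 1 ≤ jumpIndex H (p (k + 1)) by omega)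
      have h2 := h.lt_jumpTime (p k)
      have h3 := hδ (jumpIndex H (p k) + 1) (by omega)
      rw [jumpTime_succ] at h1
      have h4 : (p (k + 1) : ℝ≥0∞) = p k + w := by
        rw [← ENNReal.coe_add]
        congr 1
        simp only [p]; push_cast; ring
      rw [h4] at h1
      exact absurd (ENNReal.add_lt_add_of_lt_of_le (by finiteness) h2 (hm.le.trans h3))
        (not_lt.2 h1)
    rcases Nat.le_succ_iff.1 hsucc with heq | heq
    · have heq := le_antisymm heq hmono
      rw [h.apply_eq, h.apply_eq, heq]; simp
    · rw [h.apply_eq, h.apply_eq, heq, if_neg (h.state_succ_ne (t := p (k + 1)) (by omega))]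
      omega
  have hsum : gridChanges f a b m =
      ∑ k ∈ Finset.range m, (jumpIndex H (p (k + 1)) - jumpIndex H (p k)) :=
    Finset.sum_congr rfl hcell
  rw [hsum, Finset.sum_range_tsub (f := fun k => jumpIndex H (p k)) (h.jumpIndex_mono.comp hp)]
  simp only [p, hmw]
  simp

/-! ### Laws of counting processes are determined by moments. -/

/-- Two finite measures on a cube which have the same mixed moments are equal. -/
theorem measure_cube_ext_of_moments {ι : Type*} [Fintype ι]
    {μ ν : Measure (ι → unitInterval)} [IsFiniteMeasure μ] [IsFiniteMeasure ν]
    (h : ∀ m : ι → ℕ, ∫ x, ∏ i, (x i : ℝ) ^ m i ∂μ = ∫ x, ∏ i, (x i : ℝ) ^ m i ∂ν) : μ = ν := by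
  classical
  let coord : ι → BoundedContinuousFunction (ι → unitInterval) ℝ := fun i =>
    BoundedContinuousFunction.mkOfCompact ⟨fun x => (x i : ℝ), by fun_prop⟩
  let A : StarSubalgebra ℝ (BoundedContinuousFunction (ι → unitInterval) ℝ) :=
    { Algebra.adjoin ℝ (Set.range coord) with
      star_mem' := fun {a} ha => by
        have : star a = a := by ext x; simp
        rw [this]; exact ha }
  -- The coordinates separate points, so it suffices to compare integrals on the algebra they
  -- generate, which is spanned by monomials.
  refine ext_of_forall_mem_subalgebra_integral_eq_of_polish (𝕜 := ℝ) (A := A) ?_ ?_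
  · intro x y hxy
    obtain ⟨i, hi⟩ := Function.ne_iff.1 hxy
    refine ⟨_, ⟨(coord i : BoundedContinuousFunction (ι → unitInterval) ℝ).toContinuousMap,
      ⟨coord i, Algebra.subset_adjoin ⟨i, rfl⟩, rfl⟩, rfl⟩, ?_⟩
    simpa [coord, Subtype.ext_iff] using hi
  · intro f hf
    have hf' : f ∈ Submodule.span ℝ
        (Submonoid.closure (Set.range coord) : Set (BoundedContinuousFunction _ ℝ)) := by
      rw [← Algebra.adjoin_eq_span]; exact hf
    have hint : ∀ (ρ : Measure (ι → unitInterval)) [IsFiniteMeasure ρ]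
        (f : BoundedContinuousFunction (ι → unitInterval) ℝ), Integrable (fun x => f x) ρ :=
      fun ρ _ f => f.integrable ρ
    clear hf
    induction hf' using Submodule.span_induction with
    | mem f hf =>
      have : ∃ m : ι → ℕ, ∀ x, f x = ∏ i, (x i : ℝ) ^ m i := by
        refine Submonoid.closure_induction (motive := fun f _ => ∃ m : ι → ℕ, ∀ x,
          (f : BoundedContinuousFunction (ι → unitInterval) ℝ) x = ∏ i, (x i : ℝ) ^ m i)
          ?_ ?_ ?_ hf
        · rintro _ ⟨i, rfl⟩
          refine ⟨Pi.single i 1, fun x => ?_⟩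
          rw [Finset.prod_eq_single i]
          · simp [coord]
          · intro j _ hj; simp [hj]
          · simp
        · exact ⟨0, fun x => by simp⟩
        · rintro f g _ _ ⟨m, hm⟩ ⟨m', hm'⟩
          exact ⟨m + m', fun x => by simp [hm, hm', pow_add, Finset.prod_mul_distrib]⟩
      obtain ⟨m, hm⟩ := this
      simp_rw [hm]; exact h m
    | zero => simp
    | add f g _ _ hf hg =>
      simp only [BoundedContinuousFunction.coe_add, Pi.add_apply]
      rw [integral_add (hint μ f) (hint μ g), integral_add (hint ν f) (hint ν g)]
      rw [hf, hg]
    | smul c f _ hf =>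
      simp only [BoundedContinuousFunction.coe_smul]
      rw [integral_smul, integral_smul, hf]

/-- The weight `2 ^ (-n)` of a count `n`, in the unit interval. -/
noncomputable def halfPow (n : ℕ∞) : unitInterval :=
  if h : n = ⊤ then 0 else ⟨(1 / 2 : ℝ) ^ (n.lift (lt_top_iff_ne_top.2 h)), by positivity,
    pow_le_one₀ (by norm_num) (by norm_num)⟩

@[simp] lemma halfPow_top : halfPow ⊤ = 0 := by simp [halfPow]

@[simp] lemma coe_halfPow_natCast (n : ℕ) : (halfPow (n : ℕ∞) : ℝ) = (1 / 2) ^ n := by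
  simp [halfPow]

lemma halfPow_injective : Function.Injective halfPow := by
  intro a b hab
  have h := congrArg (Subtype.val) hab
  induction a using ENat.recTopCoe <;> induction b using ENat.recTopCoe
  · rfl
  · simp at h
    exact absurd h (by positivity)
  · simp at h
  · rw [coe_halfPow_natCast, coe_halfPow_natCast] at h
    have := pow_right_injective₀ (a := (1 / 2 : ℝ)) (by norm_num) (by norm_num) h
    simp [this]

/-- The law of a finite family of extended counts is determined by the mixed moments of the
weights `2 ^ (-N)`. -/
theorem measure_enat_ext_of_moments {ι : Type*} [Fintype ι]
    {μ ν : Measure (ι → ℕ∞)} [IsFiniteMeasure μ] [IsFiniteMeasure ν]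
    (h : ∀ m : ι → ℕ, ∫ x, ∏ i, (halfPow (x i) : ℝ) ^ m i ∂μ =
      ∫ x, ∏ i, (halfPow (x i) : ℝ) ^ m i ∂ν) : μ = ν := by
  let Φ : (ι → ℕ∞) → (ι → unitInterval) := fun x i => halfPow (x i)
  have hΦ : Measurable Φ := measurable_pi_lambda _ fun i =>
    (measurable_of_countable halfPow).comp (measurable_pi_apply i)
  have hΦinj : Function.Injective Φ := fun x y hxy =>
    funext fun i => halfPow_injective (congrFun hxy i)
  have hmap : μ.map Φ = ν.map Φ := by
    refine measure_cube_ext_of_moments fun m => ?_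
    have hm : Measurable fun x : ι → unitInterval => ∏ i, (x i : ℝ) ^ m i := by fun_prop
    rw [integral_map hΦ.aemeasurable hm.aestronglyMeasurable,
      integral_map hΦ.aemeasurable hm.aestronglyMeasurable]
    exact h m
  ext s hs
  -- A finite power of `ℕ∞` is countable, so images under the injection `Φ` are measurable and
  -- equality can be pulled back.
  have hc : MeasurableSet (Φ '' s) := ((Set.to_countable s).image Φ).measurableSet
  have := congrArg (fun ρ => ρ (Φ '' s)) hmap
  simpa [Measure.map_apply hΦ hc, Set.preimage_image_eq s hΦinj] using this

/-- Two processes of extended counts with the same mixed moments of the weights `2 ^ (-N)` have the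
same law. -/
theorem identDistrib_of_moments {Ω Ω' T : Type*} [MeasurableSpace Ω] [MeasurableSpace Ω']
    {P : Measure Ω} {P' : Measure Ω'} [IsProbabilityMeasure P] [IsProbabilityMeasure P']
    {N : T → Ω → ℕ∞} {N' : T → Ω' → ℕ∞}
    (hN : AEMeasurable (fun ω v => N v ω) P) (hN' : AEMeasurable (fun ω v => N' v ω) P')
    (h : ∀ (I : Finset T) (m : I → ℕ), ∫ ω, ∏ i : I, (halfPow (N i ω) : ℝ) ^ m i ∂P =
      ∫ ω, ∏ i : I, (halfPow (N' i ω) : ℝ) ^ m i ∂P') :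
    IdentDistrib (fun ω v => N v ω) (fun ω v => N' v ω) P P' := by
  refine ⟨hN, hN', ?_⟩
  have h1 := isProjectiveLimit_map (X := N) hN
  have h2 := isProjectiveLimit_map (X := N') hN'
  have key : (fun I : Finset T => P.map (fun ω => I.restrict (fun v => N v ω))) =
      fun I : Finset T => P'.map (fun ω => I.restrict (fun v => N' v ω)) := by
    funext I
    have a1 : AEMeasurable (fun ω => I.restrict (fun v => N v ω)) P :=
      (Finset.measurable_restrict I).comp_aemeasurable hN
    have a2 : AEMeasurable (fun ω => I.restrict (fun v => N' v ω)) P' :=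
      (Finset.measurable_restrict I).comp_aemeasurable hN'
    have := Measure.isProbabilityMeasure_map a1
    have := Measure.isProbabilityMeasure_map a2
    refine measure_enat_ext_of_moments fun m => ?_
    have hm : Measurable fun x : I → ℕ∞ => ∏ i, (halfPow (x i) : ℝ) ^ m i :=
      measurable_of_countable _
    rw [integral_map a1 hm.aestronglyMeasurable, integral_map a2 hm.aestronglyMeasurable]
    exact h I m
  rw [key] at h1
  exact h1.unique h2

/-! ### Markov property of a jump chain with holding times. -/

lemma lintegral_eq_tsum_fiber {Ω : Type*} [MeasurableSpace Ω] {μ : Measure Ω} {Y : Ω → ℕ}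
    (hY : Measurable Y) (F : Ω → ℝ≥0∞) :
    ∫⁻ ω, F ω ∂μ = ∑' i, ∫⁻ ω in {ω | Y ω = i}, F ω ∂μ := by
  rw [← lintegral_iUnion (s := fun i => {ω | Y ω = i})
    (fun i => hY (measurableSet_singleton i))
    (fun i j hij => Set.disjoint_left.2 fun ω h1 h2 => hij (h1.symm.trans h2))]
  rw [show (⋃ i, {ω | Y ω = i}) = Set.univ from by ext; simp, setLIntegral_univ]

lemma measure_eq_tsum_fiber {Ω : Type*} [MeasurableSpace Ω] {μ : Measure Ω} {Y : Ω → ℕ}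
    (hY : Measurable Y) {A : Set Ω} (hA : MeasurableSet A) :
    μ A = ∑' i, μ (A ∩ {ω | Y ω = i}) := by
  have := lintegral_eq_tsum_fiber (μ := μ) hY (A.indicator 1)
  rw [lintegral_indicator_one hA] at this
  rw [this]
  exact tsum_congr fun i => by rw [lintegral_indicator_one hA, Measure.restrict_apply hA]

/-- Jump chain `Y` and holding times `H` of a Markov jump process started at `x₀`, with transition
probabilities `p i j` and law `κ i` of the holding time in state `i`. -/
structure IsJumpHold {Ω : Type*} [MeasurableSpace Ω] (P : Measure Ω) (x₀ : ℕ)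
    (p : ℕ → ℕ → ℝ≥0∞) (κ : ℕ → Measure ℝ≥0∞) (Y : ℕ → Ω → ℕ) (H : ℕ → Ω → ℝ≥0∞) : Prop where
  measurable_state : ∀ k, Measurable (Y k)
  measurable_hold : ∀ k, Measurable (H k)
  prob : ∀ (n : ℕ) (y : ℕ → ℕ) (t : ℕ → ℝ≥0),
    P {ω | Y 0 ω = y 0 ∧ ∀ k < n, (t k : ℝ≥0∞) < H k ω ∧ Y (k + 1) ω = y (k + 1)} =
      (if y 0 = x₀ then 1 else 0) *
        ∏ k ∈ Finset.range n, κ (y k) (Set.Ioi (t k)) * p (y k) (y (k + 1))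

/-- The event that, from step `n` on, the jump chain follows `y` for `m` steps, with holding times
larger than `t`. -/
def futureEvent {Ω : Type*} (Y : ℕ → Ω → ℕ) (H : ℕ → Ω → ℝ≥0∞) (n m : ℕ) (y : ℕ → ℕ)
    (t : ℕ → ℝ≥0) : Set Ω :=
  {ω | Y n ω = y 0 ∧ ∀ k < m, (t k : ℝ≥0∞) < H (n + k) ω ∧ Y (n + k + 1) ω = y (k + 1)}

lemma futureEvent_zero {Ω : Type*} (Y : ℕ → Ω → ℕ) (H : ℕ → Ω → ℝ≥0∞) (n : ℕ) (y : ℕ → ℕ)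
    (t : ℕ → ℝ≥0) : futureEvent Y H n 0 y t = {ω | Y n ω = y 0} := by
  simp [futureEvent]

/-- The `casesOn` sequences prepend one state and one threshold, so that the event splits off its
first step. -/
lemma futureEvent_succ {Ω : Type*} (Y : ℕ → Ω → ℕ) (H : ℕ → Ω → ℝ≥0∞) (n m i : ℕ) (s : ℝ≥0)
    (y : ℕ → ℕ) (t : ℕ → ℝ≥0) :
    futureEvent Y H n (m + 1) (fun k => Nat.casesOn k i y) (fun k => Nat.casesOn k s t) =
      {ω | Y n ω = i} ∩ {ω | (s : ℝ≥0∞) < H n ω} ∩ futureEvent Y H (n + 1) m y t := by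
  ext ω
  simp only [futureEvent, Set.mem_ofPred_eq, Set.mem_inter_iff, Nat.forall_lt_succ_left]
  simp only [add_zero, and_assoc]
  refine and_congr_right fun _ => and_congr_right fun _ => and_congr_right fun _ => ?_
  refine forall₂_congr fun k _ => ?_
  rw [show n + (k + 1) = n + 1 + k by ring]

namespace IsJumpHold

variable {Ω : Type*} [MeasurableSpace Ω] {P : Measure Ω} {x₀ : ℕ}
  {p : ℕ → ℕ → ℝ≥0∞} {κ : ℕ → Measure ℝ≥0∞} {Y : ℕ → Ω → ℕ} {H : ℕ → Ω → ℝ≥0∞}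

lemma measurableSet_futureEvent (h : IsJumpHold P x₀ p κ Y H) (n m : ℕ) (y : ℕ → ℕ)
    (t : ℕ → ℝ≥0) : MeasurableSet (futureEvent Y H n m y t) := by
  have hY := h.measurable_state
  have hH := h.measurable_hold
  refine (measurableSet_eq_fun (hY n) measurable_const).inter ?_
  change MeasurableSet {ω | ∀ k, k < m → (t k : ℝ≥0∞) < H (n + k) ω ∧ Y (n + k + 1) ω = y (k + 1)}
  simp only [Set.ofPred_forall]
  refine MeasurableSet.iInter fun k => MeasurableSet.iInter fun _ => ?_
  exact (measurableSet_lt measurable_const (hH _)).inter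
    (measurableSet_eq_fun (hY _) measurable_const)

/-- The future after step `n` depends on the past only through the state `Y n`. -/
def MarkovAt {E : Type*} [MeasurableSpace E] (P : Measure Ω) (p : ℕ → ℕ → ℝ≥0∞)
    (κ : ℕ → Measure ℝ≥0∞) (Y : ℕ → Ω → ℕ) (H : ℕ → Ω → ℝ≥0∞) (n : ℕ) (R : Ω → E) : Prop :=
  ∀ (S : Set E), MeasurableSet S → ∀ (m : ℕ) (y : ℕ → ℕ) (t : ℕ → ℝ≥0),
    P (R ⁻¹' S ∩ futureEvent Y H n m y t) = P (R ⁻¹' S ∩ {ω | Y n ω = y 0}) *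
      ∏ k ∈ Finset.range m, κ (y k) (Set.Ioi (t k)) * p (y k) (y (k + 1))

/-- At time `0` the past is trivial; this starts the induction whose step is `MarkovAt.succ`. -/
lemma markovAt_zero {E : Type*} [MeasurableSpace E] (h : IsJumpHold P x₀ p κ Y H) (e : E) :
    MarkovAt P p κ Y H 0 (fun _ => e) := by
  intro S _ m y t
  by_cases he : e ∈ S
  · have h0 := h.prob 0 y t
    have hm := h.prob m y t
    simp only [not_lt_zero, false_imp_iff, implies_true, and_true, Finset.range_zero,
      Finset.prod_empty, mul_one] at h0
    simp only [Set.preimage_const_of_mem he, Set.univ_inter]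
    rw [h0, ← hm]
    simp [futureEvent]
  · simp [Set.preimage_const_of_notMem he]

lemma MarkovAt.cons {E : Type*} [MeasurableSpace E] {n : ℕ} {R : Ω → E}
    (hR : MarkovAt P p κ Y H n R) {S : Set E} (hS : MeasurableSet S) (i m : ℕ) (s : ℝ≥0)
    (y : ℕ → ℕ) (t : ℕ → ℝ≥0) :
    P (R ⁻¹' S ∩ ({ω | Y n ω = i} ∩ {ω | (s : ℝ≥0∞) < H n ω} ∩ futureEvent Y H (n + 1) m y t)) =
      P (R ⁻¹' S ∩ {ω | Y n ω = i}) *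
        ((∏ k ∈ Finset.range m, κ (y k) (Set.Ioi (t k)) * p (y k) (y (k + 1))) *
          (κ i (Set.Ioi s) * p i (y 0))) := by
  have := hR S hS (m + 1) (fun k => Nat.casesOn k i y) (fun k => Nat.casesOn k s t)
  rw [futureEvent_succ, Finset.prod_range_succ'] at this
  exact this

variable [IsProbabilityMeasure P] [∀ i, IsProbabilityMeasure (κ i)]

/-- The prescribed probabilities only concern events `t < H`. Taking `t = 0` and summing over the
states before and after the step shows that these events lose no mass at `0`. -/
lemma MarkovAt.measure_pos {E : Type*} [MeasurableSpace E] (h : IsJumpHold P x₀ p κ Y H)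
    (hp : ∀ i, ∑' j, p i j = 1) (hκ : ∀ i, κ i {0} = 0) {n : ℕ} {R : Ω → E}
    (hR : MarkovAt P p κ Y H n R) : ∀ᵐ ω ∂P, 0 < H n ω := by
  have hY := h.measurable_state
  have hH := h.measurable_hold
  have hκ' : ∀ i, κ i (Set.Ioi 0) = 1 := fun i => by
    have : (Set.Ioi (0 : ℝ≥0∞)) = {0}ᶜ := by ext; simp [pos_iff_ne_zero]
    rw [this, prob_compl_eq_one_iff (measurableSet_singleton 0), hκ]
  have key : ∀ i, P ({ω | 0 < H n ω} ∩ {ω | Y n ω = i}) = P {ω | Y n ω = i} := by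
    intro i
    have hm : MeasurableSet ({ω | 0 < H n ω} ∩ {ω | Y n ω = i}) :=
      (measurableSet_lt measurable_const (hH _)).inter
        (measurableSet_eq_fun (hY _) measurable_const)
    rw [measure_eq_tsum_fiber (hY (n + 1)) hm]
    have hj : ∀ j, P ({ω | 0 < H n ω} ∩ {ω | Y n ω = i} ∩ {ω | Y (n + 1) ω = j}) =
        P {ω | Y n ω = i} * p i j := by
      intro j
      have := hR.cons MeasurableSet.univ i 0 0 (fun _ => j) fun _ => 0
      rw [futureEvent_zero] at this
      simp only [Set.preimage_univ, Set.univ_inter, Finset.prod_range_zero, ENNReal.coe_zero,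
        hκ', one_mul] at this
      rw [← this, Set.inter_comm {ω | 0 < H n ω}]
    simp_rw [hj]
    rw [ENNReal.tsum_mul_left, hp, mul_one]
  have : P {ω | 0 < H n ω} = 1 := by
    rw [measure_eq_tsum_fiber (hY n) (measurableSet_lt measurable_const (hH _))]
    simp_rw [key]
    have := measure_eq_tsum_fiber (μ := P) (hY n) MeasurableSet.univ
    simpa using this.symm
  rw [← prob_compl_eq_zero_iff (measurableSet_lt measurable_const (hH _))] at this
  exact this

/-- Given the state `i`, the past `R`, the holding time and the future are independent. The tails
`{s < H n}` together with the total mass determine the law of the holding time, and rectangles then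
determine the joint law. -/
lemma MarkovAt.prob_hold {E : Type*} [MeasurableSpace E] (h : IsJumpHold P x₀ p κ Y H)
    (hp : ∀ i, ∑' j, p i j = 1) (hκ : ∀ i, κ i {0} = 0) {n : ℕ} {R : Ω → E}
    (hRm : Measurable R) (hR : MarkovAt P p κ Y H n R) (i m : ℕ) (y : ℕ → ℕ) (t : ℕ → ℝ≥0) :
    (P.restrict ({ω | Y n ω = i} ∩ futureEvent Y H (n + 1) m y t)).map
        (fun ω => (R ω, H n ω)) =
      (p i (y 0) * ∏ k ∈ Finset.range m, κ (y k) (Set.Ioi (t k)) * p (y k) (y (k + 1))) •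
        (((P.restrict {ω | Y n ω = i}).map R).prod (κ i)) := by
  have hY := h.measurable_state
  have hH := h.measurable_hold
  have hYi : MeasurableSet {ω | Y n ω = i} := measurableSet_eq_fun (hY _) measurable_const
  have hF := h.measurableSet_futureEvent (n + 1) m y t
  set c := p i (y 0) * ∏ k ∈ Finset.range m, κ (y k) (Set.Ioi (t k)) * p (y k) (y (k + 1))
    with hc
  have hrect : ∀ S, MeasurableSet S → ∀ s : ℝ≥0,
      P (R ⁻¹' S ∩ {ω | Y n ω = i} ∩ futureEvent Y H (n + 1) m y t ∩ {ω | (s : ℝ≥0∞) < H n ω}) =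
      c * P (R ⁻¹' S ∩ {ω | Y n ω = i}) * κ i (Set.Ioi s) := by
    intro S hS s
    rw [show R ⁻¹' S ∩ {ω | Y n ω = i} ∩ futureEvent Y H (n + 1) m y t ∩ {ω | (s : ℝ≥0∞) < H n ω} =
      R ⁻¹' S ∩ ({ω | Y n ω = i} ∩ {ω | (s : ℝ≥0∞) < H n ω} ∩ futureEvent Y H (n + 1) m y t) by
        ext; simp only [Set.mem_inter_iff]; tauto]
    rw [hR.cons hS, hc]
    ring
  have hpos := hR.measure_pos h hp hκ
  have hgen : ∀ S, MeasurableSet S →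
      (P.restrict (R ⁻¹' S ∩ {ω | Y n ω = i} ∩ futureEvent Y H (n + 1) m y t)).map (H n) =
      (c * P (R ⁻¹' S ∩ {ω | Y n ω = i})) • κ i := by
    intro S hS
    set A := R ⁻¹' S ∩ {ω | Y n ω = i} ∩ futureEvent Y H (n + 1) m y t
    have hIoi : ∀ s : ℝ≥0, (P.restrict A).map (H n) (Set.Ioi s) =
        ((c * P (R ⁻¹' S ∩ {ω | Y n ω = i})) • κ i) (Set.Ioi s) := by
      intro s
      rw [Measure.map_apply (hH n) measurableSet_Ioi,
        Measure.restrict_apply (hH n measurableSet_Ioi), Measure.smul_apply, smul_eq_mul,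
        ← hrect S hS s, Set.inter_comm]
      rfl
    have huniv : (P.restrict A).map (H n) Set.univ =
        ((c * P (R ⁻¹' S ∩ {ω | Y n ω = i})) • κ i) Set.univ := by
      -- Neither measure charges `0`, so the tail beyond `0` already gives the total mass.
      have e : (Set.univ : Set ℝ≥0∞) = {0} ∪ Set.Ioi ((0 : ℝ≥0) : ℝ≥0∞) := by
        ext x; simp
      have z1 : (P.restrict A).map (H n) {0} = 0 := by
        rw [Measure.map_apply (hH n) (measurableSet_singleton 0)]
        refine Measure.restrict_le_self.absolutelyContinuous ?_
        rw [measure_eq_zero_iff_ae_notMem]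
        filter_upwards [hpos] with ω hω
        simpa using hω.ne'
      have z2 : ((c * P (R ⁻¹' S ∩ {ω | Y n ω = i})) • κ i) {0} = 0 := by
        simp [hκ]
      rw [e, measure_union (by simp) measurableSet_Ioi, measure_union (by simp) measurableSet_Ioi,
        z1, z2, hIoi]
    have hfin : IsFiniteMeasure ((P.restrict A).map (H n)) := by infer_instance
    have hfin' : IsFiniteMeasure ((c * P (R ⁻¹' S ∩ {ω | Y n ω = i})) • κ i) :=
      ⟨by rw [← huniv]; exact measure_lt_top _ _⟩
    refine Measure.ext_of_Iic _ _ fun a => ?_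
    induction a using ENNReal.recTopCoe with
    | top => simpa only [Set.Iic_top] using huniv
    | coe s =>
      rw [← Set.compl_Ioi, measure_compl measurableSet_Ioi (measure_ne_top _ _),
        measure_compl measurableSet_Ioi (measure_ne_top _ _), huniv, hIoi]
  have hcfin : c * P {ω | Y n ω = i} ≠ ⊤ := by
    have := congrArg (fun μ => μ Set.univ) (hgen Set.univ MeasurableSet.univ)
    simp only [Set.preimage_univ, Set.univ_inter, Measure.smul_apply, measure_univ,
      smul_eq_mul, mul_one] at this
    rw [← this]
    exact measure_ne_top _ _
  rw [← Measure.prod_smul_left]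
  have : IsFiniteMeasure (c • (P.restrict {ω | Y n ω = i}).map R) := ⟨by
    rw [Measure.smul_apply, Measure.map_apply hRm MeasurableSet.univ, smul_eq_mul]
    simpa using hcfin.lt_top⟩
  symm
  refine Measure.prod_eq fun S B hS hB => ?_
  have := congrArg (fun μ => μ B) (hgen S hS)
  simp only [Measure.smul_apply, smul_eq_mul] at this
  rw [Measure.map_apply (hH n) hB, Measure.restrict_apply (hH n hB)] at this
  rw [Measure.map_apply (hRm.prodMk (hH n)) (hS.prod hB),
    Measure.restrict_apply ((hRm.prodMk (hH n)) (hS.prod hB)), Measure.smul_apply,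
    Measure.map_apply hRm hS, Measure.restrict_apply (hRm hS), smul_eq_mul, ← this]
  congr 1
  ext ω
  simp only [Set.mem_inter_iff, Set.mem_preimage, Set.mem_prod]
  tauto

/-- A summary of the past may be updated by any measurable function of itself, the holding time and
the two states around the step. Recursively built quantities such as collected weights and jump
times are thereby covered. -/
lemma MarkovAt.succ {E : Type*} [MeasurableSpace E] (h : IsJumpHold P x₀ p κ Y H)
    (hp : ∀ i, ∑' j, p i j = 1) (hκ : ∀ i, κ i {0} = 0) {n : ℕ} {R : Ω → E}
    (hRm : Measurable R) (hR : MarkovAt P p κ Y H n R) {G : ℕ → ℕ → E × ℝ≥0∞ → E}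
    (hG : ∀ i j, Measurable (G i j)) :
    MarkovAt P p κ Y H (n + 1) (fun ω => G (Y n ω) (Y (n + 1) ω) (R ω, H n ω)) := by
  intro S hS m y t
  have hY := h.measurable_state
  have hH := h.measurable_hold
  have hRH : Measurable fun ω => (R ω, H n ω) := hRm.prodMk (hH n)
  have hF := h.measurableSet_futureEvent (n + 1) m y t
  have hYm : ∀ k i, MeasurableSet {ω | Y k ω = i} :=
    fun k i => measurableSet_eq_fun (hY _) measurable_const
  have hGm : Measurable fun ω => G (Y n ω) (Y (n + 1) ω) (R ω, H n ω) := by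
    have : Measurable fun q : (ℕ × ℕ) × (E × ℝ≥0∞) => G q.1.1 q.1.2 q.2 :=
      measurable_from_prod_countable_right fun q => hG q.1 q.2
    exact this.comp (((hY n).prodMk (hY (n + 1))).prodMk hRH)
  rw [measure_eq_tsum_fiber (hY n) ((hGm hS).inter hF),
    measure_eq_tsum_fiber (hY n) ((hGm hS).inter (hYm _ _)), ← ENNReal.tsum_mul_right]
  refine tsum_congr fun i => ?_
  have key := hR.prob_hold h hp hκ hRm i
  have k1 := congrArg (fun μ => μ (G i (y 0) ⁻¹' S)) (key m y t)
  have k0 := congrArg (fun μ => μ (G i (y 0) ⁻¹' S)) (key 0 y t)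
  simp only [Measure.smul_apply, smul_eq_mul, Finset.range_zero, Finset.prod_empty, mul_one,
    futureEvent_zero] at k1 k0
  rw [Measure.map_apply hRH (hG _ _ hS), Measure.restrict_apply (hRH (hG _ _ hS))] at k1 k0
  -- On fixed states `i` and `y 0` the update is the single function `G i (y 0)`, to which the joint
  -- law applies.
  have e1 : (fun ω => G (Y n ω) (Y (n + 1) ω) (R ω, H n ω)) ⁻¹' S ∩
      futureEvent Y H (n + 1) m y t ∩ {ω | Y n ω = i} =
      (fun ω => (R ω, H n ω)) ⁻¹' (G i (y 0) ⁻¹' S) ∩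
        ({ω | Y n ω = i} ∩ futureEvent Y H (n + 1) m y t) := by
    ext ω
    simp only [Set.mem_inter_iff, Set.mem_preimage, Set.mem_ofPred_eq, futureEvent]
    constructor
    · rintro ⟨⟨h1, h2, h3⟩, h4⟩; subst h4; rw [h2] at h1; exact ⟨h1, rfl, h2, h3⟩
    · rintro ⟨h1, h4, h2, h3⟩; subst h4; rw [h2]; exact ⟨⟨h1, rfl, h3⟩, rfl⟩
  have e0 : (fun ω => G (Y n ω) (Y (n + 1) ω) (R ω, H n ω)) ⁻¹' S ∩
      {ω | Y (n + 1) ω = y 0} ∩ {ω | Y n ω = i} =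
      (fun ω => (R ω, H n ω)) ⁻¹' (G i (y 0) ⁻¹' S) ∩
        ({ω | Y n ω = i} ∩ {ω | Y (n + 1) ω = y 0}) := by
    ext ω
    simp only [Set.mem_inter_iff, Set.mem_preimage, Set.mem_ofPred_eq]
    constructor
    · rintro ⟨⟨h1, h2⟩, h4⟩; subst h4; rw [h2] at h1; exact ⟨h1, rfl, h2⟩
    · rintro ⟨h1, h4, h2⟩; subst h4; rw [h2]; exact ⟨⟨h1, rfl⟩, rfl⟩
  rw [e1, e0, k1, k0]
  ring

/-- One-step conditioning on the past of the jump chain. -/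
lemma MarkovAt.lintegral_step {E : Type*} [MeasurableSpace E] (h : IsJumpHold P x₀ p κ Y H)
    (hp : ∀ i, ∑' j, p i j = 1) (hκ : ∀ i, κ i {0} = 0) {n : ℕ} {R : Ω → E}
    (hRm : Measurable R) (hR : MarkovAt P p κ Y H n R) {F : ℕ → ℕ → E × ℝ≥0∞ → ℝ≥0∞}
    (hF : ∀ i j, Measurable (F i j)) :
    ∫⁻ ω, F (Y n ω) (Y (n + 1) ω) (R ω, H n ω) ∂P =
      ∫⁻ ω, ∑' j, p (Y n ω) j * ∫⁻ s, F (Y n ω) j (R ω, s) ∂κ (Y n ω) ∂P := by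
  have hY := h.measurable_state
  have hH := h.measurable_hold
  have hYm : ∀ k i, MeasurableSet {ω | Y k ω = i} :=
    fun k i => measurableSet_eq_fun (hY _) measurable_const
  have hRH : Measurable fun ω => (R ω, H n ω) := hRm.prodMk (hH n)
  have hint : ∀ i j, Measurable fun e => ∫⁻ s, F i j (e, s) ∂κ i :=
    fun i j => (hF i j).lintegral_prod_right'
  rw [lintegral_eq_tsum_fiber (hY n), lintegral_eq_tsum_fiber (hY n)]
  refine tsum_congr fun i => ?_
  have r1 : ∫⁻ ω in {ω | Y n ω = i}, ∑' j, p (Y n ω) j * ∫⁻ s, F (Y n ω) j (R ω, s) ∂κ (Y n ω) ∂P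
      = ∑' j, p i j * ∫⁻ ω in {ω | Y n ω = i}, ∫⁻ s, F i j (R ω, s) ∂κ i ∂P := by
    rw [setLIntegral_congr_fun (g := fun ω => ∑' j, p i j * ∫⁻ s, F i j (R ω, s) ∂κ i) (hYm n i)
      (fun ω (hω : Y n ω = i) => by simp only [hω])]
    have hm : ∀ j, Measurable fun ω => p i j * ∫⁻ s, F i j (R ω, s) ∂κ i :=
      fun j => ((hint i j).comp hRm).const_mul _
    rw [lintegral_tsum fun j => (hm j).aemeasurable]
    exact tsum_congr fun j => lintegral_const_mul _ ((hint i j).comp hRm)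
  rw [r1, lintegral_eq_tsum_fiber (hY (n + 1))]
  refine tsum_congr fun j => ?_
  rw [Measure.restrict_restrict (hYm _ _), Set.inter_comm]
  rw [setLIntegral_congr_fun (g := fun ω => F i j (R ω, H n ω)) ((hYm _ _).inter (hYm _ _))
    (fun ω (hω : Y n ω = i ∧ Y (n + 1) ω = j) => by simp only [hω])]
  have key := hR.prob_hold h hp hκ hRm i 0 (fun _ => j) (fun _ => 0)
  rw [futureEvent_zero] at key
  simp only [Finset.range_zero, Finset.prod_empty, mul_one] at key
  rw [← lintegral_map (hF i j) hRH, key, lintegral_smul_measure, smul_eq_mul,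
    lintegral_prod _ (hF i j).aemeasurable, lintegral_map (hint i j) hRm]

end IsJumpHold

/-! ### The Riccati equation for the walk. -/

/-- A measurable weight function with values in `[0, 1]`, equal to `1` beyond `V` and continuous
off a countable set. -/
structure IsWeight (g : ℝ → ℝ) (V : ℝ) : Prop where
  measurable : Measurable g
  nonneg : ∀ x, 0 ≤ g x
  le_one : ∀ x, g x ≤ 1
  eq_one : ∀ x, V < x → g x = 1
  horizon_nonneg : 0 ≤ V
  countable_discontinuities : ∃ C : Set ℝ, C.Countable ∧ ∀ x ∉ C, ContinuousAt g x

lemma intervalIntegrable_of_bounded_unit {h : ℝ → ℝ} (hm : Measurable h) (h0 : ∀ x, 0 ≤ h x)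
    (h1 : ∀ x, h x ≤ 1) (a b : ℝ) : IntervalIntegrable h volume a b := by
  refine (intervalIntegrable_const (c := (1 : ℝ))).mono_fun hm.aestronglyMeasurable ?_
  exact Eventually.of_forall fun x => by
    simpa [abs_of_nonneg (h0 x)] using h1 x

section Riccati

variable {g h : ℝ → ℝ} {V : ℝ}

/-- The value of the process started with a downward jump. -/
noncomputable def downValue (h : ℝ → ℝ) (x : ℝ) : ℝ :=
  Real.exp (-x) * (1 + ∫ y in (0 : ℝ)..x, Real.exp y * h y)

/-- The value of the process started with an upward jump. -/
noncomputable def upValue (h : ℝ → ℝ) (x : ℝ) : ℝ :=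
  Real.exp x * ((∫ y in Set.Ioi (0 : ℝ), Real.exp (-y) * h y) -
    ∫ y in (0 : ℝ)..x, Real.exp (-y) * h y)

lemma intervalIntegrable_exp_mul (hm : Measurable h) (h0 : ∀ x, 0 ≤ h x) (h1 : ∀ x, h x ≤ 1)
    (a b : ℝ) : IntervalIntegrable (fun y => Real.exp y * h y) volume a b :=
  (intervalIntegrable_of_bounded_unit hm h0 h1 a b).continuousOn_mul (by fun_prop)

lemma intervalIntegrable_exp_neg_mul (hm : Measurable h) (h0 : ∀ x, 0 ≤ h x) (h1 : ∀ x, h x ≤ 1)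
    (a b : ℝ) : IntervalIntegrable (fun y => Real.exp (-y) * h y) volume a b :=
  (intervalIntegrable_of_bounded_unit hm h0 h1 a b).continuousOn_mul (by fun_prop)

lemma continuous_downValue (hm : Measurable h) (h0 : ∀ x, 0 ≤ h x) (h1 : ∀ x, h x ≤ 1) :
    Continuous (downValue h) :=
  (by fun_prop : Continuous fun x : ℝ => Real.exp (-x)).mul
    (continuous_const.add (intervalIntegral.continuous_primitive
      (intervalIntegrable_exp_mul hm h0 h1) 0))

lemma continuous_upValue (hm : Measurable h) (h0 : ∀ x, 0 ≤ h x) (h1 : ∀ x, h x ≤ 1) :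
    Continuous (upValue h) :=
  Real.continuous_exp.mul
    (continuous_const.sub (intervalIntegral.continuous_primitive
      (intervalIntegrable_exp_neg_mul hm h0 h1) 0))

lemma hasDerivAt_downValue (hm : Measurable h) (h0 : ∀ x, 0 ≤ h x) (h1 : ∀ x, h x ≤ 1) {x : ℝ}
    (hx : ContinuousAt h x) : HasDerivAt (downValue h) (-downValue h x + h x) x := by
  have hI : HasDerivAt (fun x => ∫ y in (0 : ℝ)..x, Real.exp y * h y) (Real.exp x * h x) x :=
    intervalIntegral.integral_hasDerivAt_right (intervalIntegrable_exp_mul hm h0 h1 0 x)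
      (by exact (by fun_prop : Measurable fun y => Real.exp y * h y).stronglyMeasurable.stronglyMeasurableAtFilter)
      (Real.continuous_exp.continuousAt.mul hx)
  have hE : HasDerivAt (fun x : ℝ => Real.exp (-x)) (-Real.exp (-x)) x := by
    simpa using (hasDerivAt_neg x).exp
  refine (hE.mul (hI.const_add 1)).congr_deriv ?_
  have : Real.exp (-x) * Real.exp x = 1 := by rw [← Real.exp_add]; simp
  simp only [downValue]
  linear_combination (h x) * this

lemma hasDerivAt_upValue (hm : Measurable h) (h0 : ∀ x, 0 ≤ h x) (h1 : ∀ x, h x ≤ 1) {x : ℝ}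
    (hx : ContinuousAt h x) : HasDerivAt (upValue h) (upValue h x - h x) x := by
  have hI : HasDerivAt (fun x => ∫ y in (0 : ℝ)..x, Real.exp (-y) * h y)
      (Real.exp (-x) * h x) x :=
    intervalIntegral.integral_hasDerivAt_right (intervalIntegrable_exp_neg_mul hm h0 h1 0 x)
      (by exact (by fun_prop : Measurable fun y => Real.exp (-y) * h y).stronglyMeasurable.stronglyMeasurableAtFilter)
      ((by fun_prop : Continuous fun y : ℝ => Real.exp (-y)).continuousAt.mul hx)
  refine ((Real.hasDerivAt_exp x).mul (hI.const_sub _)).congr_deriv ?_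
  have : Real.exp (-x) * Real.exp x = 1 := by rw [← Real.exp_add]; simp
  simp only [upValue]
  linear_combination (-h x) * this

lemma integrableOn_exp_neg_mul (hm : Measurable h) (h0 : ∀ x, 0 ≤ h x) (h1 : ∀ x, h x ≤ 1)
    (a : ℝ) : IntegrableOn (fun y => Real.exp (-y) * h y) (Set.Ioi a) := by
  refine Integrable.mono' (integrableOn_exp_neg_Ioi a)
    (by fun_prop : Measurable fun y => Real.exp (-y) * h y).aestronglyMeasurable
    (Eventually.of_forall fun y => ?_)
  rw [Real.norm_of_nonneg (mul_nonneg (Real.exp_pos _).le (h0 y))]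
  exact mul_le_of_le_one_right (Real.exp_pos _).le (h1 y)

/-- This is the mean of `h` at `x` plus a standard exponential variable. The definition uses
integrals from `0` because that form can be differentiated directly. -/
lemma upValue_eq (hm : Measurable h) (h0 : ∀ x, 0 ≤ h x) (h1 : ∀ x, h x ≤ 1) {x : ℝ}
    (hx : 0 ≤ x) : upValue h x = Real.exp x * ∫ y in Set.Ioi x, Real.exp (-y) * h y := by
  rw [upValue, intervalIntegral.integral_of_le hx, ← Set.Ioc_union_Ioi_eq_Ioi hx,
    setIntegral_union (Set.Ioc_disjoint_Ioi le_rfl) measurableSet_Ioi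
      ((integrableOn_exp_neg_mul hm h0 h1 0).mono_set Set.Ioc_subset_Ioi_self)
      (integrableOn_exp_neg_mul hm h0 h1 x)]
  ring_nf

lemma upValue_nonneg (hm : Measurable h) (h0 : ∀ x, 0 ≤ h x) (h1 : ∀ x, h x ≤ 1) {x : ℝ}
    (hx : 0 ≤ x) : 0 ≤ upValue h x := by
  rw [upValue_eq hm h0 h1 hx]
  exact mul_nonneg (Real.exp_pos _).le
    (integral_nonneg fun y => mul_nonneg (Real.exp_pos _).le (h0 y))

lemma downValue_pos (h0 : ∀ x, 0 ≤ h x) {x : ℝ} (hx : 0 ≤ x) : 0 < downValue h x := by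
  have : 0 ≤ ∫ y in (0 : ℝ)..x, Real.exp y * h y :=
    intervalIntegral.integral_nonneg hx fun y _ => mul_nonneg (Real.exp_pos _).le (h0 y)
  exact mul_pos (Real.exp_pos _) (by linarith)

lemma downValue_le_one (hm : Measurable h) (h0 : ∀ x, 0 ≤ h x) (h1 : ∀ x, h x ≤ 1) {x : ℝ}
    (hx : 0 ≤ x) : downValue h x ≤ 1 := by
  have : ∫ y in (0 : ℝ)..x, Real.exp y * h y ≤ ∫ y in (0 : ℝ)..x, Real.exp y :=
    intervalIntegral.integral_mono_on hx (intervalIntegrable_exp_mul hm h0 h1 0 x)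
      (by simp) fun y _ => mul_le_of_le_one_right (Real.exp_pos _).le (h1 y)
  rw [integral_exp, Real.exp_zero] at this
  calc downValue h x ≤ Real.exp (-x) * Real.exp x :=
        mul_le_mul_of_nonneg_left (by linarith) (Real.exp_pos _).le
    _ = 1 := by rw [← Real.exp_add]; simp

/-- The ratio of the two values solves a Riccati equation with terminal value `1`. -/
theorem riccati_of_fixedPoint (hg : IsWeight g V) (hm : Measurable h) (h0 : ∀ x, 0 ≤ h x)
    (h1 : ∀ x, h x ≤ 1)
    (hfix : ∀ x, 0 ≤ x → h x = g x * ((downValue h x + upValue h x) / 2)) :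
    ContinuousOn (fun x => upValue h x / downValue h x) (Set.Icc 0 V) ∧
    upValue h V / downValue h V = 1 ∧
    (∀ x ∈ Set.Icc 0 V, 0 ≤ upValue h x / downValue h x ∧ upValue h x / downValue h x ≤ 1) ∧
    ∃ C : Set ℝ, C.Countable ∧ ∀ x ∈ Set.Ioo 0 V \ C,
      HasDerivAt (fun x => upValue h x / downValue h x)
        (2 * (upValue h x / downValue h x) -
          g x * (1 + upValue h x / downValue h x) ^ 2 / 2) x := by
  obtain ⟨C, hC, hgC⟩ := hg.countable_discontinuities
  have cα := continuous_downValue hm h0 h1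
  have cβ := continuous_upValue hm h0 h1
  -- The fixed-point equation writes `h` as `g` times a continuous function, so `h` inherits the
  -- continuity points of `g`.
  have hcont : ∀ x, 0 < x → x ∉ C → ContinuousAt h x := by
    intro x hx hxC
    have : ContinuousAt (fun x => g x * ((downValue h x + upValue h x) / 2)) x :=
      (hgC x hxC).mul ((cα.add cβ).div_const 2).continuousAt
    refine this.congr ?_
    filter_upwards [lt_mem_nhds hx] with y hy
    exact (hfix y hy.le).symm
  have dα := fun x hx hxC => hasDerivAt_downValue hm h0 h1 (hcont x hx hxC)
  have dβ := fun x hx hxC => hasDerivAt_upValue hm h0 h1 (hcont x hx hxC)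
  have gI := intervalIntegrable_of_bounded_unit hg.measurable hg.nonneg hg.le_one
  -- Since `2 h = g (down + up)`, the derivative of `up - down` is `(down + up) (1 - g)`. It
  -- vanishes beyond `V` and is nonnegative before, which yields the terminal value and the bound
  -- `up ≤ down`.
  have diff : ∀ a b, 0 ≤ a → a ≤ b →
      ∫ x in a..b, (downValue h x + upValue h x) * (1 - g x) =
        (upValue h b - downValue h b) - (upValue h a - downValue h a) := by
    intro a b ha hab
    refine integral_eq_of_hasDerivAt_off_countable_of_le
      (fun x => upValue h x - downValue h x) _ hab hC (cβ.sub cα).continuousOn ?_ ?_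
    · rintro x ⟨hx, hxC⟩
      have hx0 : 0 < x := ha.trans_lt hx.1
      refine ((dβ x hx0 hxC).sub (dα x hx0 hxC)).congr_deriv ?_
      linear_combination (-2) * hfix x hx0.le
    · exact ((intervalIntegrable_const (c := (1 : ℝ))).sub (gI a b)).continuousOn_mul
        (cα.add cβ).continuousOn
  have hV := hg.horizon_nonneg
  have hterm : upValue h V = downValue h V := by
    set c := upValue h V - downValue h V with hc
    have hconst : ∀ b, V ≤ b → upValue h b - downValue h b = c := by
      intro b hb
      have := diff V b hV hb
      rw [intervalIntegral.integral_of_le hb, setIntegral_congr_fun (g := fun _ => (0 : ℝ))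
        measurableSet_Ioc (fun x hx => by simp [hg.eq_one x hx.1])] at this
      simp only [integral_zero] at this
      linarith
    -- Beyond `V` the slope of `down` is the constant `c / 2`, which boundedness of `down` forces to
    -- be zero.
    have hlin : ∀ b, V ≤ b → downValue h b - downValue h V = c / 2 * (b - V) := by
      intro b hb
      have := integral_eq_of_hasDerivAt_off_countable_of_le (downValue h) (fun _ => c / 2) hb hC
        cα.continuousOn (fun x ⟨hx, hxC⟩ => by
          have hx0 : 0 < x := hV.trans_lt hx.1
          refine (dα x hx0 hxC).congr_deriv ?_
          rw [hfix x hx0.le, hg.eq_one x hx.1, ← hconst x hx.1.le]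
          ring) (by simp)
      rw [← this]
      simp; ring
    have hbd : ∀ b, 0 ≤ b → |downValue h b| ≤ 1 := fun b hb => by
      rw [abs_of_pos (downValue_pos h0 hb)]; exact downValue_le_one hm h0 h1 hb
    have : c = 0 := by
      by_contra hne
      -- The length `6 / |c|` makes the change of `down` equal to `3` in absolute value, while two
      -- values in `[0, 1]` cannot differ that much.
      have hb := hlin (V + 6 / |c|) (by have := abs_pos.2 hne; linarith [div_pos (by norm_num : (0:ℝ) < 6) this])
      have b1 := hbd (V + 6 / |c|) (by positivity)
      have b2 := hbd V hV
      have hb' : |c / 2 * (V + 6 / |c| - V)| = 3 := by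
        rw [add_sub_cancel_left, abs_mul, abs_div, abs_div, abs_abs]
        have := abs_pos.2 hne
        field_simp
        norm_num
      rw [← hb] at hb'
      have := abs_sub (downValue h (V + 6 / |c|)) (downValue h V)
      linarith
    linarith
  have hle : ∀ x ∈ Set.Icc 0 V, upValue h x ≤ downValue h x := by
    intro x hx
    have := diff x V hx.1 hx.2
    have hnn : 0 ≤ ∫ x in x..V, (downValue h x + upValue h x) * (1 - g x) :=
      intervalIntegral.integral_nonneg hx.2 fun y hy =>
        mul_nonneg (add_nonneg (downValue_pos h0 (hx.1.trans hy.1)).le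
          (upValue_nonneg hm h0 h1 (hx.1.trans hy.1))) (by linarith [hg.le_one y])
    linarith
  refine ⟨?_, ?_, ?_, C, hC, ?_⟩
  · exact cβ.continuousOn.div cα.continuousOn fun x hx => (downValue_pos h0 hx.1).ne'
  · rw [hterm, div_self (downValue_pos h0 hV).ne']
  · intro x hx
    have := downValue_pos h0 hx.1
    exact ⟨div_nonneg (upValue_nonneg hm h0 h1 hx.1) this.le, (div_le_one this).2 (hle x hx)⟩
  · rintro x ⟨hx, hxC⟩
    have hpos := downValue_pos h0 hx.1.le
    refine ((dβ x hx.1 hxC).div (dα x hx.1 hxC) hpos.ne').congr_deriv ?_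
    rw [hfix x hx.1.le]
    field_simp
    ring

end Riccati

/-! ### The Laplace walk killed on becoming negative. -/

lemma integrable_laplace_density : Integrable fun z : ℝ => 1 / 2 * Real.exp (-|z|) := by
  refine Integrable.const_mul ?_ _
  rw [← integrableOn_univ, ← Set.Iic_union_Ioi (a := (0 : ℝ))]
  refine IntegrableOn.union ?_ ?_
  · refine (integrableOn_exp_Iic 0).congr_fun (fun z hz => ?_) measurableSet_Iic
    simp only [abs_of_nonpos (Set.mem_Iic.1 hz), neg_neg]
  · refine (integrableOn_exp_neg_Ioi 0).congr_fun (fun z hz => ?_) measurableSet_Ioi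
    simp only [abs_of_pos (Set.mem_Ioi.1 hz)]

lemma integral_laplace_density : ∫ z : ℝ, 1 / 2 * Real.exp (-|z|) = 1 := by
  rw [← intervalIntegral.integral_Iic_add_Ioi (b := 0) integrable_laplace_density.integrableOn
    integrable_laplace_density.integrableOn,
    setIntegral_congr_fun (g := fun z => 1 / 2 * Real.exp z) measurableSet_Iic
      (fun z hz => by simp only [abs_of_nonpos (Set.mem_Iic.1 hz), neg_neg]),
    setIntegral_congr_fun (g := fun z => 1 / 2 * Real.exp (-z)) measurableSet_Ioi
      (fun z hz => by simp only [abs_of_pos (Set.mem_Ioi.1 hz)]),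
    integral_const_mul, integral_const_mul, integral_exp_Iic_zero, integral_exp_neg_Ioi_zero]
  norm_num

instance : IsProbabilityMeasure laplaceMeasure := ⟨by
  rw [laplaceMeasure, withDensity_apply _ MeasurableSet.univ, setLIntegral_univ,
    ← ofReal_integral_eq_lintegral_ofReal integrable_laplace_density
      (Eventually.of_forall fun z => by positivity), integral_laplace_density, ENNReal.ofReal_one]⟩

lemma lintegral_laplaceMeasure {f : ℝ → ℝ≥0∞} (hf : Measurable f) :
    ∫⁻ y, f y ∂laplaceMeasure = ∫⁻ y, ENNReal.ofReal (1 / 2 * Real.exp (-|y|)) * f y := by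
  rw [laplaceMeasure, lintegral_withDensity_eq_lintegral_mul _ (by fun_prop) hf]
  rfl

lemma lintegral_laplaceMeasure_add {f : ℝ → ℝ≥0∞} (hf : Measurable f) (x : ℝ) :
    ∫⁻ y, f (x + y) ∂laplaceMeasure =
      ∫⁻ z, ENNReal.ofReal (1 / 2 * Real.exp (-|z - x|)) * f z := by
  rw [lintegral_laplaceMeasure (f := fun y => f (x + y)) (hf.comp (measurable_const_add x)),
    ← lintegral_add_left_eq_self (fun z => ENNReal.ofReal (1 / 2 * Real.exp (-|z - x|)) * f z) x]
  simp

/-- The weight collected during the first `n` steps by the walk started at `x` with increments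
`s`, killed when it becomes negative. -/
noncomputable def walkWeight (g : ℝ → ℝ) : ℕ → ℝ → (ℕ → ℝ) → ℝ≥0∞
  | 0, _, _ => 1
  | n + 1, x, s => if x + s 0 < 0 then 1 else
      ENNReal.ofReal (g (x + s 0)) * walkWeight g n (x + s 0) fun i => s (i + 1)

/-- The expectation of `walkWeight g n x` under Laplace increments. -/
noncomputable def walkValue (g : ℝ → ℝ) : ℕ → ℝ → ℝ≥0∞
  | 0, _ => 1
  | n + 1, x => ∫⁻ y, (if x + y < 0 then 1 else
      ENNReal.ofReal (g (x + y)) * walkValue g n (x + y)) ∂laplaceMeasure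

section Walk

variable {g : ℝ → ℝ} {V : ℝ}

lemma measurable_walkWeight (hg : Measurable g) (n : ℕ) :
    Measurable fun q : ℝ × (ℕ → ℝ) => walkWeight g n q.1 q.2 := by
  induction n with
  | zero => exact measurable_const
  | succ n ih =>
    have h0 : Measurable fun q : ℝ × (ℕ → ℝ) => q.1 + q.2 0 := by fun_prop
    refine Measurable.ite (measurableSet_lt h0 measurable_const) measurable_const ?_
    refine (hg.comp h0).ennreal_ofReal.mul ?_
    have h1 : Measurable fun q : ℝ × (ℕ → ℝ) => (q.1 + q.2 0, fun i => q.2 (i + 1)) := by fun_prop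
    exact ih.comp h1

lemma measurable_killed (hg : Measurable g) {u : ℝ → ℝ≥0∞} (hu : Measurable u) :
    Measurable fun y => if y < 0 then 1 else ENNReal.ofReal (g y) * u y :=
  Measurable.ite measurableSet_Iio measurable_const (hg.ennreal_ofReal.mul hu)

lemma measurable_walkValue (hg : Measurable g) (n : ℕ) : Measurable (walkValue g n) := by
  induction n with
  | zero => exact measurable_const
  | succ n ih =>
    have : Measurable fun q : ℝ × ℝ => if q.1 + q.2 < 0 then (1 : ℝ≥0∞) else
        ENNReal.ofReal (g (q.1 + q.2)) * walkValue g n (q.1 + q.2) :=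
      (measurable_killed hg ih).comp (by fun_prop : Measurable fun q : ℝ × ℝ => q.1 + q.2)
    exact this.lintegral_prod_right'

lemma walkValue_le_one (hg1 : ∀ x, g x ≤ 1) (n : ℕ) (x : ℝ) : walkValue g n x ≤ 1 := by
  induction n generalizing x with
  | zero => exact le_rfl
  | succ n ih =>
    calc walkValue g (n + 1) x ≤ ∫⁻ _, 1 ∂laplaceMeasure := by
          refine lintegral_mono fun y => ?_
          dsimp only
          split_ifs
          · exact le_rfl
          · exact mul_le_one' (by simpa using hg1 _) (ih _)
      _ = 1 := by simp

lemma walkValue_antitone (hg1 : ∀ x, g x ≤ 1) (x : ℝ) : Antitone fun n => walkValue g n x := by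
  refine antitone_nat_of_succ_le fun n => ?_
  induction n generalizing x with
  | zero => exact walkValue_le_one hg1 1 x
  | succ n ih =>
    refine lintegral_mono fun y => ?_
    dsimp only
    split_ifs
    · exact le_rfl
    · gcongr
      exact ih _

/-- The limit of `walkValue g n` as `n` tends to infinity. -/
noncomputable def walkLimit (g : ℝ → ℝ) (x : ℝ) : ℝ≥0∞ := ⨅ n, walkValue g n x

lemma measurable_walkLimit (hg : Measurable g) : Measurable (walkLimit g) :=
  Measurable.iInf fun n => measurable_walkValue hg n

lemma walkLimit_le_one (g : ℝ → ℝ) (x : ℝ) : walkLimit g x ≤ 1 := iInf_le _ 0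

/-- The affine form `b + a * u` serves both the fixed-point equation, where `b` is the indicator of
being killed, and the first step restricted to nonnegative values, where `b = 0`. -/
lemma tendsto_lintegral_walkValue (hg : Measurable g) (hg1 : ∀ x, g x ≤ 1) {μ : Measure ℝ}
    [IsFiniteMeasure μ] {a b : ℝ → ℝ≥0∞} (ha : Measurable a) (ha1 : ∀ y, a y ≤ 1)
    (hb : Measurable b) (hb1 : ∀ y, b y ≤ 1) (x : ℝ) :
    Tendsto (fun n => ∫⁻ y, (b y + a y * walkValue g n (x + y)) ∂μ) atTop
      (𝓝 (∫⁻ y, (b y + a y * walkLimit g (x + y)) ∂μ)) := by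
  refine tendsto_lintegral_of_dominated_convergence (fun _ => 2) (fun n => ?_) (fun n => ?_) ?_ ?_
  · exact hb.add (ha.mul ((measurable_walkValue hg n).comp (measurable_const_add x)))
  · refine Eventually.of_forall fun y => ?_
    calc b y + a y * walkValue g n (x + y) ≤ 1 + 1 * 1 := by
          gcongr
          exacts [hb1 y, ha1 y, walkValue_le_one hg1 n _]
      _ = 2 := by norm_num
  · simp only [lintegral_const]
    exact ENNReal.mul_ne_top (by norm_num) (measure_ne_top μ _)
  · refine Eventually.of_forall fun y => ?_
    refine Tendsto.const_add _ (ENNReal.Tendsto.const_mul ?_ (Or.inr ?_))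
    · exact tendsto_atTop_iInf (walkValue_antitone hg1 _)
    · exact ((ha1 y).trans_lt ENNReal.one_lt_top).ne

lemma killed_eq (g : ℝ → ℝ) (u : ℝ → ℝ≥0∞) (z : ℝ) :
    (if z < 0 then 1 else ENNReal.ofReal (g z) * u z) =
      (if z < 0 then 1 else 0) + (if z < 0 then 0 else ENNReal.ofReal (g z)) * u z := by
  split_ifs <;> simp

lemma walkLimit_fixedPoint (hg : Measurable g) (hg1 : ∀ x, g x ≤ 1) (x : ℝ) :
    walkLimit g x = ∫⁻ y, (if x + y < 0 then 1 else
      ENNReal.ofReal (g (x + y)) * walkLimit g (x + y)) ∂laplaceMeasure := by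
  have h1 : Tendsto (fun n => walkValue g (n + 1) x) atTop (𝓝 (walkLimit g x)) :=
    (tendsto_add_atTop_iff_nat 1).2 (tendsto_atTop_iInf (walkValue_antitone hg1 x))
  refine tendsto_nhds_unique h1 ?_
  have hadd : Measurable fun y : ℝ => x + y := measurable_const_add x
  have hlt : MeasurableSet {y : ℝ | x + y < 0} := measurableSet_lt hadd measurable_const
  have := tendsto_lintegral_walkValue hg hg1 (μ := laplaceMeasure)
    (a := fun y => if x + y < 0 then 0 else ENNReal.ofReal (g (x + y)))
    (b := fun y => if x + y < 0 then 1 else 0)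
    (Measurable.ite hlt measurable_const (hg.comp hadd).ennreal_ofReal)
    (fun y => by split_ifs; exacts [zero_le_one, by simpa using hg1 _])
    (Measurable.ite hlt measurable_const measurable_const)
    (fun y => by split_ifs <;> simp) x
  simp_rw [killed_eq]
  refine this.congr fun n => ?_
  simp_rw [walkValue, killed_eq]

end Walk

/-- Solutions on `[0, V]` of the Riccati equation `r' = 2 r - g (1 + r)² / 2` with terminal value
`1` at `V`. -/
structure IsRiccati (g : ℝ → ℝ) (V : ℝ) (r : ℝ → ℝ) : Prop where
  measurable : Measurable r
  continuousOn : ContinuousOn r (Set.Icc 0 V)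
  terminal : r V = 1
  nonneg : ∀ x ∈ Set.Icc 0 V, 0 ≤ r x
  le_one : ∀ x ∈ Set.Icc 0 V, r x ≤ 1
  hasDerivAt : ∃ C : Set ℝ, C.Countable ∧ ∀ x ∈ Set.Ioo 0 V \ C,
    HasDerivAt r (2 * r x - g x * (1 + r x) ^ 2 / 2) x

/-- The walk side of the proof: the limiting value satisfies the fixed-point equation, its ratio `up
/ down` is `r`, and since `down 0 = 1` the contribution of a nonnegative first step is half of `up 0
= r 0`. -/
theorem exists_isRiccati_walk {g : ℝ → ℝ} {V : ℝ} (hg : IsWeight g V) :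
    ∃ r, IsRiccati g V r ∧
      Tendsto (fun n => ∫⁻ y in Set.Ici 0, ENNReal.ofReal (g y) * walkValue g n y ∂laplaceMeasure)
        atTop (𝓝 (ENNReal.ofReal (r 0) / 2)) := by
  set u : ℝ → ℝ := fun x => (walkLimit g x).toReal with hu
  set h : ℝ → ℝ := fun x => g x * u x with hh
  have um : Measurable u := (measurable_walkLimit hg.measurable).ennreal_toReal
  have u0 : ∀ x, 0 ≤ u x := fun x => ENNReal.toReal_nonneg
  have u1 : ∀ x, u x ≤ 1 := fun x => by
    simpa using ENNReal.toReal_mono ENNReal.one_ne_top (walkLimit_le_one g x)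
  have hm : Measurable h := hg.measurable.mul um
  have h0 : ∀ x, 0 ≤ h x := fun x => mul_nonneg (hg.nonneg x) (u0 x)
  have h1 : ∀ x, h x ≤ 1 := fun x => mul_le_one₀ (hg.le_one x) (u0 x) (u1 x)
  have hof : ∀ x, ENNReal.ofReal (g x) * walkLimit g x = ENNReal.ofReal (h x) := fun x => by
    rw [hh, ENNReal.ofReal_mul (hg.nonneg x), hu,
      ENNReal.ofReal_toReal ((walkLimit_le_one g x).trans_lt ENNReal.one_lt_top).ne]
  have hval : ∀ x, 0 ≤ x → u x = (downValue h x + upValue h x) / 2 := by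
    intro x hx
    set k : ℝ → ℝ := fun z => if z < 0 then 1 else h z with hk
    have km : Measurable k := Measurable.ite measurableSet_Iio measurable_const hm
    have k0 : ∀ z, 0 ≤ k z := fun z => by simp only [hk]; split_ifs; exacts [zero_le_one, h0 z]
    have k1 : ∀ z, k z ≤ 1 := fun z => by simp only [hk]; split_ifs; exacts [le_rfl, h1 z]
    have e1 : u x = ∫ z, 1 / 2 * Real.exp (-|z - x|) * k z := by
      have hmeas : Measurable fun z => 1 / 2 * Real.exp (-|z - x|) * k z := by fun_prop
      rw [integral_eq_lintegral_of_nonneg_ae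
        (Eventually.of_forall fun z => mul_nonneg (by positivity) (k0 z))
        hmeas.aestronglyMeasurable, hu]
      simp only
      rw [walkLimit_fixedPoint hg.measurable hg.le_one, lintegral_laplaceMeasure_add
        (f := fun z => if z < 0 then 1 else ENNReal.ofReal (g z) * walkLimit g z)
        (measurable_killed hg.measurable (measurable_walkLimit hg.measurable))]
      congr 2
      funext z
      rw [ENNReal.ofReal_mul (p := 1 / 2 * Real.exp (-|z - x|)) (by positivity), hof]
      congr 1
      simp only [hk]
      split_ifs <;> simp
    have hint : Integrable fun z => 1 / 2 * Real.exp (-|z - x|) * k z := by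
      refine (integrable_laplace_density.comp_sub_right x).mono'
        (by fun_prop : Measurable fun z => 1 / 2 * Real.exp (-|z - x|) * k z).aestronglyMeasurable
        (Eventually.of_forall fun z => ?_)
      rw [Real.norm_of_nonneg (mul_nonneg (by positivity) (k0 z))]
      exact mul_le_of_le_one_right (by positivity) (k1 z)
    -- The next position is split into three ranges: killed, between `0` and `x`, above `x`. The
    -- first two make up half of `downValue`, the third half of `upValue`.
    have i1 : ∫ z in Set.Iic 0, 1 / 2 * Real.exp (-|z - x|) * k z = 1 / 2 * Real.exp (-x) := by
      rw [integral_Iic_eq_integral_Iio, setIntegral_congr_fun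
        (g := fun z => 1 / 2 * Real.exp (-x) * Real.exp z) measurableSet_Iio, integral_const_mul,
        ← integral_Iic_eq_integral_Iio, integral_exp_Iic_zero, mul_one]
      intro z hz
      have hz' : z < 0 := hz
      simp only [hk, if_pos hz', abs_of_nonpos (by linarith : z - x ≤ 0), mul_one, mul_assoc,
        ← Real.exp_add]
      ring_nf
    have i2 : ∫ z in Set.Ioc 0 x, 1 / 2 * Real.exp (-|z - x|) * k z =
        1 / 2 * Real.exp (-x) * ∫ z in (0 : ℝ)..x, Real.exp z * h z := by
      rw [intervalIntegral.integral_of_le hx, ← integral_const_mul]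
      refine setIntegral_congr_fun measurableSet_Ioc fun z hz => ?_
      simp only [hk, if_neg (not_lt.2 hz.1.le), abs_of_nonpos (by linarith [hz.2] : z - x ≤ 0)]
      rw [show -(-(z - x)) = -x + z by ring, Real.exp_add]
      ring
    have i3 : ∫ z in Set.Ioi x, 1 / 2 * Real.exp (-|z - x|) * k z =
        1 / 2 * upValue h x := by
      rw [upValue_eq hm h0 h1 hx, ← integral_const_mul, ← integral_const_mul]
      refine setIntegral_congr_fun measurableSet_Ioi fun z hz => ?_
      have hz' : x < z := hz
      simp only [hk, if_neg (not_lt.2 (hx.trans hz'.le)), abs_of_pos (sub_pos.2 hz')]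
      rw [show -(z - x) = x + -z by ring, Real.exp_add]
      ring
    rw [e1, ← intervalIntegral.integral_Iic_add_Ioi (b := 0) hint.integrableOn hint.integrableOn,
      ← Set.Ioc_union_Ioi_eq_Ioi hx, setIntegral_union (Set.Ioc_disjoint_Ioi le_rfl)
        measurableSet_Ioi hint.integrableOn hint.integrableOn, i1, i2, i3, downValue]
    ring
  obtain ⟨c1, c2, c3, c4⟩ := riccati_of_fixedPoint hg hm h0 h1
    (fun x hx => by rw [← hval x hx])
  refine ⟨fun x => upValue h x / downValue h x,
    ⟨(continuous_upValue hm h0 h1).measurable.div (continuous_downValue hm h0 h1).measurable,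
      c1, c2, fun x hx => (c3 x hx).1, fun x hx => (c3 x hx).2, c4⟩, ?_⟩
  have hlim := tendsto_lintegral_walkValue hg.measurable hg.le_one
    (μ := laplaceMeasure.restrict (Set.Ici 0)) (a := fun y => ENNReal.ofReal (g y))
    (b := fun _ => 0) hg.measurable.ennreal_ofReal (fun y => by simpa using hg.le_one y)
    measurable_const (fun _ => zero_le_one) 0
  simp only [zero_add, hof] at hlim
  convert hlim using 2
  have hd : downValue h 0 = 1 := by simp [downValue]
  have hup := upValue_eq hm h0 h1 le_rfl
  rw [Real.exp_zero, one_mul] at hup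
  have hind : ∫⁻ y in Set.Ici 0, ENNReal.ofReal (h y) ∂laplaceMeasure =
      ∫⁻ y in Set.Ici 0, ENNReal.ofReal (1 / 2 * (Real.exp (-y) * h y)) := by
    rw [laplaceMeasure, restrict_withDensity measurableSet_Ici,
      lintegral_withDensity_eq_lintegral_mul _ (by fun_prop) hm.ennreal_ofReal]
    refine setLIntegral_congr_fun measurableSet_Ici fun y hy => ?_
    simp only [Pi.mul_apply]
    rw [← ENNReal.ofReal_mul (by positivity), abs_of_nonneg hy, mul_assoc]
  simp only
  rw [hind, hd, div_one, hup, setLIntegral_congr Ioi_ae_eq_Ici.symm,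
    ← ofReal_integral_eq_lintegral_ofReal ((integrableOn_exp_neg_mul hm h0 h1 0).const_mul _)
      (Eventually.of_forall fun y => mul_nonneg (by norm_num)
        (mul_nonneg (Real.exp_pos _).le (h0 y))), integral_const_mul,
    ENNReal.ofReal_mul (by norm_num), ENNReal.div_eq_inv_mul]
  congr 1
  rw [one_div, ENNReal.ofReal_inv_of_pos two_pos, ENNReal.ofReal_ofNat]

section WalkProb

variable {Ω : Type*} [MeasurableSpace Ω] {P : Measure Ω}

lemma indepFun_shift {X : ℕ → Ω → ℝ} (hXm : ∀ i, Measurable (X i)) (hX : iIndepFun X P) :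
    IndepFun (X 0) (fun ω i => X (i + 1) ω) P := by
  have := indep_iSup_of_disjoint (fun i => (hXm i).comap_le) hX
    (S := {0}) (T := Set.Ioi 0) (by simp)
  rw [IndepFun_iff_Indep]
  refine indep_of_indep_of_le_left (indep_of_indep_of_le_right this ?_) ?_
  · rw [MeasurableSpace.pi, MeasurableSpace.comap_iSup]
    refine iSup_le fun i => ?_
    rw [MeasurableSpace.comap_comp]
    exact le_iSup₂_of_le (i + 1) (Nat.succ_pos i) le_rfl
  · exact le_iSup₂_of_le 0 rfl le_rfl

/-- Conditioning on the first increment, which is independent of the shifted sequence. The induction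
runs over all i.i.d. sequences since the shift is again one. -/
lemma lintegral_walkWeight [IsProbabilityMeasure P] {g : ℝ → ℝ} (hg : Measurable g) {X : ℕ → Ω → ℝ}
    (hXm : ∀ i, Measurable (X i)) (hXlaw : ∀ i, P.map (X i) = laplaceMeasure)
    (hX : iIndepFun X P) (n : ℕ) :
    (∀ x, ∫⁻ ω, walkWeight g n x (fun i => X i ω) ∂P = walkValue g n x) ∧
    ∫⁻ ω in {ω | 0 ≤ X 0 ω}, walkWeight g (n + 1) 0 (fun i => X i ω) ∂P =
      ∫⁻ y in Set.Ici 0, ENNReal.ofReal (g y) * walkValue g n y ∂laplaceMeasure := by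
  have main : ∀ (n : ℕ) (X : ℕ → Ω → ℝ), (∀ i, Measurable (X i)) →
      (∀ i, P.map (X i) = laplaceMeasure) → iIndepFun X P →
      (∀ x, ∫⁻ ω, walkWeight g n x (fun i => X (i + 1) ω) ∂P = walkValue g n x) →
      ∀ (x : ℝ) (a b : ℝ → ℝ≥0∞), Measurable a → Measurable b →
      ∫⁻ ω, (b (X 0 ω) + a (X 0 ω) * walkWeight g n (x + X 0 ω) fun i => X (i + 1) ω) ∂P =
        ∫⁻ y, (b y + a y * walkValue g n (x + y)) ∂laplaceMeasure := by
    intro n X hXm hXlaw hX ih x a b ha hb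
    have hT : Measurable fun ω i => X (i + 1) ω := measurable_pi_lambda _ fun i => hXm _
    have hind := (indepFun_iff_map_prod_eq_prod_map_map (hXm 0).aemeasurable
      hT.aemeasurable).1 (indepFun_shift hXm hX)
    have hw : Measurable fun q : ℝ × (ℕ → ℝ) => walkWeight g n (x + q.1) q.2 :=
      (measurable_walkWeight hg n).comp
        (by fun_prop : Measurable fun q : ℝ × (ℕ → ℝ) => (x + q.1, q.2))
    have hF : Measurable fun q : ℝ × (ℕ → ℝ) => b q.1 + a q.1 * walkWeight g n (x + q.1) q.2 :=
      (hb.comp measurable_fst).add ((ha.comp measurable_fst).mul hw)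
    have hw' : ∀ y, Measurable fun s : ℕ → ℝ => walkWeight g n (x + y) s :=
      fun y => (measurable_walkWeight hg n).comp measurable_prodMk_left
    have : IsProbabilityMeasure (P.map fun ω i => X (i + 1) ω) :=
      Measure.isProbabilityMeasure_map hT.aemeasurable
    rw [← lintegral_map (f := fun q : ℝ × (ℕ → ℝ) => b q.1 + a q.1 * walkWeight g n (x + q.1) q.2)
      (g := fun ω => (X 0 ω, fun i => X (i + 1) ω)) hF ((hXm 0).prodMk hT), hind,
      lintegral_prod _ hF.aemeasurable, hXlaw]
    refine lintegral_congr fun y => ?_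
    simp only
    rw [lintegral_add_left measurable_const, lintegral_const, measure_univ, mul_one]
    rw [lintegral_const_mul _ (hw' y), lintegral_map (hw' y) hT, ih]
  have hval : ∀ (n : ℕ) (X : ℕ → Ω → ℝ), (∀ i, Measurable (X i)) →
      (∀ i, P.map (X i) = laplaceMeasure) → iIndepFun X P →
      ∀ x, ∫⁻ ω, walkWeight g n x (fun i => X i ω) ∂P = walkValue g n x := by
    intro n
    induction n with
    | zero => intro X _ _ _ x; simp [walkWeight, walkValue]
    | succ n ih =>
      intro X hXm hXlaw hX x
      have hadd : Measurable fun y : ℝ => x + y := measurable_const_add x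
      have hlt : MeasurableSet {y : ℝ | x + y < 0} := measurableSet_lt hadd measurable_const
      have := main n X hXm hXlaw hX (ih (fun i => X (i + 1)) (fun i => hXm _)
        (fun i => hXlaw _) (hX.precomp (add_left_injective 1))) x
        (fun y => if x + y < 0 then 0 else ENNReal.ofReal (g (x + y)))
        (fun y => if x + y < 0 then 1 else 0)
        (Measurable.ite hlt measurable_const (hg.comp hadd).ennreal_ofReal)
        (Measurable.ite hlt measurable_const measurable_const)
      have e1 : ∀ ω, walkWeight g (n + 1) x (fun i => X i ω) =
          (if x + X 0 ω < 0 then 1 else 0) + (if x + X 0 ω < 0 then 0 else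
            ENNReal.ofReal (g (x + X 0 ω))) * walkWeight g n (x + X 0 ω) fun i => X (i + 1) ω := by
        intro ω
        rw [walkWeight]; split_ifs <;> simp
      simp_rw [e1, this, walkValue, killed_eq]
  refine ⟨hval n X hXm hXlaw hX, ?_⟩
  have := main n X hXm hXlaw hX (hval n (fun i => X (i + 1)) (fun i => hXm _)
    (fun i => hXlaw _) (hX.precomp (add_left_injective 1))) 0
    ((Set.Ici 0).indicator fun y => ENNReal.ofReal (g y)) (fun _ => 0)
    (hg.ennreal_ofReal.indicator measurableSet_Ici) measurable_const
  simp only [zero_add] at this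
  rw [← lintegral_indicator (measurableSet_le measurable_const (hXm 0)),
    ← lintegral_indicator measurableSet_Ici]
  convert this using 2
  · funext ω
    by_cases h0 : 0 ≤ X 0 ω
    · simp [Set.indicator, h0, walkWeight, not_lt.2 h0]
    · simp [Set.indicator, h0]
  · funext y
    by_cases h0 : 0 ≤ y <;> simp [Set.indicator, h0]

end WalkProb

/-! ### Exponential holding times and the fair jump chain. -/

/-- The exponential law with parameter `l`, as a law on `[0, ∞]`; the point mass at `∞` if
`l = 0`. -/
noncomputable def holdLaw (l : ℝ≥0) : Measure ℝ≥0∞ :=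
  if l = 0 then Measure.dirac ⊤ else (expMeasure l).map ENNReal.ofReal

instance (l : ℝ≥0) : IsProbabilityMeasure (holdLaw l) := by
  rw [holdLaw]
  split_ifs with h
  · infer_instance
  · have := isProbabilityMeasure_expMeasure (r := l) (by positivity)
    exact Measure.isProbabilityMeasure_map ENNReal.measurable_ofReal.aemeasurable

@[simp] lemma holdLaw_zero : holdLaw 0 = Measure.dirac ⊤ := by simp [holdLaw]

lemma lintegral_holdLaw {l : ℝ≥0} (hl : l ≠ 0) {f : ℝ≥0∞ → ℝ≥0∞} (hf : Measurable f) :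
    ∫⁻ s, f s ∂holdLaw l =
      ∫⁻ s in Set.Ioi (0 : ℝ), ENNReal.ofReal (l * Real.exp (-(l * s))) * f (ENNReal.ofReal s) := by
  have hm : Measurable (exponentialPDF l) := (measurable_exponentialPDFReal l).ennreal_ofReal
  have hf' : Measurable fun s : ℝ => f (ENNReal.ofReal s) := hf.comp ENNReal.measurable_ofReal
  rw [holdLaw, if_neg hl, lintegral_map hf ENNReal.measurable_ofReal,
    show expMeasure l = volume.withDensity (exponentialPDF l) from rfl,
    lintegral_withDensity_eq_lintegral_mul _ hm hf', ← lintegral_indicator measurableSet_Ioi]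
  refine lintegral_congr_ae ?_
  filter_upwards [Measure.ae_ne volume (0 : ℝ)] with s hs
  simp only [Pi.mul_apply, Set.indicator, Set.mem_Ioi]
  rcases lt_or_gt_of_ne hs with h | h
  · rw [exponentialPDF_of_neg h, if_neg h.not_gt, zero_mul]
  · rw [exponentialPDF_of_nonneg h.le, if_pos h]

lemma hasDerivAt_neg_const_mul (c x : ℝ) : HasDerivAt (fun s : ℝ => -(c * s)) (-c) x :=
  ((hasDerivAt_id x).const_mul c).neg.congr_deriv (by simp)

lemma integral_exp_rate_Ioi {l : ℝ} (hl : 0 < l) (t : ℝ) :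
    IntegrableOn (fun s => l * Real.exp (-(l * s))) (Set.Ioi t) ∧
    ∫ s in Set.Ioi t, l * Real.exp (-(l * s)) = Real.exp (-(l * t)) := by
  have hd : ∀ x ∈ Set.Ici t, HasDerivAt (fun s => -Real.exp (-(l * s)))
      (l * Real.exp (-(l * x))) x := fun x _ => by
    exact (hasDerivAt_neg_const_mul l x).exp.neg.congr_deriv (by ring)
  have hlim : Tendsto (fun s => -Real.exp (-(l * s))) atTop (𝓝 0) := by
    have : Tendsto (fun s : ℝ => l * s) atTop atTop := tendsto_id.const_mul_atTop hl
    simpa using (Real.tendsto_exp_neg_atTop_nhds_zero.comp this).neg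
  have hpos : ∀ x ∈ Set.Ioi t, 0 ≤ l * Real.exp (-(l * x)) := fun x _ => by positivity
  refine ⟨integrableOn_Ioi_deriv_of_nonneg' hd hpos hlim, ?_⟩
  rw [integral_Ioi_of_hasDerivAt_of_nonneg' hd hpos hlim]
  simp

/-- These are the tails prescribed in `IsBirthDeathProcess`; for `l = 0` the point mass at `∞` gives
`1 = exp 0`. -/
lemma holdLaw_Ioi (l t : ℝ≥0) : holdLaw l (Set.Ioi t) = ENNReal.ofReal (Real.exp (-(l * t))) := by
  by_cases hl : l = 0
  · simp [hl]
  have h := lintegral_holdLaw hl (f := (Set.Ioi (t : ℝ≥0∞)).indicator 1)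
    (measurable_one.indicator measurableSet_Ioi)
  rw [lintegral_indicator_one measurableSet_Ioi] at h
  obtain ⟨hi, he⟩ := integral_exp_rate_Ioi (l := l) (by positivity) t
  rw [h, ← he, ofReal_integral_eq_lintegral_ofReal hi (Eventually.of_forall fun s => by positivity),
    ← lintegral_indicator measurableSet_Ioi, ← lintegral_indicator measurableSet_Ioi]
  refine lintegral_congr fun s => ?_
  have hs : (t : ℝ≥0∞) < ENNReal.ofReal s ↔ (t : ℝ) < s := by
    rw [← ENNReal.ofReal_coe_nnreal, ENNReal.ofReal_lt_ofReal_iff']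
    exact ⟨fun h => h.1, fun h => ⟨h, t.2.trans_lt h⟩⟩
  by_cases h1 : (t : ℝ) < s
  · have h2 : 0 < s := t.2.trans_lt h1
    simp [Set.indicator, hs, h1, h2]
  · simp [Set.indicator, hs, h1]

lemma holdLaw_singleton_zero (l : ℝ≥0) : holdLaw l {0} = 0 := by
  have h := holdLaw_Ioi l 0
  have e : Set.Ioi ((0 : ℝ≥0) : ℝ≥0∞) = {0}ᶜ := by ext; simp [pos_iff_ne_zero]
  rw [e] at h
  simp only [NNReal.coe_zero, mul_zero, neg_zero, Real.exp_zero, ENNReal.ofReal_one] at h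
  exact (prob_compl_eq_one_iff (measurableSet_singleton 0)).1 h

/-- Transition probabilities of the jump chain with equal birth and death rates. -/
noncomputable def fairStep (i j : ℕ) : ℝ≥0∞ :=
  ENNReal.ofReal (jumpProb (fun j => (j : ℝ≥0) / 2) (fun j => (j : ℝ≥0) / 2) i j)

lemma fairStep_zero (j : ℕ) : fairStep 0 j = if j = 0 then 1 else 0 := by
  simp [fairStep, jumpProb]
  split_ifs <;> simp

lemma fairStep_succ (i j : ℕ) :
    fairStep (i + 1) j = if j = i + 2 then 2⁻¹ else if j = i then 2⁻¹ else 0 := by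
  have h2 : (((i + 1 : ℕ) : ℝ≥0) / 2 + ((i + 1 : ℕ) : ℝ≥0) / 2) = ((i + 1 : ℕ) : ℝ≥0) :=
    add_halves _
  have h0 : ((i + 1 : ℕ) : ℝ≥0) ≠ 0 := by positivity
  have hh : (((((i + 1 : ℕ) : ℝ≥0) / 2 : ℝ≥0) : ℝ) / (((i + 1 : ℕ) : ℝ≥0) : ℝ)) = 2⁻¹ := by
    have : (((i + 1 : ℕ) : ℝ≥0) : ℝ) ≠ 0 := by exact_mod_cast h0
    push_cast at this ⊢
    field_simp
  have e : ENNReal.ofReal (2⁻¹) = 2⁻¹ := by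
    rw [ENNReal.ofReal_inv_of_pos two_pos, ENNReal.ofReal_ofNat]
  rw [fairStep, jumpProb, h2, if_neg h0, ← NNReal.coe_add, h2, hh, show i + 1 + 1 = i + 2 from rfl]
  simp only [add_left_inj]
  split_ifs <;> simp [e]

lemma tsum_fairStep_mul (i : ℕ) (f : ℕ → ℝ≥0∞) :
    ∑' j, fairStep (i + 1) j * f j = 2⁻¹ * f (i + 2) + 2⁻¹ * f i := by
  rw [tsum_eq_sum (s := {i + 2, i}) (fun j hj => by
    simp only [Finset.mem_insert, Finset.mem_singleton, not_or] at hj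
    rw [fairStep_succ, if_neg hj.1, if_neg hj.2, zero_mul]),
    Finset.sum_pair (by omega), fairStep_succ, fairStep_succ, if_pos rfl, if_neg (by omega),
    if_pos rfl]

lemma tsum_fairStep_zero_mul (f : ℕ → ℝ≥0∞) : ∑' j, fairStep 0 j * f j = f 0 := by
  rw [tsum_eq_single 0 fun j hj => by rw [fairStep_zero, if_neg hj, zero_mul], fairStep_zero,
    if_pos rfl, one_mul]

lemma tsum_fairStep (i : ℕ) : ∑' j, fairStep i j = 1 := by
  cases i with
  | zero => simpa using tsum_fairStep_zero_mul fun _ => 1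
  | succ i => simpa [ENNReal.inv_two_add_inv_two] using tsum_fairStep_mul i fun _ => 1

/-! ### Powers of the Riccati solution are harmonic for the weighted chain. -/

section OneStep

variable {g r : ℝ → ℝ} {V : ℝ}

/-- The integral of `1 - g` over `[0, x]`. -/
noncomputable def killing (g : ℝ → ℝ) (x : ℝ) : ℝ := ∫ s in (0 : ℝ)..x, (1 - g s)

lemma intervalIntegrable_one_sub (hg : IsWeight g V) (a b : ℝ) :
    IntervalIntegrable (fun s => 1 - g s) volume a b :=
  intervalIntegrable_const.sub
    (intervalIntegrable_of_bounded_unit hg.measurable hg.nonneg hg.le_one a b)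

lemma continuous_killing (hg : IsWeight g V) : Continuous (killing g) :=
  intervalIntegral.continuous_primitive (intervalIntegrable_one_sub hg) 0

lemma killing_sub (hg : IsWeight g V) (a b : ℝ) :
    killing g b - killing g a = ∫ s in a..b, (1 - g s) :=
  intervalIntegral.integral_interval_sub_left (intervalIntegrable_one_sub hg _ _)
    (intervalIntegrable_one_sub hg _ _)

lemma killing_mono (hg : IsWeight g V) : Monotone (killing g) := fun a b hab => by
  rw [← sub_nonneg, killing_sub hg]
  exact intervalIntegral.integral_nonneg hab fun s _ => by linarith [hg.le_one s]

lemma hasDerivAt_killing (hg : IsWeight g V) {x : ℝ} (hx : ContinuousAt g x) :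
    HasDerivAt (killing g) (1 - g x) x :=
  intervalIntegral.integral_hasDerivAt_right (intervalIntegrable_one_sub hg 0 x)
    (by exact (measurable_const.sub hg.measurable).stronglyMeasurable.stronglyMeasurableAtFilter)
    (continuousAt_const.sub hx)

/-- Integrated form of the Riccati equation for the powers of the solution. -/
lemma IsRiccati.integral_eq (hr : IsRiccati g V r) (hg : IsWeight g V) (i : ℕ) {τ : ℝ}
    (hτ : τ ∈ Set.Icc 0 V) :
    (∀ j : ℕ, IntervalIntegrable (fun s => (i + 1) * Real.exp (-((i + 1) * s)) *
      (Real.exp (-((i + 1) * (killing g (τ + s) - killing g τ))) * g (τ + s) * r (τ + s) ^ j))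
      volume 0 (V - τ)) ∧
    (∫ s in (0 : ℝ)..V - τ, (i + 1) * Real.exp (-((i + 1) * s)) *
      (Real.exp (-((i + 1) * (killing g (τ + s) - killing g τ))) * g (τ + s) * r (τ + s) ^ (i + 2)))
      / 2 +
    (∫ s in (0 : ℝ)..V - τ, (i + 1) * Real.exp (-((i + 1) * s)) *
      (Real.exp (-((i + 1) * (killing g (τ + s) - killing g τ))) * g (τ + s) * r (τ + s) ^ i)) / 2 +
    Real.exp (-((i + 1) * (V - τ))) * Real.exp (-((i + 1) * (killing g V - killing g τ))) =
      r τ ^ (i + 1) := by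
  have hle : 0 ≤ V - τ := sub_nonneg.2 hτ.2
  have cΓ := continuous_killing hg
  have cr : ContinuousOn (fun s => r (τ + s)) (Set.Icc 0 (V - τ)) :=
    hr.continuousOn.comp (by fun_prop) fun s hs => ⟨by linarith [hτ.1, hs.1], by linarith [hs.2]⟩
  have cE : Continuous fun s => (i + 1) * Real.exp (-((i + 1) * s)) *
      Real.exp (-((i + 1) * (killing g (τ + s) - killing g τ))) := by fun_prop
  have gI : IntervalIntegrable (fun s => g (τ + s)) volume 0 (V - τ) :=
    intervalIntegrable_of_bounded_unit (hg.measurable.comp (measurable_const_add τ))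
      (fun s => hg.nonneg _) (fun s => hg.le_one _) _ _
  have hI : ∀ j : ℕ, IntervalIntegrable (fun s => (i + 1) * Real.exp (-((i + 1) * s)) *
      (Real.exp (-((i + 1) * (killing g (τ + s) - killing g τ))) * g (τ + s) * r (τ + s) ^ j))
      volume 0 (V - τ) := by
    intro j
    have hc : ContinuousOn (fun s => ((i + 1) * Real.exp (-((i + 1) * s)) *
      Real.exp (-((i + 1) * (killing g (τ + s) - killing g τ)))) * r (τ + s) ^ j)
        (Set.uIcc 0 (V - τ)) := by
      rw [Set.uIcc_of_le hle]
      exact cE.continuousOn.mul (cr.pow j)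
    exact (gI.continuousOn_mul hc).congr fun s _ => by ring
  refine ⟨hI, ?_⟩
  obtain ⟨C, hC, hrC⟩ := hr.hasDerivAt
  obtain ⟨D, hD, hgD⟩ := hg.countable_discontinuities
  -- In the derivative of this product the terms in `r ^ (i + 1)` cancel by the Riccati equation.
  -- What remains is `-g / 2` times the birth term `r ^ (i + 2)` plus the death term `r ^ i`, with
  -- the exponential factors.
  have hftc := integral_eq_of_hasDerivAt_off_countable_of_le
    (fun s => Real.exp (-((i + 1) * s)) *
      Real.exp (-((i + 1) * (killing g (τ + s) - killing g τ))) * r (τ + s) ^ (i + 1))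
    (fun s => (-1 / 2 : ℝ) * ((i + 1) * Real.exp (-((i + 1) * s)) *
      (Real.exp (-((i + 1) * (killing g (τ + s) - killing g τ))) * g (τ + s) *
        r (τ + s) ^ (i + 2))) +
      (-1 / 2 : ℝ) * ((i + 1) * Real.exp (-((i + 1) * s)) *
      (Real.exp (-((i + 1) * (killing g (τ + s) - killing g τ))) * g (τ + s) *
        r (τ + s) ^ i))) hle
    ((hC.union hD).preimage (add_right_injective τ)) ?_ ?_ ?_
  · rw [intervalIntegral.integral_add ((hI _).const_mul _) ((hI _).const_mul _),
      intervalIntegral.integral_const_mul, intervalIntegral.integral_const_mul] at hftc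
    simp only [add_sub_cancel, hr.terminal, one_pow, mul_one, add_zero, sub_self, mul_zero,
      neg_zero, Real.exp_zero, one_mul] at hftc
    linarith
  · exact (by fun_prop : Continuous fun s => Real.exp (-((i + 1) * s)) *
      Real.exp (-((i + 1) * (killing g (τ + s) - killing g τ)))).continuousOn.mul (cr.pow _)
  · rintro s ⟨hs, hsC⟩
    have hsC : τ + s ∉ C ∧ τ + s ∉ D := by simpa using hsC
    have d1 : HasDerivAt (fun s : ℝ => Real.exp (-((i + 1) * s)))
        (Real.exp (-((i + 1) * s)) * (-(i + 1))) s :=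
      (hasDerivAt_neg_const_mul _ s).exp
    have d2 := (((hasDerivAt_killing hg (hgD _ hsC.2)).comp_const_add τ s).sub_const
      (killing g τ)).const_mul ((i : ℝ) + 1) |>.neg.exp
    have d3 := ((hrC (τ + s) ⟨⟨by linarith [hτ.1, hs.1], by linarith [hs.2]⟩, hsC.1⟩).comp_const_add
      τ s).pow (i + 1)
    refine ((d1.mul d2).mul d3).congr_deriv ?_
    simp only [Nat.add_sub_cancel, Nat.cast_add, Nat.cast_one, Pi.mul_apply, Pi.pow_apply,
      Pi.neg_apply]
    ring
  · exact ((hI _).const_mul _).add ((hI _).const_mul _)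

/-- The time `t`, cut off at `V`, as a real number. -/
noncomputable def capTime (V : ℝ) (t : ℝ≥0∞) : ℝ := (min t (ENNReal.ofReal V)).toReal

/-- The weight collected while staying for a time `s` in state `i` from time `t` on, including the
jump at time `t + s`. -/
noncomputable def stepWeight (g : ℝ → ℝ) (V : ℝ) (i : ℕ) (t s : ℝ≥0∞) : ℝ≥0∞ :=
  ENNReal.ofReal (Real.exp (-(i * (killing g (capTime V (t + s)) - killing g (capTime V t))))) *
    if t + s ≤ ENNReal.ofReal V then ENNReal.ofReal (g (t + s).toReal) else 1

/-- The candidate for the expected weight collected from time `t` on, starting in state `i`. -/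
noncomputable def stateValue (r : ℝ → ℝ) (V : ℝ) (i : ℕ) (t : ℝ≥0∞) : ℝ≥0∞ :=
  if t ≤ ENNReal.ofReal V then ENNReal.ofReal (r t.toReal ^ i) else 1

lemma measurable_capTime (V : ℝ) : Measurable (capTime V) :=
  (measurable_id.min measurable_const).ennreal_toReal

lemma capTime_of_le {V : ℝ} {t : ℝ≥0∞} (h : t ≤ ENNReal.ofReal V) : capTime V t = t.toReal := by
  rw [capTime, min_eq_left h]

lemma capTime_of_ge (hV : 0 ≤ V) {t : ℝ≥0∞} (h : ENNReal.ofReal V ≤ t) : capTime V t = V := by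
  rw [capTime, min_eq_right h, ENNReal.toReal_ofReal hV]

lemma capTime_le (hV : 0 ≤ V) (t : ℝ≥0∞) : capTime V t ≤ V := by
  rw [← ENNReal.toReal_ofReal hV]
  exact ENNReal.toReal_mono ENNReal.ofReal_ne_top (min_le_right _ _) |>.trans_eq'
    (by rw [ENNReal.toReal_ofReal hV, capTime])

lemma capTime_mono (V : ℝ) : Monotone (capTime V) := fun s t h =>
  ENNReal.toReal_mono (by simp) (min_le_min_right _ h)

lemma measurable_stepWeight (hg : IsWeight g V) (i : ℕ) :
    Measurable fun q : ℝ≥0∞ × ℝ≥0∞ => stepWeight g V i q.1 q.2 := by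
  have ha : Measurable fun q : ℝ≥0∞ × ℝ≥0∞ => q.1 + q.2 := by fun_prop
  have hk := (continuous_killing hg).measurable
  have h1 := hk.comp ((measurable_capTime V).comp ha)
  have h2 := hk.comp ((measurable_capTime V).comp
    (measurable_fst : Measurable (Prod.fst : ℝ≥0∞ × ℝ≥0∞ → ℝ≥0∞)))
  refine Measurable.mul ?_ (Measurable.ite (measurableSet_le ha measurable_const)
    (hg.measurable.comp ha.ennreal_toReal).ennreal_ofReal measurable_const)
  exact (Real.measurable_exp.comp ((h1.sub h2).const_mul _).neg).ennreal_ofReal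

lemma Measurable.stepWeight (hg : IsWeight g V) (i : ℕ) {α : Type*} [MeasurableSpace α]
    {a b : α → ℝ≥0∞} (ha : Measurable a) (hb : Measurable b) :
    Measurable fun q => stepWeight g V i (a q) (b q) := by
  have h := (measurable_stepWeight hg i).comp (ha.prodMk hb)
  exact h

lemma measurable_stateValue (hr : Measurable r) (i : ℕ) : Measurable (stateValue r V i) :=
  Measurable.ite measurableSet_Iic
    ((hr.comp ENNReal.measurable_toReal).pow_const i).ennreal_ofReal measurable_const

lemma stepWeight_le_one (hg : IsWeight g V) (i : ℕ) (t s : ℝ≥0∞) : stepWeight g V i t s ≤ 1 := by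
  refine mul_le_one' ?_ ?_
  · rw [ENNReal.ofReal_le_one, Real.exp_le_one_iff]
    have := killing_mono hg (capTime_mono V (le_self_add : t ≤ t + s))
    have : 0 ≤ (i : ℝ) * (killing g (capTime V (t + s)) - killing g (capTime V t)) :=
      mul_nonneg i.cast_nonneg (by linarith)
    linarith
  · split_ifs
    · simpa using hg.le_one _
    · exact le_rfl

lemma IsRiccati.stateValue_le_one (hr : IsRiccati g V r) (hV : 0 ≤ V) (i : ℕ) (t : ℝ≥0∞) :
    stateValue r V i t ≤ 1 := by
  rw [stateValue]
  split_ifs with h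
  · have ht : t.toReal ∈ Set.Icc 0 V := by
      refine ⟨ENNReal.toReal_nonneg, ?_⟩
      simpa [ENNReal.toReal_ofReal hV] using ENNReal.toReal_mono ENNReal.ofReal_ne_top h
    rw [ENNReal.ofReal_le_one]
    exact pow_le_one₀ (hr.nonneg _ ht) (hr.le_one _ ht)
  · exact le_rfl

/-- The candidate value is harmonic for the jump chain. -/
theorem IsRiccati.tsum_step (hr : IsRiccati g V r) (hg : IsWeight g V) (i : ℕ) (t : ℝ≥0∞) :
    ∑' j, fairStep i j * ∫⁻ s, stepWeight g V i t s * stateValue r V j (t + s) ∂holdLaw i =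
      stateValue r V i t := by
  have hV := hg.horizon_nonneg
  by_cases ht : t ≤ ENNReal.ofReal V
  swap
  · have hlt := not_le.1 ht
    -- Past the horizon nothing more is collected.
    have h1 : ∀ j s, stepWeight g V i t s * stateValue r V j (t + s) = 1 := by
      intro j s
      have hts : ¬ t + s ≤ ENNReal.ofReal V := not_le.2 (hlt.trans_le le_self_add)
      rw [stepWeight, stateValue, if_neg hts, if_neg hts, capTime_of_ge hV hlt.le,
        capTime_of_ge hV (hlt.le.trans le_self_add)]
      simp
    simp_rw [h1]
    simp [stateValue, ht, tsum_fairStep]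
  · obtain ⟨τ, hτ0, rfl⟩ : ∃ τ : ℝ, 0 ≤ τ ∧ ENNReal.ofReal τ = t :=
      ⟨t.toReal, ENNReal.toReal_nonneg,
        ENNReal.ofReal_toReal (ht.trans_lt ENNReal.ofReal_lt_top).ne⟩
    have hτV : τ ≤ V := (ENNReal.ofReal_le_ofReal_iff hV).1 ht
    cases i with
    | zero =>
      rw [tsum_fairStep_zero_mul]
      simp [stepWeight, stateValue, ht]
    | succ i =>
      have hm : ∀ j, Measurable fun s => stepWeight g V (i + 1) (ENNReal.ofReal τ) s *
          stateValue r V j (ENNReal.ofReal τ + s) := fun j =>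
        ((measurable_stepWeight hg _).comp measurable_prodMk_left).mul
          ((measurable_stateValue hr.measurable j).comp (measurable_const_add _))
      obtain ⟨hI, hsum⟩ := hr.integral_eq hg i ⟨hτ0, hτV⟩
      set I : ℕ → ℝ := fun j => ∫ s in (0 : ℝ)..V - τ, (i + 1) * Real.exp (-((i + 1) * s)) *
        (Real.exp (-((i + 1) * (killing g (τ + s) - killing g τ))) * g (τ + s) * r (τ + s) ^ j)
        with hIdef
      have hnn : ∀ j, ∀ s ∈ Set.Ioc 0 (V - τ), 0 ≤ ((i : ℝ) + 1) * Real.exp (-((i + 1) * s)) *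
          (Real.exp (-((i + 1) * (killing g (τ + s) - killing g τ))) * g (τ + s) *
            r (τ + s) ^ j) := by
        intro j s hs
        have h1 := hr.nonneg (τ + s) ⟨by linarith [hs.1], by linarith [hs.2]⟩
        have h2 := hg.nonneg (τ + s)
        positivity
      have hI0 : ∀ j, 0 ≤ I j := fun j => by
        simp only [hIdef]
        rw [intervalIntegral.integral_of_le (sub_nonneg.2 hτV)]
        exact setIntegral_nonneg measurableSet_Ioc (hnn j)
      -- `K` is the contribution of a holding time that outlasts the horizon; it is the boundary
      -- term of the integrated equation because `r V = 1`.
      set K := Real.exp (-((i + 1) * (V - τ))) *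
        Real.exp (-((i + 1) * (killing g V - killing g τ))) with hK
      have hA : ∀ j, ∫⁻ s, stepWeight g V (i + 1) (ENNReal.ofReal τ) s *
          stateValue r V j (ENNReal.ofReal τ + s) ∂holdLaw ((i + 1 : ℕ) : ℝ≥0) =
          ENNReal.ofReal (I j + K) := by
        intro j
        have hl : (((i + 1 : ℕ) : ℝ≥0) : ℝ) = i + 1 := by push_cast; ring
        rw [lintegral_holdLaw (by positivity) (hm j), hl,
          ← Set.Ioc_union_Ioi_eq_Ioi (sub_nonneg.2 hτV),
          lintegral_union measurableSet_Ioi (Set.Ioc_disjoint_Ioi le_rfl),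
          ENNReal.ofReal_add (hI0 j) (by positivity)]
        congr 1
        · simp only [hIdef]
          rw [intervalIntegral.integral_of_le (sub_nonneg.2 hτV),
            ofReal_integral_eq_lintegral_ofReal ((hI j).1)
              ((ae_restrict_iff' measurableSet_Ioc).2 (Eventually.of_forall (hnn j)))]
          refine setLIntegral_congr_fun measurableSet_Ioc fun s hs => ?_
          have hle : ENNReal.ofReal (τ + s) ≤ ENNReal.ofReal V :=
            ENNReal.ofReal_le_ofReal (by linarith [hs.2])
          rw [stepWeight, stateValue, ← ENNReal.ofReal_add hτ0 hs.1.le, if_pos hle, if_pos hle,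
            capTime_of_le hle, capTime_of_le ht, ENNReal.toReal_ofReal (by linarith [hs.1]),
            ENNReal.toReal_ofReal hτ0, ← ENNReal.ofReal_mul (by positivity),
            ← ENNReal.ofReal_mul (mul_nonneg (by positivity) (hg.nonneg _)),
            ← ENNReal.ofReal_mul (by positivity)]
          push_cast
          rfl
        · obtain ⟨hi, he⟩ := integral_exp_rate_Ioi (l := i + 1) (by positivity) (V - τ)
          rw [hK, ← he, ENNReal.ofReal_mul (by rw [he]; positivity),
            ofReal_integral_eq_lintegral_ofReal hi (Eventually.of_forall fun s => by positivity),
            ← lintegral_mul_const _ (by fun_prop)]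
          refine setLIntegral_congr_fun measurableSet_Ioi fun s hs => ?_
          have hs' : V - τ < s := hs
          have hs0 : 0 ≤ s := by linarith
          have hlt : ENNReal.ofReal V < ENNReal.ofReal (τ + s) :=
            (ENNReal.ofReal_lt_ofReal_iff (by linarith)).2 (by linarith)
          rw [stepWeight, stateValue, ← ENNReal.ofReal_add hτ0 hs0, if_neg hlt.not_ge,
            if_neg hlt.not_ge, capTime_of_ge hV hlt.le, capTime_of_le ht,
            ENNReal.toReal_ofReal hτ0, mul_one, mul_one]
          push_cast
          rfl
      rw [tsum_fairStep_mul, hA, hA, stateValue, if_pos ht, ENNReal.toReal_ofReal hτ0, ← hsum]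
      have e : (2⁻¹ : ℝ≥0∞) = ENNReal.ofReal 2⁻¹ := by
        rw [ENNReal.ofReal_inv_of_pos two_pos, ENNReal.ofReal_ofNat]
      have hK0 : 0 ≤ K := by positivity
      rw [e, ← ENNReal.ofReal_mul (by positivity), ← ENNReal.ofReal_mul (by positivity),
        ← ENNReal.ofReal_add (mul_nonneg (by norm_num) (add_nonneg (hI0 _) hK0))
          (mul_nonneg (by norm_num) (add_nonneg (hI0 _) hK0))]
      congr 1
      simp only [hIdef, hK]
      ring

end OneStep

/-! ### The expected weight of the birth and death process. -/

lemma jumpProb_nonneg (β δ : ℕ → ℝ≥0) (i j : ℕ) : 0 ≤ jumpProb β δ i j := by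
  rw [jumpProb]
  split_ifs <;> positivity

namespace IsJumpHold

variable {Ω : Type*} [MeasurableSpace Ω] {P : Measure Ω} [IsProbabilityMeasure P] {x₀ : ℕ}
  {p : ℕ → ℕ → ℝ≥0∞} {κ : ℕ → Measure ℝ≥0∞} {Y : ℕ → Ω → ℕ} {H : ℕ → Ω → ℝ≥0∞}

lemma ae_init (h : IsJumpHold P x₀ p κ Y H) : ∀ᵐ ω ∂P, Y 0 ω = x₀ := by
  have := h.prob 0 (fun _ => x₀) (fun _ => 0)
  simp only [not_lt_zero, false_imp_iff, implies_true, and_true, if_true, Finset.range_zero,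
    Finset.prod_empty, mul_one] at this
  rw [ae_iff]
  exact (prob_compl_eq_zero_iff (h.measurable_state 0 (measurableSet_singleton x₀))).2 this

variable [∀ i, IsProbabilityMeasure (κ i)]

/-- A state variable updated along the jump chain is measurable and Markov at every step. -/
lemma markovAt_of_rec {E : Type*} [MeasurableSpace E] (h : IsJumpHold P x₀ p κ Y H)
    (hp : ∀ i, ∑' j, p i j = 1) (hκ : ∀ i, κ i {0} = 0) {G : ℕ → ℕ → E × ℝ≥0∞ → E}
    (hG : ∀ i j, Measurable (G i j)) {R : ℕ → Ω → E} {e : E} (h0 : R 0 = fun _ => e)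
    (hR : ∀ n, R (n + 1) = fun ω => G (Y n ω) (Y (n + 1) ω) (R n ω, H n ω)) (n : ℕ) :
    Measurable (R n) ∧ MarkovAt P p κ Y H n (R n) := by
  induction n with
  | zero => rw [h0]; exact ⟨measurable_const, h.markovAt_zero e⟩
  | succ n ih =>
    rw [hR]
    refine ⟨?_, ih.2.succ h hp hκ ih.1 hG⟩
    have : Measurable fun q : (ℕ × ℕ) × (E × ℝ≥0∞) => G q.1.1 q.1.2 q.2 :=
      measurable_from_prod_countable_right fun q => hG q.1 q.2
    exact this.comp (((h.measurable_state n).prodMk (h.measurable_state (n + 1))).prodMk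
      (ih.1.prodMk (h.measurable_hold n)))

/-- Almost surely, every step of the chain avoids a null set of transitions and holding times. -/
lemma ae_step (h : IsJumpHold P x₀ p κ Y H)
    (hp : ∀ i, ∑' j, p i j = 1) (hκ : ∀ i, κ i {0} = 0) (A : ℕ → ℕ → Set ℝ≥0∞)
    (hA : ∀ i j, MeasurableSet (A i j)) (hA0 : ∀ i j, p i j * κ i (A i j) = 0) :
    ∀ᵐ ω ∂P, ∀ n, H n ω ∉ A (Y n ω) (Y (n + 1) ω) := by
  rw [ae_all_iff]
  intro n
  have hR := h.markovAt_of_rec hp hκ (G := fun _ _ _ => ()) (fun _ _ => measurable_const)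
    (R := fun _ _ => ()) (e := ()) rfl (fun _ => rfl) n
  have := hR.2.lintegral_step h hp hκ hR.1
    (F := fun i j q => (A i j).indicator 1 q.2)
    (fun i j => (measurable_one.indicator (hA i j)).comp measurable_snd)
  simp only [lintegral_indicator_one (hA _ _), hA0, tsum_zero, lintegral_zero] at this
  have hm : Measurable fun q : (ℕ × ℕ) × ℝ≥0∞ =>
      (A q.1.1 q.1.2).indicator (1 : ℝ≥0∞ → ℝ≥0∞) q.2 :=
    measurable_from_prod_countable_right fun q => measurable_one.indicator (hA q.1 q.2)
  rw [lintegral_eq_zero_iff (f := fun ω => (A (Y n ω) (Y (n + 1) ω)).indicator 1 (H n ω))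
    (hm.comp (((h.measurable_state n).prodMk
      (h.measurable_state (n + 1))).prodMk (h.measurable_hold n)))] at this
  filter_upwards [this] with ω hω hmem
  simp [hmem] at hω

end IsJumpHold

section BirthDeath

variable {Ω : Type*} [MeasurableSpace Ω] {P : Measure Ω} [IsProbabilityMeasure P]

/-- Equal rates `j / 2` give holding parameter `j` and a fair chain absorbed at `0`. The pathwise
properties exclude only null events of single steps. -/
theorem IsBirthDeathProcess.exists_isJumpPath {Z : ℝ≥0 → Ω → ℕ}
    (hZ : IsBirthDeathProcess P (fun j => (j : ℝ≥0) / 2) (fun j => (j : ℝ≥0) / 2) 1 Z) :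
    ∃ (Y : ℕ → Ω → ℕ) (H : ℕ → Ω → ℝ≥0∞),
      IsJumpHold P 1 fairStep (fun i => holdLaw i) Y H ∧
      ∀ᵐ ω ∂P, IsJumpPath (fun k => Y k ω) (fun k => H k ω) (fun t => Z t ω) := by
  obtain ⟨Y, H, hY, hH, hprob, hZ'⟩ := hZ.jump_hold
  have hJ : IsJumpHold P 1 fairStep (fun i => holdLaw i) Y H := by
    refine ⟨hY, hH, fun n y t => ?_⟩
    rw [← ofReal_measureReal (measure_ne_top _ _), hprob,
      ENNReal.ofReal_mul (by split_ifs <;> norm_num), ENNReal.ofReal_prod_of_nonneg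
        fun k _ => mul_nonneg (Real.exp_pos _).le (jumpProb_nonneg _ _ _ _)]
    congr 1
    · split_ifs <;> simp
    · refine Finset.prod_congr rfl fun k _ => ?_
      rw [ENNReal.ofReal_mul (Real.exp_pos _).le, holdLaw_Ioi, fairStep]
      congr 4
      push_cast
      ring
  refine ⟨Y, H, hJ, ?_⟩
  have hs := hJ.ae_step tsum_fairStep (fun i => holdLaw_singleton_zero i)
    -- Forbidden holding times: all of them for a non-unit step from a nonzero state, the finite
    -- ones in state `0`, and zero otherwise.
    (fun i j => if i ≠ 0 ∧ j ≠ i + 1 ∧ j + 1 ≠ i then Set.univ else if i = 0 then {⊤}ᶜ else {0})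
    (fun i j => by
      split_ifs
      exacts [MeasurableSet.univ, (measurableSet_singleton _).compl, measurableSet_singleton _])
    (fun i j => by
      split_ifs with h1 h2
      · obtain ⟨i, rfl⟩ := Nat.exists_eq_succ_of_ne_zero h1.1
        rw [Nat.succ_eq_add_one, fairStep_succ, if_neg (by omega), if_neg (by omega), zero_mul]
      · simp [h2]
      · rw [holdLaw_singleton_zero, mul_zero])
  filter_upwards [hs, hJ.ae_init, hZ'] with ω h1 h2 h3
  refine ⟨h2, fun k => ?_, fun k hk => ?_, fun k hk => ?_, h3⟩
  · have := h1 k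
    rw [pos_iff_ne_zero]
    split_ifs at this with h4 h5
    · simp at this
    · simp only [Set.mem_compl_iff, Set.mem_singleton_iff, not_not] at this
      simp [this]
    · simpa using this
  · have := h1 k
    by_contra hne
    rw [if_pos ⟨hk, by tauto⟩] at this
    simp at this
  · have := h1 k
    rw [if_neg (by tauto), if_pos hk] at this
    simpa using this

/-- The weight collected before the `n`-th jump of the chain. -/
noncomputable def pathWeight (g : ℝ → ℝ) (V : ℝ) (Y : ℕ → ℕ) (H : ℕ → ℝ≥0∞) (n : ℕ) : ℝ≥0∞ :=
  ∏ k ∈ Finset.range n, stepWeight g V (Y k) (jumpTime H k) (H k)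

variable {g r : ℝ → ℝ} {V : ℝ} {Y : ℕ → Ω → ℕ} {H : ℕ → Ω → ℝ≥0∞}

/-- The collected weight times the value of the current state is a martingale along the jumps:
`IsRiccati.tsum_step` keeps its expectation constant. The pair of weight and jump time is the
summary of the past. -/
lemma lintegral_pathWeight (hg : IsWeight g V) (hr : IsRiccati g V r)
    (hJ : IsJumpHold P 1 fairStep (fun i => holdLaw i) Y H) (n : ℕ) :
    Measurable (fun ω => pathWeight g V (fun k => Y k ω) (fun k => H k ω) n *
      stateValue r V (Y n ω) (jumpTime (fun k => H k ω) n)) ∧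
    ∫⁻ ω, pathWeight g V (fun k => Y k ω) (fun k => H k ω) n *
      stateValue r V (Y n ω) (jumpTime (fun k => H k ω) n) ∂P = ENNReal.ofReal (r 0) := by
  let R : ℕ → Ω → ℝ≥0∞ × ℝ≥0∞ := fun n ω =>
    (pathWeight g V (fun k => Y k ω) (fun k => H k ω) n, jumpTime (fun k => H k ω) n)
  let G : ℕ → ℕ → (ℝ≥0∞ × ℝ≥0∞) × ℝ≥0∞ → ℝ≥0∞ × ℝ≥0∞ := fun i _ q =>
    (q.1.1 * stepWeight g V i q.1.2 q.2, q.1.2 + q.2)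
  have hw : ∀ i, Measurable fun q : (ℝ≥0∞ × ℝ≥0∞) × ℝ≥0∞ => stepWeight g V i q.1.2 q.2 := by
    intro i
    have h := Measurable.stepWeight hg i (measurable_fst.snd :
      Measurable fun q : (ℝ≥0∞ × ℝ≥0∞) × ℝ≥0∞ => q.1.2) measurable_snd
    exact h
  have hG : ∀ i j, Measurable (G i j) := by
    intro i j
    have h1 : Measurable fun q : (ℝ≥0∞ × ℝ≥0∞) × ℝ≥0∞ => q.1.1 := by fun_prop
    have h2 : Measurable fun q : (ℝ≥0∞ × ℝ≥0∞) × ℝ≥0∞ => q.1.2 + q.2 := by fun_prop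
    exact (h1.mul (hw i)).prodMk h2
  have h0 : R 0 = fun _ => (1, 0) := by
    funext ω; simp [R, pathWeight]
  have hRs : ∀ n, R (n + 1) = fun ω => G (Y n ω) (Y (n + 1) ω) (R n ω, H n ω) := by
    intro n; funext ω
    simp only [R, G, pathWeight, Finset.prod_range_succ, jumpTime_succ]
  have hR := hJ.markovAt_of_rec tsum_fairStep (fun i => holdLaw_singleton_zero i) hG h0 hRs
  have hv : Measurable fun q : ℕ × ℝ≥0∞ => stateValue r V q.1 q.2 :=
    measurable_from_prod_countable_right fun i => measurable_stateValue hr.measurable i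
  have hm : ∀ n, Measurable (fun ω => (R n ω).1 * stateValue r V (Y n ω) (R n ω).2) := fun n =>
    (hR n).1.fst.mul (hv.comp ((hJ.measurable_state n).prodMk (hR n).1.snd))
  refine ⟨hm n, ?_⟩
  change ∫⁻ ω, (R n ω).1 * stateValue r V (Y n ω) (R n ω).2 ∂P = _
  induction n with
  | zero =>
    have : ∀ᵐ ω ∂P, (R 0 ω).1 * stateValue r V (Y 0 ω) (R 0 ω).2 = ENNReal.ofReal (r 0) := by
      filter_upwards [hJ.ae_init] with ω hω
      rw [h0, hω]
      simp [stateValue]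
    rw [lintegral_congr_ae this]
    simp
  | succ n ih =>
    rw [← ih]
    have step := (hR n).2.lintegral_step hJ tsum_fairStep (fun i => holdLaw_singleton_zero i)
      (hR n).1 (F := fun i j q => (G i j q).1 * stateValue r V j (G i j q).2)
      (fun i j => (hG i j).fst.mul ((measurable_stateValue hr.measurable j).comp (hG i j).snd))
    rw [hRs n]
    rw [step]
    refine lintegral_congr fun ω => ?_
    have hms : ∀ j, Measurable fun s => stepWeight g V (Y n ω) (R n ω).2 s *
          stateValue r V j ((R n ω).2 + s) := fun j =>
        ((measurable_stepWeight hg _).comp measurable_prodMk_left).mul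
          ((measurable_stateValue hr.measurable j).comp (measurable_const_add _))
    rw [← hr.tsum_step hg, ← ENNReal.tsum_mul_left]
    refine tsum_congr fun j => ?_
    simp only [G, mul_assoc]
    rw [lintegral_const_mul _ (hms j)]
    ring

/-- The weight collected by a jump path up to time `V`. -/
noncomputable def totalWeight (g : ℝ → ℝ) (V : ℝ≥0) (H : ℕ → ℝ≥0∞) (f : ℝ≥0 → ℕ) : ℝ≥0∞ :=
  ENNReal.ofReal (Real.exp (-∫ s in (0 : ℝ)..V, (1 - g s) * f s.toNNReal)) *
    ∏ k ∈ Finset.range (jumpIndex H V), ENNReal.ofReal (g (jumpTime H (k + 1)).toReal)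

/-- The path equals `Y k` between its `k`-th and `(k + 1)`-th jumps, so the integral splits over
holding periods, cut off at `V`. -/
lemma IsJumpPath.sum_killing {V : ℝ≥0} (hg : IsWeight g V) {Y : ℕ → ℕ} {H : ℕ → ℝ≥0∞}
    {f : ℝ≥0 → ℕ} (h : IsJumpPath Y H f) (n : ℕ) :
    IntervalIntegrable (fun s => (1 - g s) * f s.toNNReal) volume 0 (capTime V (jumpTime H n)) ∧
    ∑ k ∈ Finset.range n, (Y k : ℝ) * (killing g (capTime V (jumpTime H (k + 1))) -
      killing g (capTime V (jumpTime H k))) =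
      ∫ s in (0 : ℝ)..capTime V (jumpTime H n), (1 - g s) * f s.toNNReal := by
  have hc0 : capTime V (jumpTime H 0) = 0 := by simp [capTime]
  have hcell : ∀ k, Set.EqOn (fun s => (Y k : ℝ) * (1 - g s)) (fun s => (1 - g s) * f s.toNNReal)
      (Set.Ioo (capTime V (jumpTime H k)) (capTime V (jumpTime H (k + 1)))) := by
    intro k s hs
    have hs0 : 0 ≤ s := ENNReal.toReal_nonneg.trans hs.1.le
    have hsV : s < V := hs.2.trans_le (capTime_le V.coe_nonneg _)
    have h1 : jumpTime H k ≤ s.toNNReal := by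
      rcases le_total (jumpTime H k) (ENNReal.ofReal V) with hle | hle
      · have := hs.1
        rw [capTime_of_le hle] at this
        rw [← ENNReal.ofReal_toReal (hle.trans_lt ENNReal.ofReal_lt_top).ne]
        exact ENNReal.ofReal_le_ofReal this.le
      · have := hs.1
        rw [capTime_of_ge V.coe_nonneg hle] at this
        exact absurd this hsV.not_gt
    have h2 : s.toNNReal < jumpTime H (k + 1) := by
      by_cases htop : jumpTime H (k + 1) = ⊤
      · rw [htop]; exact ENNReal.coe_lt_top
      · exact (ENNReal.ofReal_lt_iff_lt_toReal hs0 htop).2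
          (hs.2.trans_le (ENNReal.toReal_mono htop (min_le_left _ _)))
    simp only
    rw [h.apply_eq, jumpIndex_eq h1 h2, mul_comm]
  have hle : ∀ k, capTime V (jumpTime H k) ≤ capTime V (jumpTime H (k + 1)) := fun k =>
    capTime_mono V (jumpTime_mono H k.le_succ)
  have hint : ∀ k, IntervalIntegrable (fun s => (1 - g s) * f s.toNNReal) volume
      (capTime V (jumpTime H k)) (capTime V (jumpTime H (k + 1))) := by
    intro k
    have := (intervalIntegrable_one_sub hg (capTime V (jumpTime H k))
      (capTime V (jumpTime H (k + 1)))).const_mul (Y k : ℝ)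
    rw [intervalIntegrable_iff_integrableOn_Ioo_of_le (hle k)] at this ⊢
    exact this.congr_fun (hcell k) measurableSet_Ioo
  have hsum := intervalIntegral.sum_integral_adjacent_intervals
    (a := fun k => capTime V (jumpTime H k)) (n := n) fun k _ => hint k
  refine ⟨?_, ?_⟩
  · have := IntervalIntegrable.trans_iterate
      (a := fun k => capTime V (jumpTime H k)) (n := n) fun k _ => hint k
    rwa [hc0] at this
  · rw [hc0] at hsum
    rw [← hsum]
    refine Finset.sum_congr rfl fun k _ => ?_
    rw [killing_sub hg, ← intervalIntegral.integral_const_mul,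
      intervalIntegral.integral_of_le (hle k), intervalIntegral.integral_of_le (hle k),
      integral_Ioc_eq_integral_Ioo, integral_Ioc_eq_integral_Ioo]
    exact setIntegral_congr_fun measurableSet_Ioo (hcell k)

/-- Once the `n`-th jump falls after `V`, the state value is `1` and later jumps contribute no
factor. The martingale is then equal to its limit. -/
lemma IsJumpPath.pathWeight_mul_stateValue {V : ℝ≥0} (hg : IsWeight g V) {Y : ℕ → ℕ}
    {H : ℕ → ℝ≥0∞} {f : ℝ≥0 → ℕ} (h : IsJumpPath Y H f) {n : ℕ} (hn : jumpIndex H V < n) :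
    pathWeight g V Y H n * stateValue r V (Y n) (jumpTime H n) = totalWeight g V H f := by
  have hle : ∀ k, jumpTime H k ≤ ENNReal.ofReal V ↔ k ≤ jumpIndex H V := fun k => by
    rw [ENNReal.ofReal_coe_nnreal]; exact h.jumpTime_le_iff
  have hlt : ¬ jumpTime H n ≤ ENNReal.ofReal V := by rw [hle]; omega
  rw [stateValue, if_neg hlt, mul_one, pathWeight, totalWeight]
  simp only [stepWeight, ← jumpTime_succ]
  rw [Finset.prod_mul_distrib, ← ENNReal.ofReal_prod_of_nonneg fun k _ => (Real.exp_pos _).le,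
    ← Real.exp_sum, Finset.sum_neg_distrib, (h.sum_killing hg n).2,
    capTime_of_ge V.coe_nonneg (not_le.1 hlt).le]
  congr 1
  rw [← Finset.prod_subset (Finset.range_mono hn.le)]
  · refine Finset.prod_congr rfl fun k hk => ?_
    rw [if_pos ((hle _).2 (Finset.mem_range.1 hk))]
  · intro k _ hk
    rw [if_neg (by rw [hle]; simpa using hk)]

/-- The expected weight collected by the birth and death process is the solution of the Riccati
equation at time `0`. -/
theorem lintegral_totalWeight {V : ℝ≥0} (hg : IsWeight g V) (hr : IsRiccati g V r)
    (hJ : IsJumpHold P 1 fairStep (fun i => holdLaw i) Y H) {Z : ℝ≥0 → Ω → ℕ}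
    (hpath : ∀ᵐ ω ∂P, IsJumpPath (fun k => Y k ω) (fun k => H k ω) (fun t => Z t ω)) :
    ∫⁻ ω, totalWeight g V (fun k => H k ω) (fun t => Z t ω) ∂P = ENNReal.ofReal (r 0) := by
  have hlim := tendsto_lintegral_of_dominated_convergence (μ := P) (fun _ => (1 : ℝ≥0∞))
    (fun n => (lintegral_pathWeight hg hr hJ n).1)
    (f := fun ω => totalWeight g V (fun k => H k ω) (fun t => Z t ω))
    (fun n => Eventually.of_forall fun ω => ?_) (by simp) ?_
  · refine tendsto_nhds_unique hlim ?_
    simp_rw [(lintegral_pathWeight hg hr hJ _).2]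
    exact tendsto_const_nhds
  · refine mul_le_one' (Finset.prod_le_one' fun k _ => stepWeight_le_one hg _ _ _)
      (hr.stateValue_le_one V.coe_nonneg _ _)
  · filter_upwards [hpath] with ω hω
    refine tendsto_const_nhds.congr' ?_
    filter_upwards [eventually_gt_atTop (jumpIndex (fun k => H k ω) V)] with n hn
    exact (hω.pathWeight_mul_stateValue hg hn).symm

end BirthDeath

/-! ### Cox processes and the joint transform of jumps and marks. -/

lemma ENNReal.tsum_pi_prod {n : ℕ} (a : Fin n → ℕ → ℝ≥0∞) :
    ∑' k : Fin n → ℕ, ∏ i, a i (k i) = ∏ i, ∑' j, a i j := by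
  induction n with
  | zero => simp [tsum_fintype]
  | succ n ih =>
    rw [← (Fin.consEquiv fun _ => ℕ).tsum_eq, ENNReal.tsum_prod', Fin.prod_univ_succ,
      ← ENNReal.tsum_mul_right]
    refine tsum_congr fun j => ?_
    rw [← ih, ← ENNReal.tsum_mul_left]
    refine tsum_congr fun k => ?_
    simp [Fin.prod_univ_succ, Fin.consEquiv]

/-- The generating function of the Poisson law: each mark of weight `c` acts as killing at rate `1 -
c`. -/
lemma tsum_pow_mul_poisson {c : ℝ} (hc : 0 ≤ c) (l : ℝ≥0) :
    ∑' k, ENNReal.ofReal c ^ k * ENNReal.ofReal ((poissonMeasure l).real {k}) =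
      ENNReal.ofReal (Real.exp (-((1 - c) * l))) := by
  have h : HasSum (fun k : ℕ => Real.exp (-l) * ((c * l) ^ k / (Nat.factorial k)))
      (Real.exp (-l) * Real.exp (c * l)) := by
    rw [Real.exp_eq_exp_ℝ]
    exact (NormedSpace.expSeries_div_hasSum_exp (c * (l : ℝ))).mul_left _
  rw [← Real.exp_add] at h
  rw [show -((1 - c) * (l : ℝ)) = -l + c * l by ring, ← h.tsum_eq,
    ENNReal.ofReal_tsum_of_nonneg (fun k => by positivity) h.summable]
  refine tsum_congr fun k => ?_
  rw [← ENNReal.ofReal_pow hc, ← ENNReal.ofReal_mul (by positivity),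
    poissonMeasure_real_singleton, mul_pow]
  congr 1
  ring

/-- If `P⟦A | m⟧ = w`, then `∫⁻_A B = ∫⁻ w B` for `m`-measurable `B`. -/
lemma setLIntegral_eq_of_condExp {Ω : Type*} {m m₀ : MeasurableSpace Ω} {P : Measure[m₀] Ω}
    [IsProbabilityMeasure P] (hm : m ≤ m₀) {A : Set Ω} (hA : MeasurableSet[m₀] A) {w : Ω → ℝ}
    (hw0 : ∀ ω, 0 ≤ w ω) (hw : P⟦A | m⟧ =ᵐ[P] w) {B : Ω → ℝ≥0∞} (hB : Measurable[m] B) :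
    AEMeasurable w P ∧ ∫⁻ ω in A, B ω ∂P = ∫⁻ ω, ENNReal.ofReal (w ω) * B ω ∂P := by
  have hint : Integrable (A.indicator fun _ => (1 : ℝ)) P :=
    (integrable_const 1).indicator hA
  have hwint : Integrable w P := integrable_condExp.congr hw
  have hwm : AEMeasurable w P := hwint.1.aemeasurable
  refine ⟨hwm, ?_⟩
  -- The defining property of conditional expectation, read as an equality of measures on the
  -- smaller σ-algebra; it then extends from sets to nonnegative functions.
  have key : (P.restrict A).trim hm =
      (P.withDensity fun ω => ENNReal.ofReal (w ω)).trim hm := by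
    refine @Measure.ext _ m _ _ fun F hF => ?_
    rw [trim_measurableSet_eq hm hF, trim_measurableSet_eq hm hF,
      Measure.restrict_apply (hm F hF), withDensity_apply _ (hm F hF),
      ← ofReal_integral_eq_lintegral_ofReal hwint.integrableOn (Eventually.of_forall hw0),
      ← setIntegral_congr_ae (hm F hF) (hw.mono fun ω h _ => h),
      setIntegral_condExp hm hint hF, setIntegral_indicator hA, setIntegral_const]
    simp
  have h := congrArg (fun μ => @lintegral _ m μ B) key
  simp only [lintegral_trim hm hB] at h
  rw [h, lintegral_withDensity_eq_lintegral_mul₀' hwm.ennreal_ofReal]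
  · rfl
  · exact (hB.mono hm le_rfl).aemeasurable

/-- The conditional probability of no point in the interval is `exp (-Λ)` for the integrated
intensity `Λ`. Conditional expectations are measurable up to null sets, and `-log` recovers `Λ`. -/
lemma IsCoxProcess.aemeasurable_cumIntensity {Ω : Type*} [MeasurableSpace Ω]
    {P : Measure Ω} {X : ℝ≥0 → Ω → ℝ≥0} {M : ℝ≥0 → Ω → ℕ}
    (hM : IsCoxProcess P X M) {a b : ℝ≥0} (hab : a ≤ b) :
    AEMeasurable (fun ω => (cumIntensity X a b ω).toReal) P := by
  have hmono : Monotone fun j : ℕ => if j = 0 then a else b := by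
    intro i j hij
    rcases Nat.eq_zero_or_pos i with rfl | hi
    · by_cases hj : j = 0 <;> simp [hj, hab]
    · simp [hi.ne', (hi.trans_le hij).ne']
  have h := hM.condLaw 1 _ (fun _ => 0) hmono
  have hm := (integrable_condExp.congr h).1.aemeasurable
  simp only [Finset.prod_range_one, poissonMeasure_real_singleton] at hm
  refine (Real.measurable_log.comp_aemeasurable hm).neg.congr (Eventually.of_forall fun ω => ?_)
  simp [ENNReal.coe_toNNReal_eq_toReal]

lemma measurable_gridChanges {Ω : Type*} (Z : ℝ≥0 → Ω → ℕ) (a b : ℝ≥0) (m : ℕ) :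
    Measurable[processSigma fun t ω => (Z t ω : ℝ≥0)] fun ω => gridChanges (fun t => Z t ω) a b m := by
  have hZ : ∀ t, Measurable[processSigma fun t ω => (Z t ω : ℝ≥0)] fun ω => (Z t ω : ℝ≥0) :=
    fun t => by
      have h := (measurable_pi_apply t).comp
        (comap_measurable (fun ω (t : ℝ≥0) => (Z t ω : ℝ≥0)))
      exact h
  refine Finset.measurable_sum _ fun k _ => ?_
  refine Measurable.ite ?_ measurable_const measurable_const
  have := measurableSet_eq_fun
    (hZ (a + k * ((b - a) / m))) (hZ (a + (k + 1 : ℕ) * ((b - a) / m)))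
  simpa only [Nat.cast_inj] using this

section Cox

variable {Ω : Type*} [MeasurableSpace Ω] {P : Measure Ω} [IsProbabilityMeasure P]

/-- Decompose by the values of the increments, replace each event by its conditional Poisson
probability against the `X`-measurable `B`, and sum the generating functions. -/
lemma IsCoxProcess.lintegral_increments {X : ℝ≥0 → Ω → ℝ≥0} {M : ℝ≥0 → Ω → ℕ}
    (hM : IsCoxProcess P X M) (n : ℕ) {t : ℕ → ℝ≥0} (ht : Monotone t) {c : ℕ → ℝ}
    (hc : ∀ i, 0 ≤ c i) {B : Ω → ℝ≥0∞} (hB : Measurable[processSigma X] B) :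
    ∫⁻ ω, (∏ i ∈ Finset.range n, ENNReal.ofReal (c i) ^ (M (t (i + 1)) ω - M (t i) ω)) * B ω ∂P =
      ∫⁻ ω, (∏ i ∈ Finset.range n, ENNReal.ofReal
        (Real.exp (-((1 - c i) * (cumIntensity X (t i) (t (i + 1)) ω).toReal)))) * B ω ∂P := by
  have hm : processSigma X ≤ (inferInstance : MeasurableSpace Ω) :=
    (measurable_pi_lambda _ hM.measurable_intensity).comap_le
  let D : Ω → Fin n → ℕ := fun ω i => M (t (i + 1)) ω - M (t i) ω
  have hD : Measurable D := measurable_pi_lambda _ fun i =>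
    (hM.measurable _).sub (hM.measurable _)
  let w : (Fin n → ℕ) → Ω → ℝ := fun k ω =>
    ∏ i : Fin n, (poissonMeasure (cumIntensity X (t i) (t (i + 1)) ω).toNNReal).real {k i}
  have hw0 : ∀ k ω, 0 ≤ w k ω := fun k ω => Finset.prod_nonneg fun i _ => measureReal_nonneg
  have hcond : ∀ k : Fin n → ℕ, AEMeasurable (w k) P ∧
      ∫⁻ ω in D ⁻¹' {k}, B ω ∂P = ∫⁻ ω, ENNReal.ofReal (w k ω) * B ω ∂P := by
    intro k
    let k' : ℕ → ℕ := fun i => if h : i < n then k ⟨i, h⟩ else 0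
    have hA : MeasurableSet {ω | ∀ i < n, M (t (i + 1)) ω = M (t i) ω + k' i} := by
      simp only [Set.ofPred_forall]
      exact MeasurableSet.iInter fun i => MeasurableSet.iInter fun _ =>
        measurableSet_eq_fun (hM.measurable _) ((hM.measurable _).add_const _)
    have hw := hM.condLaw n t k' ht
    have hwk : (fun ω => ∏ i ∈ Finset.range n,
        (poissonMeasure (cumIntensity X (t i) (t (i + 1)) ω).toNNReal).real {k' i}) = w k := by
      funext ω
      rw [Finset.prod_range]
      simp [w, k']
    rw [hwk] at hw
    obtain ⟨h1, h2⟩ := setLIntegral_eq_of_condExp hm hA (hw0 k) hw hB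
    refine ⟨h1, ?_⟩
    rw [← h2]
    refine setLIntegral_congr ?_
    -- Monotonicity makes the truncated difference a genuine increment.
    filter_upwards [hM.monotone] with ω hω
    refine propext ?_
    change D ω = k ↔ ∀ i < n, M (t (i + 1)) ω = M (t i) ω + k' i
    constructor
    · intro h i hi
      have := congrFun h ⟨i, hi⟩
      have hmono := hω (ht (i.le_add_right 1))
      simp only [D, k', dif_pos hi] at this ⊢
      simp only at hmono
      omega
    · intro h
      funext i
      have := h i i.2
      simp only [D, k', dif_pos i.2] at this ⊢
      simp [this]
  have hBm : AEMeasurable B P := (hB.mono hm le_rfl).aemeasurable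
  have hsplit : ∫⁻ ω, (∏ i ∈ Finset.range n,
      ENNReal.ofReal (c i) ^ (M (t (i + 1)) ω - M (t i) ω)) * B ω ∂P =
      ∑' k : Fin n → ℕ, ∫⁻ ω in D ⁻¹' {k}, (∏ i : Fin n, ENNReal.ofReal (c i) ^ k i) * B ω ∂P := by
    rw [← setLIntegral_univ, show (Set.univ : Set Ω) = ⋃ k, D ⁻¹' {k} by ext; simp,
      lintegral_iUnion (fun k => hD (measurableSet_singleton k)) fun j k hjk =>
        Set.disjoint_left.2 fun ω h1 h2 => hjk (h1.symm.trans h2)]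
    refine tsum_congr fun k => setLIntegral_congr_fun (hD (measurableSet_singleton k)) ?_
    intro ω hω
    have hω : D ω = k := hω
    simp only [← hω, D, Finset.prod_range]
  rw [hsplit]
  have hwB : ∀ k, AEMeasurable (fun ω => ENNReal.ofReal (w k ω) * B ω) P := fun k =>
    (hcond k).1.ennreal_ofReal.mul hBm
  have hk : ∀ k : Fin n → ℕ,
      ∫⁻ ω in D ⁻¹' {k}, (∏ i : Fin n, ENNReal.ofReal (c i) ^ k i) * B ω ∂P =
      ∫⁻ ω, (∏ i : Fin n, ENNReal.ofReal (c i) ^ k i) * (ENNReal.ofReal (w k ω) * B ω) ∂P := by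
    intro k
    rw [lintegral_const_mul'' _ hBm.restrict, (hcond k).2,
      lintegral_const_mul'' _ (hwB k)]
  simp_rw [hk]
  have hcwB : ∀ k : Fin n → ℕ, AEMeasurable (fun ω => (∏ i : Fin n, ENNReal.ofReal (c i) ^ k i) *
      (ENNReal.ofReal (w k ω) * B ω)) P := fun k => (hwB k).const_mul _
  rw [← lintegral_tsum hcwB]
  refine lintegral_congr fun ω => ?_
  simp_rw [← mul_assoc]
  rw [ENNReal.tsum_mul_right, Finset.prod_range]
  congr 1
  have e : ∀ k : Fin n → ℕ, (∏ i : Fin n, ENNReal.ofReal (c i) ^ k i) * ENNReal.ofReal (w k ω) =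
      ∏ i : Fin n, (ENNReal.ofReal (c i) ^ k i * ENNReal.ofReal
        ((poissonMeasure (cumIntensity X (t i) (t (i + 1)) ω).toNNReal).real {k i})) := by
    intro k
    rw [ENNReal.ofReal_prod_of_nonneg fun i _ => measureReal_nonneg, Finset.prod_mul_distrib]
  simp_rw [e]
  rw [ENNReal.tsum_pi_prod (a := fun i j => ENNReal.ofReal (c i) ^ j * ENNReal.ofReal
        ((poissonMeasure (cumIntensity X (t i) (t (i + 1)) ω).toNNReal).real {j}))]
  exact Finset.prod_congr rfl fun i _ => tsum_pow_mul_poisson (hc i) _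

/-- The value on `(t l, t (l + 1)]` of the product weight with factors `b i` on `[0, t (i + 1)]`. -/
noncomputable def cellWeight (n : ℕ) (b : ℕ → ℝ) (l : ℕ) : ℝ :=
  ∏ i ∈ Finset.range n, if l ≤ i then b i else 1

/-- The product of the weights `b i` over the `i` with `x ≤ t (i + 1)`. -/
noncomputable def prodWeight (n : ℕ) (t : ℕ → ℝ≥0) (b : ℕ → ℝ) (x : ℝ) : ℝ :=
  ∏ i ∈ Finset.range n, if x ≤ t (i + 1) then b i else 1

variable {n : ℕ} {t : ℕ → ℝ≥0} {b : ℕ → ℝ}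

/-- The only possible discontinuities are the thresholds, and `t n` is a horizon because every
threshold that occurs is at most `t n`. -/
lemma isWeight_prodWeight (ht : Monotone t) (hb0 : ∀ i, 0 ≤ b i) (hb1 : ∀ i, b i ≤ 1) :
    IsWeight (prodWeight n t b) (t n) := by
  have h0 : ∀ x i, 0 ≤ if x ≤ (t (i + 1) : ℝ) then b i else 1 := fun x i => by
    split_ifs; exacts [hb0 i, zero_le_one]
  refine ⟨?_, fun x => Finset.prod_nonneg fun i _ => h0 x i, fun x => Finset.prod_le_one
    (fun i _ => h0 x i) fun i _ => ?_, fun x hx => Finset.prod_eq_one fun i hi => ?_,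
    (t n).coe_nonneg, Set.range fun i => (t (i + 1) : ℝ), Set.countable_range _, fun x hx => ?_⟩
  · exact Finset.measurable_prod _ fun i _ =>
      Measurable.ite measurableSet_Iic measurable_const measurable_const
  · split_ifs; exacts [hb1 i, le_rfl]
  · rw [if_neg]
    have : t (i + 1) ≤ t n := ht (Finset.mem_range.1 hi)
    exact not_le.2 (lt_of_le_of_lt (by exact_mod_cast this) hx)
  · refine tendsto_finsetProd _ fun i _ => ?_
    have hne : x ≠ t (i + 1) := fun h => hx ⟨i, h.symm⟩
    rcases lt_or_gt_of_ne hne with h | h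
    · rw [if_pos h.le]
      refine tendsto_const_nhds.congr' ?_
      filter_upwards [gt_mem_nhds h] with y hy
      rw [if_pos hy.le]
    · rw [if_neg h.not_ge]
      refine tendsto_const_nhds.congr' ?_
      filter_upwards [lt_mem_nhds h] with y hy
      rw [if_neg hy.not_ge]

lemma prodWeight_eq_cellWeight (ht : Monotone t) {l : ℕ} {x : ℝ}
    (hx : x ∈ Set.Ioc (t l : ℝ) (t (l + 1))) : prodWeight n t b x = cellWeight n b l := by
  refine Finset.prod_congr rfl fun i _ => ?_
  congr 1
  refine propext ⟨fun h => ?_, fun h => hx.2.trans (by exact_mod_cast ht (by omega))⟩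
  by_contra hlt
  have : t (i + 1) ≤ t l := ht (by omega)
  exact absurd (hx.1.trans_le h) (not_lt.2 (by exact_mod_cast this))

/-- Summation by parts in the exponents: a point in the `l`-th cell is counted at all thresholds
with `i ≥ l`. This passes from counts to increments. -/
lemma prod_pow_eq_prod_cellWeight {f : ℕ → ℕ} (hf : Monotone f) (hf0 : f 0 = 0) :
    ∏ i ∈ Finset.range n, ENNReal.ofReal (b i) ^ f (i + 1) =
      ∏ l ∈ Finset.range n, (∏ i ∈ Finset.range n,
        if l ≤ i then ENNReal.ofReal (b i) else 1) ^ (f (l + 1) - f l) := by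
  simp_rw [← Finset.prod_pow]
  rw [Finset.prod_comm]
  refine Finset.prod_congr rfl fun i hi => ?_
  have hi := Finset.mem_range.1 hi
  have e : f (i + 1) = ∑ l ∈ Finset.range (i + 1), (f (l + 1) - f l) := by
    rw [Finset.sum_range_tsub hf, hf0, Nat.sub_zero]
  rw [e, ← Finset.prod_pow_eq_pow_sum]
  symm
  rw [← Finset.prod_subset (Finset.range_mono (by omega : i + 1 ≤ n))]
  · exact Finset.prod_congr rfl fun l hl => by
      rw [if_pos (by simpa [Nat.lt_succ_iff] using hl)]
  · intro l _ hl
    rw [if_neg (by simpa [Nat.lt_succ_iff] using hl), one_pow]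

lemma ofReal_cellWeight (hb0 : ∀ i, 0 ≤ b i) (l : ℕ) : ENNReal.ofReal (cellWeight n b l) =
    ∏ i ∈ Finset.range n, if l ≤ i then ENNReal.ofReal (b i) else 1 := by
  rw [cellWeight, ENNReal.ofReal_prod_of_nonneg fun i _ => by split_ifs; exacts [hb0 i, zero_le_one]]
  exact Finset.prod_congr rfl fun i _ => by split_ifs <;> simp

/-- The total weight of a jump path for a product weight. -/
lemma IsJumpPath.totalWeight_prodWeight {Y : ℕ → ℕ} {H : ℕ → ℝ≥0∞} {f : ℝ≥0 → ℕ}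
    (h : IsJumpPath Y H f) (ht : Monotone t) (ht0 : t 0 = 0) (hb0 : ∀ i, 0 ≤ b i)
    (hfin : ∀ v : ℝ≥0, ∫⁻ s in Set.Ioc (0 : ℝ) v, (f s.toNNReal : ℝ≥0∞) < ⊤) :
    totalWeight (prodWeight n t b) (t n) H f =
      (∏ i ∈ Finset.range n, ENNReal.ofReal (Real.exp (-((1 - cellWeight n b i) *
        (∫⁻ s in Set.Ioc (t i : ℝ) (t (i + 1)), (f s.toNNReal : ℝ≥0∞)).toReal)))) *
      ∏ i ∈ Finset.range n, ENNReal.ofReal (b i) ^ jumpIndex H (t (i + 1)) := by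
  have hfm : Measurable fun s : ℝ => (f s.toNNReal : ℝ) := by
    have : Measurable fun s : ℝ => f s.toNNReal := by
      simp_rw [h.apply_eq]
      exact measurable_from_nat.comp (h.jumpIndex_mono.measurable.comp measurable_real_toNNReal)
    exact measurable_from_nat.comp this
  have hmono : ∀ l, (t l : ℝ) ≤ t (l + 1) := fun l => by exact_mod_cast ht l.le_succ
  have hfint : ∀ l, IntegrableOn (fun s : ℝ => (f s.toNNReal : ℝ)) (Set.Ioc (t l) (t (l + 1))) := by
    intro l
    have : IntegrableOn (fun s : ℝ => (f s.toNNReal : ℝ)) (Set.Ioc 0 (t (l + 1))) := by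
      refine ⟨hfm.aestronglyMeasurable, ?_⟩
      rw [hasFiniteIntegral_iff_ofReal (Eventually.of_forall fun s => Nat.cast_nonneg _)]
      simpa using hfin (t (l + 1))
    exact this.mono_set (Set.Ioc_subset_Ioc_left (t l).coe_nonneg)
  have hcell : ∀ l, Set.EqOn (fun s : ℝ => (1 - cellWeight n b l) * (f s.toNNReal : ℝ))
      (fun s => (1 - prodWeight n t b s) * f s.toNNReal) (Set.Ioc (t l) (t (l + 1))) :=
    fun l s hs => by simp only [prodWeight_eq_cellWeight ht hs]
  have hsum := intervalIntegral.sum_integral_adjacent_intervals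
    (f := fun s => (1 - prodWeight n t b s) * f s.toNNReal) (μ := volume)
    (a := fun k => (t k : ℝ)) (n := n) fun l _ => by
      rw [intervalIntegrable_iff_integrableOn_Ioc_of_le (hmono l)]
      exact IntegrableOn.congr_fun ((hfint l).const_mul _) (hcell l) measurableSet_Ioc
  rw [ht0, NNReal.coe_zero] at hsum
  rw [totalWeight, ← hsum, ← Finset.sum_neg_distrib, Real.exp_sum,
    ENNReal.ofReal_prod_of_nonneg fun k _ => (Real.exp_pos _).le]
  congr 1
  · refine Finset.prod_congr rfl fun l _ => ?_
    rw [intervalIntegral.integral_of_le (hmono l), ← setIntegral_congr_fun measurableSet_Ioc (hcell l),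
      integral_const_mul, integral_eq_lintegral_of_nonneg_ae
        (Eventually.of_forall fun s => Nat.cast_nonneg _) hfm.aestronglyMeasurable]
    simp
  · have e : ∀ k ∈ Finset.range (jumpIndex H (t n)),
        ENNReal.ofReal (prodWeight n t b (jumpTime H (k + 1)).toReal) =
        ∏ i ∈ Finset.range n, if k < jumpIndex H (t (i + 1)) then ENNReal.ofReal (b i) else 1 := by
      intro k hk
      rw [prodWeight, ENNReal.ofReal_prod_of_nonneg fun i _ => by
        split_ifs; exacts [hb0 i, zero_le_one]]
      refine Finset.prod_congr rfl fun i _ => ?_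
      have hlt := h.jumpTime_lt_top (Nat.succ_le_of_lt (Finset.mem_range.1 hk))
      have : (jumpTime H (k + 1)).toReal ≤ t (i + 1) ↔ k < jumpIndex H (t (i + 1)) := by
        rw [← Nat.succ_le_iff, ← h.jumpTime_le_iff, Nat.succ_eq_add_one,
          ← ENNReal.ofReal_le_ofReal_iff (t (i + 1)).coe_nonneg, ENNReal.ofReal_toReal hlt.ne,
          ENNReal.ofReal_coe_nnreal]
      simp only [this]
      split_ifs <;> simp
    rw [Finset.prod_congr rfl e, Finset.prod_comm]
    refine Finset.prod_congr rfl fun i hi => ?_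
    have hle : jumpIndex H (t (i + 1)) ≤ jumpIndex H (t n) :=
      h.jumpIndex_mono (ht (Finset.mem_range.1 hi))
    rw [← Finset.prod_subset (Finset.range_mono hle) fun k _ hk => by
      rw [if_neg (by simpa using hk)]]
    rw [Finset.prod_congr rfl fun k hk => if_pos (Finset.mem_range.1 hk)]
    simp

/-- Joint transform of the jumps of the birth and death process and of the marks. -/
theorem lintegral_jumps_marks {Z M : ℝ≥0 → Ω → ℕ} {Y : ℕ → Ω → ℕ} {H : ℕ → Ω → ℝ≥0∞}
    (hJ : IsJumpHold P 1 fairStep (fun i => holdLaw i) Y H)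
    (hpath : ∀ᵐ ω ∂P, IsJumpPath (fun k => Y k ω) (fun k => H k ω) (fun t => Z t ω))
    (hM : IsCoxProcess P (fun t ω => (Z t ω : ℝ≥0)) M) (ht : Monotone t) (ht0 : t 0 = 0)
    (hb0 : ∀ i, 0 ≤ b i) (hb1 : ∀ i, b i ≤ 1) {r : ℝ → ℝ}
    (hr : IsRiccati (prodWeight n t b) (t n) r) :
    ∫⁻ ω, ∏ i ∈ Finset.range n, ENNReal.ofReal (b i) ^
      (jumpIndex (fun k => H k ω) (t (i + 1)) + M (t (i + 1)) ω) ∂P = ENNReal.ofReal (r 0) := by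
  rw [← lintegral_totalWeight (isWeight_prodWeight ht hb0 hb1) hr hJ hpath]
  set B : ℕ → Ω → ℝ≥0∞ := fun m ω => ∏ i ∈ Finset.range n,
    ENNReal.ofReal (b i) ^ gridChanges (fun s => Z s ω) 0 (t (i + 1)) m with hBdef
  set J : Ω → ℝ≥0∞ := fun ω => ∏ i ∈ Finset.range n,
    ENNReal.ofReal (b i) ^ jumpIndex (fun k => H k ω) (t (i + 1)) with hJdef
  have hm : processSigma (fun t ω => (Z t ω : ℝ≥0)) ≤ (inferInstance : MeasurableSpace Ω) :=
    (measurable_pi_lambda _ hM.measurable_intensity).comap_le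
  have hBm : ∀ m, Measurable[processSigma fun t ω => (Z t ω : ℝ≥0)] (B m) := fun m =>
    Finset.measurable_prod _ fun i _ => measurable_from_nat.comp (measurable_gridChanges Z _ _ m)
  have hb1' : ∀ i, ENNReal.ofReal (b i) ≤ 1 := fun i => by simpa using hb1 i
  have hB1 : ∀ m ω, B m ω ≤ 1 := fun m ω => Finset.prod_le_one' fun i _ => pow_le_one' (hb1' i) _
  have hBlim : ∀ᵐ ω ∂P, ∀ᶠ m in atTop, B m ω = J ω := by
    filter_upwards [hpath] with ω hω
    have : ∀ᶠ m in atTop, ∀ i ∈ Finset.range n, gridChanges (fun s => Z s ω) 0 (t (i + 1)) m =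
        jumpIndex (fun k => H k ω) (t (i + 1)) := by
      rw [eventually_all_finset]
      intro i _
      have := hω.eventually_gridChanges (zero_le (a := t (i + 1)))
      rwa [hω.jumpIndex_zero, Nat.sub_zero] at this
    filter_upwards [this] with m hm
    exact Finset.prod_congr rfl fun i hi => by rw [hm i hi]
  have hlim : ∀ F : Ω → ℝ≥0∞, AEMeasurable F P → (∀ ω, F ω ≤ 1) →
      Tendsto (fun m => ∫⁻ ω, F ω * B m ω ∂P) atTop (𝓝 (∫⁻ ω, F ω * J ω ∂P)) := by
    intro F hF hF1
    refine tendsto_lintegral_of_dominated_convergence' (fun _ => 1)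
      (fun m => hF.mul ((hBm m).mono hm le_rfl).aemeasurable)
      (fun m => Eventually.of_forall fun ω => mul_le_one' (hF1 ω) (hB1 m ω)) (by simp) ?_
    filter_upwards [hBlim] with ω hω
    refine tendsto_const_nhds.congr' ?_
    filter_upwards [hω] with m hm
    rw [hm]
  set F₁ : Ω → ℝ≥0∞ := fun ω => ∏ i ∈ Finset.range n,
    ENNReal.ofReal (cellWeight n b i) ^ (M (t (i + 1)) ω - M (t i) ω)
  set F₂ : Ω → ℝ≥0∞ := fun ω => ∏ i ∈ Finset.range n, ENNReal.ofReal
    (Real.exp (-((1 - cellWeight n b i) *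
      (cumIntensity (fun t ω => (Z t ω : ℝ≥0)) (t i) (t (i + 1)) ω).toReal)))
  have hc0 : ∀ i, 0 ≤ cellWeight n b i := fun l => Finset.prod_nonneg fun i _ => by
    split_ifs; exacts [hb0 i, zero_le_one]
  have hc1 : ∀ i, cellWeight n b i ≤ 1 := fun l => Finset.prod_le_one
    (fun i _ => by split_ifs; exacts [hb0 i, zero_le_one])
    fun i _ => by split_ifs; exacts [hb1 i, le_rfl]
  have hF₁m : Measurable F₁ := Finset.measurable_prod _ fun i _ =>
    measurable_from_nat.comp ((hM.measurable _).sub (hM.measurable _))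
  have hF₁1 : ∀ ω, F₁ ω ≤ 1 := fun ω => Finset.prod_le_one' fun i _ =>
    pow_le_one' (by simpa using hc1 i) _
  have hF₂1 : ∀ ω, F₂ ω ≤ 1 := fun ω => Finset.prod_le_one' fun i _ => by
    rw [ENNReal.ofReal_le_one, Real.exp_le_one_iff]
    have := mul_nonneg (sub_nonneg.2 (hc1 i)) (ENNReal.toReal_nonneg
      (a := cumIntensity (fun t ω => (Z t ω : ℝ≥0)) (t i) (t (i + 1)) ω))
    linarith
  have htot : ∀ᵐ ω ∂P, totalWeight (prodWeight n t b) (t n) (fun k => H k ω) (fun s => Z s ω) =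
      F₂ ω * J ω := by
    filter_upwards [hpath, hM.cumIntensity_lt_top] with ω hω hfin
    rw [hω.totalWeight_prodWeight ht ht0 hb0 fun v => by simpa [cumIntensity] using hfin v]
    simp [F₂, J, cumIntensity]
  have hlhs : ∀ᵐ ω ∂P, ∏ i ∈ Finset.range n, ENNReal.ofReal (b i) ^
      (jumpIndex (fun k => H k ω) (t (i + 1)) + M (t (i + 1)) ω) = F₁ ω * J ω := by
    filter_upwards [hM.monotone, hM.zero] with ω hmono hzero
    simp only [pow_add, Finset.prod_mul_distrib, F₁, J, ofReal_cellWeight hb0]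
    rw [prod_pow_eq_prod_cellWeight (f := fun i => M (t i) ω) (hmono.comp ht)
      (by simp only [ht0, hzero]), mul_comm]
  have hF₂m : AEMeasurable F₂ P := by
    refine Finset.aemeasurable_fun_prod _ fun i _ => ?_
    have h := hM.aemeasurable_cumIntensity (ht i.le_succ)
    exact (Real.measurable_exp.comp_aemeasurable (h.const_mul _).neg).ennreal_ofReal
  rw [lintegral_congr_ae hlhs, lintegral_congr_ae htot]
  -- The conditional law of the marks applies to the grid versions `B m`, which are measurable for
  -- the process; the jump factor `J` is only their almost sure limit.
  refine tendsto_nhds_unique (hlim F₁ hF₁m.aemeasurable hF₁1) ?_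
  refine (hlim F₂ hF₂m hF₂1).congr fun m => ?_
  exact (hM.lintegral_increments n ht hc0 (hBm m)).symm

end Cox

/-! ### Counts as limits, and enumeration of finite time sets. -/

section Counting

open scoped Classical in
/-- The number of elements of `A` below `N` is eventually `A.encard`, or tends to infinity. -/
lemma encard_eventually_or_tendsto (A : Set ℕ) :
    (∀ᶠ N in atTop, (((Finset.range N).filter (· ∈ A)).card : ℕ∞) = A.encard) ∨
      (A.encard = ⊤ ∧ Tendsto (fun N => ((Finset.range N).filter (· ∈ A)).card) atTop atTop) := by
  rcases A.finite_or_infinite with hA | hA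
  · left
    obtain ⟨N₀, hN₀⟩ := hA.toFinset.exists_nat_subset_range
    filter_upwards [eventually_ge_atTop N₀] with N hN
    have : (Finset.range N).filter (· ∈ A) = hA.toFinset := by
      ext k
      simp only [Finset.mem_filter, Set.Finite.mem_toFinset, and_iff_right_iff_imp]
      exact fun hk => Finset.range_mono hN (hN₀ (hA.mem_toFinset.2 hk))
    rw [this, hA.encard_eq_coe_toFinset_card]
  · right
    refine ⟨hA.encard_eq, tendsto_atTop_atTop_of_monotone (fun N N' h =>
      Finset.card_le_card (Finset.filter_subset_filter _ (Finset.range_mono h))) fun B => ?_⟩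
    obtain ⟨F, hFA, hF⟩ := hA.exists_subset_card_eq B
    obtain ⟨N, hN⟩ := F.exists_nat_subset_range
    refine ⟨N, hF ▸ Finset.card_le_card fun k hk => ?_⟩
    exact Finset.mem_filter.2 ⟨hN hk, hFA hk⟩

open scoped Classical in
lemma tendsto_halfPow_card (A : Set ℕ) :
    Tendsto (fun N => (1 / 2 : ℝ) ^ ((Finset.range N).filter (· ∈ A)).card) atTop
      (𝓝 (halfPow A.encard : ℝ)) := by
  rcases encard_eventually_or_tendsto A with h | ⟨h1, h2⟩
  · refine tendsto_const_nhds.congr' ?_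
    filter_upwards [h] with N hN
    rw [← hN, coe_halfPow_natCast]
  · rw [h1, halfPow_top]
    exact (tendsto_pow_atTop_nhds_zero_of_lt_one (by norm_num) (by norm_num)).comp h2

/-- Enumeration of a finite set of times as the values at `1, …, n` of a monotone sequence. -/
lemma exists_monotone_enum (I : Finset ℝ≥0) (m : I → ℕ) : ∃ (t : ℕ → ℝ≥0) (m' : ℕ → ℕ),
    Monotone t ∧ t 0 = 0 ∧ ∀ F : ℝ≥0 → ℕ → ℝ,
      ∏ i : I, F i (m i) = ∏ i ∈ Finset.range I.card, F (t (i + 1)) (m' i) := by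
  set e : Fin I.card ≃o I := I.orderIsoOfFin rfl
  -- `t k` is the supremum of the `k` smallest times: `0` for the empty supremum, and constant from
  -- `I.card` on.
  refine ⟨fun k => (Finset.univ.filter fun j : Fin I.card => (j : ℕ) < k).sup fun j => (e j : ℝ≥0),
    fun i => if h : i < I.card then m (e ⟨i, h⟩) else 0, fun k l hkl => ?_, by simp, fun F => ?_⟩
  · exact Finset.sup_mono fun j hj => by
      simp only [Finset.mem_filter, Finset.mem_univ, true_and] at hj ⊢
      omega
  · rw [Finset.prod_range, ← e.toEquiv.prod_comp]
    refine Finset.prod_congr rfl fun i _ => ?_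
    have : ((Finset.univ.filter fun j : Fin I.card => (j : ℕ) < i + 1).sup
        fun j => (e j : ℝ≥0)) = e i := by
      refine le_antisymm (Finset.sup_le fun j hj => ?_)
        (Finset.le_sup (f := fun j => (e j : ℝ≥0)) (by simp))
      simp only [Finset.mem_filter, Finset.mem_univ, true_and] at hj
      exact e.monotone (Fin.le_def.2 (by omega))
    simp only [this, i.2, dite_true]
    rfl

end Counting

/-! ### The ladder time and the counts of the walk. -/

section Walk

variable {Ω : Type*} {X : ℕ → Ω → ℝ}

/-- Since `S 0 = 0` is not negative, the ladder time is at least `1` and the subtraction in `nu` is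
never truncated; an infinite ladder time stays infinite. -/
lemma natCast_le_nu_iff (X : ℕ → Ω → ℝ) (ω : Ω) (k : ℕ) :
    (k : ℕ∞) ≤ nu X ω ↔ ∀ j ≤ k, 0 ≤ walk X j ω := by
  have h0 : ladderTime X ω ≠ 0 := by
    intro h
    obtain ⟨j, hj, hj'⟩ := (hittingAfter_le_iff (u := walk X) (s := Set.Iio 0) (n := 0) (i := 0)
      (ω := ω)).1 h.le
    obtain rfl : j = 0 := by simpa using hj
    simp [walk] at hj'
  have h1 : (k : ℕ∞) ≤ nu X ω ↔ (k : ℕ∞) < ladderTime X ω := by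
    rw [nu]
    generalize ladderTime X ω = a at h0
    induction a using ENat.recTopCoe with
    | top => simp
    | coe a =>
      have h0 : a ≠ 0 := by exact_mod_cast h0
      have : ((a : ℕ∞) - 1) = ((a - 1 : ℕ) : ℕ∞) := by simp
      rw [this, Nat.cast_le, Nat.cast_lt]
      omega
  rw [h1]
  constructor
  · intro h j hj
    have := notMem_of_lt_hittingAfter (u := walk X) (s := Set.Iio 0) (n := 0) (k := j) (ω := ω)
      (lt_of_le_of_lt (Nat.cast_le (α := ℕ∞).2 hj) h) (Nat.zero_le j)
    simpa using this
  · intro h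
    by_contra hlt
    obtain ⟨j, hj, hj'⟩ := (hittingAfter_le_iff (u := walk X) (s := Set.Iio 0) (n := 0) (i := k)
      (ω := ω)).1 (not_lt.1 hlt)
    exact absurd hj' (not_lt.2 (h j hj.2))

lemma one_le_nu_iff (X : ℕ → Ω → ℝ) (ω : Ω) : 1 ≤ nu X ω ↔ 0 ≤ X 0 ω := by
  have := natCast_le_nu_iff X ω 1
  rw [Nat.cast_one] at this
  rw [this]
  refine ⟨fun h => by simpa [walk] using h 1 le_rfl, fun h j hj => ?_⟩
  interval_cases j <;> simp [walk, h]

/-- The `k` such that the walk is nonnegative up to time `k + 1`, and at most `v` at that time. -/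
def visitSet (X : ℕ → Ω → ℝ) (v : ℝ) (ω : Ω) : Set ℕ :=
  {k | (∀ j ≤ k, 0 ≤ walk X (j + 1) ω) ∧ walk X (k + 1) ω ≤ v}

lemma Ndes_eq_encard (X : ℕ → Ω → ℝ) (v : ℝ≥0) (ω : Ω) :
    Ndes X v ω = (visitSet X v ω).encard := by
  rw [Ndes, ← (add_left_injective 1).encard_image (visitSet X v ω)]
  congr 1
  ext k
  simp only [natCast_le_nu_iff, visitSet, Set.mem_image, Set.mem_ofPred_eq]
  constructor
  · rintro ⟨hk, h1, h2⟩
    obtain ⟨k, rfl⟩ := Nat.exists_eq_add_of_le' hk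
    exact ⟨k, ⟨fun j hj => h1 _ (by omega), h2⟩, rfl⟩
  · rintro ⟨k, ⟨h1, h2⟩, rfl⟩
    refine ⟨by omega, fun j hj => ?_, h2⟩
    cases j with
    | zero => simp [walk]
    | succ j => exact h1 j (by omega)

open scoped Classical in
lemma walkWeight_eq_prod (g : ℝ → ℝ) (n : ℕ) (x : ℝ) (s : ℕ → ℝ) : walkWeight g n x s =
    ∏ k ∈ Finset.range n, if ∀ j ≤ k, 0 ≤ x + ∑ i ∈ Finset.range (j + 1), s i
      then ENNReal.ofReal (g (x + ∑ i ∈ Finset.range (k + 1), s i)) else 1 := by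
  induction n generalizing x s with
  | zero => simp [walkWeight]
  | succ n ih =>
    rw [walkWeight, Finset.prod_range_succ', ih]
    split_ifs with h1 h2 h2
    · exact absurd (h2 0 le_rfl) (by simpa using h1)
    · rw [mul_one, Finset.prod_eq_one]
      intro k _
      rw [if_neg]
      exact fun h => absurd (h 0 (Nat.zero_le _)) (by simpa using h1)
    · rw [mul_comm]
      congr 1
      · refine Finset.prod_congr rfl fun k _ => ?_
        have e : ∀ j, x + s 0 + ∑ i ∈ Finset.range (j + 1), s (i + 1) =
            x + ∑ i ∈ Finset.range (j + 1 + 1), s i := fun j => by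
          rw [Finset.sum_range_succ' s]; ring
        simp only [e]
        congr 1
        refine propext ⟨fun h j hj => ?_, fun h j hj => h (j + 1) (by omega)⟩
        cases j with
        | zero => exact h2 0 le_rfl
        | succ j => exact h j (by omega)
      · simp
    · exact absurd (fun j hj => by
        obtain rfl : j = 0 := by omega
        simpa using h1) h2

-- A visited point at height `x` contributes `b i` for every threshold `t (i + 1) ≥ x`; exchanging
-- the two products collects the visit counts.
open scoped Classical in
lemma walkWeight_prodWeight {n : ℕ} {t : ℕ → ℝ≥0} {b : ℕ → ℝ} (hb0 : ∀ i, 0 ≤ b i) (N : ℕ)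
    (X : ℕ → Ω → ℝ) (ω : Ω) : walkWeight (prodWeight n t b) N 0 (fun i => X i ω) =
      ∏ i ∈ Finset.range n, ENNReal.ofReal (b i) ^
        ((Finset.range N).filter (· ∈ visitSet X (t (i + 1)) ω)).card := by
  have e : ∀ k, (if ∀ j ≤ k, 0 ≤ 0 + ∑ i ∈ Finset.range (j + 1), X i ω
      then ENNReal.ofReal (prodWeight n t b (0 + ∑ i ∈ Finset.range (k + 1), X i ω)) else 1) =
      ∏ i ∈ Finset.range n, if k ∈ visitSet X (t (i + 1)) ω then ENNReal.ofReal (b i) else 1 := by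
    intro k
    simp only [zero_add]
    change (if ∀ j ≤ k, 0 ≤ walk X (j + 1) ω
      then ENNReal.ofReal (prodWeight n t b (walk X (k + 1) ω)) else 1) = _
    split_ifs with h
    · rw [prodWeight, ENNReal.ofReal_prod_of_nonneg fun i _ => by
        split_ifs; exacts [hb0 i, zero_le_one]]
      refine Finset.prod_congr rfl fun i _ => ?_
      have : k ∈ visitSet X (t (i + 1)) ω ↔ walk X (k + 1) ω ≤ t (i + 1) := and_iff_right h
      simp only [this]
      split_ifs <;> simp
    · symm
      exact Finset.prod_eq_one fun i _ => if_neg fun h' => h h'.1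
  rw [walkWeight_eq_prod, Finset.prod_congr rfl fun k _ => e k, Finset.prod_comm]
  refine Finset.prod_congr rfl fun i _ => ?_
  rw [← Finset.prod_filter, Finset.prod_const]

variable [MeasurableSpace Ω]

lemma measurable_walk (hX : ∀ i, Measurable (X i)) (k : ℕ) : Measurable (walk X k) :=
  Finset.measurable_sum _ fun i _ => hX i

lemma measurable_Ndes (hX : ∀ i, Measurable (X i)) : Measurable fun ω v => Ndes X v ω := by
  refine measurable_pi_lambda _ fun v => ?_
  simp_rw [Ndes_eq_encard]
  refine measurable_encard.comp (measurable_set_iff.2 fun k => measurableSet_setOfPred.1 ?_)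
  have e : {ω | k ∈ visitSet X v ω} =
      (⋂ j, ⋂ _ : j ≤ k, {ω | 0 ≤ walk X (j + 1) ω}) ∩ {ω | walk X (k + 1) ω ≤ v} := by
    ext ω
    simp [visitSet]
  rw [e]
  exact (MeasurableSet.iInter fun j => MeasurableSet.iInter fun _ =>
    measurableSet_le measurable_const (measurable_walk hX _)).inter
      (measurableSet_le (measurable_walk hX _) measurable_const)

/-- Joint transform of the counts of the walk. -/
theorem exists_isRiccati_lintegral_Ndes {P : Measure Ω} [IsProbabilityMeasure P]
    (hXm : ∀ i, Measurable (X i)) (hXlaw : ∀ i, P.map (X i) = laplaceMeasure) (hX : iIndepFun X P)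
    (n : ℕ) {t : ℕ → ℝ≥0} (ht : Monotone t) (m : ℕ → ℕ) :
    ∃ r, IsRiccati (prodWeight n t fun i => (1 / 2) ^ m i) (t n) r ∧
      ∫⁻ ω in {ω | 0 ≤ X 0 ω}, ENNReal.ofReal
        (∏ i ∈ Finset.range n, (halfPow (Ndes X (t (i + 1)) ω) : ℝ) ^ m i) ∂P =
        ENNReal.ofReal (r 0) / 2 := by
  classical
  have hb0 : ∀ i, (0 : ℝ) ≤ (1 / 2) ^ m i := fun i => by positivity
  have hg : IsWeight (prodWeight n t fun i => (1 / 2) ^ m i) (t n) :=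
    isWeight_prodWeight ht hb0 fun i => pow_le_one₀ (by norm_num) (by norm_num)
  obtain ⟨r, hr, hlim⟩ := exists_isRiccati_walk hg
  refine ⟨r, hr, tendsto_nhds_unique ?_ hlim⟩
  -- As the number of steps grows, the truncated visit counts converge, possibly to `∞`, where
  -- `halfPow` is `0`. Finiteness of the ladder time is not required.
  simp_rw [← fun N => (lintegral_walkWeight hg.measurable hXm hXlaw hX N).2]
  have hmeas : ∀ N, Measurable fun ω =>
      walkWeight (prodWeight n t fun i => (1 / 2) ^ m i) (N + 1) 0 (fun i => X i ω) := fun N => by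
    have h := (measurable_walkWeight hg.measurable (N + 1)).comp
      (measurable_const.prodMk (measurable_pi_lambda _ hXm) :
        Measurable fun ω => ((0 : ℝ), fun i => X i ω))
    exact h
  have hw : ∀ N ω, walkWeight (prodWeight n t fun i => (1 / 2) ^ m i) N 0 (fun i => X i ω) =
      ENNReal.ofReal (∏ i ∈ Finset.range n, ((1 / 2 : ℝ) ^
        ((Finset.range N).filter (· ∈ visitSet X (t (i + 1)) ω)).card) ^ m i) := by
    intro N ω
    rw [walkWeight_prodWeight hb0, ENNReal.ofReal_prod_of_nonneg fun i _ => by positivity]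
    refine Finset.prod_congr rfl fun i _ => ?_
    rw [← ENNReal.ofReal_pow (hb0 i), ← pow_mul, ← pow_mul, mul_comm]
  refine tendsto_lintegral_of_dominated_convergence (fun _ => 1) hmeas
    (fun N => Eventually.of_forall fun ω => ?_) (by simp) (Eventually.of_forall fun ω => ?_)
  · simp only
    rw [hw, ENNReal.ofReal_le_one]
    exact Finset.prod_le_one (fun i _ => by positivity) fun i _ =>
      pow_le_one₀ (by positivity) (pow_le_one₀ (by norm_num) (by norm_num))
  · simp_rw [hw, Ndes_eq_encard]
    refine ENNReal.tendsto_ofReal (tendsto_finsetProd _ fun i _ => Tendsto.pow ?_ _)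
    exact (tendsto_halfPow_card _).comp (tendsto_add_atTop_nat 1)

/-- The case of no thresholds: the product is `1`, the horizon is `0`, and the terminal condition
gives `r 0 = 1`. -/
lemma measure_zero_le {P : Measure Ω} [IsProbabilityMeasure P] (hXm : ∀ i, Measurable (X i))
    (hXlaw : ∀ i, P.map (X i) = laplaceMeasure) (hX : iIndepFun X P) :
    P {ω | 0 ≤ X 0 ω} = 1 / 2 := by
  obtain ⟨r, hr, h⟩ := exists_isRiccati_lintegral_Ndes hXm hXlaw hX 0 (t := fun _ => 0)
    monotone_const fun _ => 0
  have h1 := hr.terminal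
  rw [NNReal.coe_zero] at h1
  simpa [h1] using h

end Walk

/-! ### Comparison of the two transforms. -/

section IdentityInLaw

variable {Ω : Type*} [MeasurableSpace Ω]

lemma integral_prod_eq_toReal {P : Measure Ω} {T : Type*} {N : T → Ω → ℕ∞}
    (hN : AEMeasurable (fun ω v => N v ω) P) (n : ℕ) (t : ℕ → T) (m : ℕ → ℕ) :
    ∫ ω, ∏ i ∈ Finset.range n, (halfPow (N (t i) ω) : ℝ) ^ m i ∂P =
      (∫⁻ ω, ENNReal.ofReal (∏ i ∈ Finset.range n, (halfPow (N (t i) ω) : ℝ) ^ m i) ∂P).toReal := by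
  refine integral_eq_lintegral_of_nonneg_ae (Eventually.of_forall fun ω =>
    Finset.prod_nonneg fun i _ => pow_nonneg (halfPow _).2.1 _) ?_
  refine AEMeasurable.aestronglyMeasurable (Finset.aemeasurable_fun_prod _ fun i _ => ?_)
  have h := (measurable_of_countable fun a : ℕ∞ => (halfPow a : ℝ)).comp_aemeasurable
    ((measurable_pi_apply (t i)).comp_aemeasurable hN)
  exact h.pow_const _

lemma ae_Ncount_eq {P : Measure Ω} {Z M : ℝ≥0 → Ω → ℕ} {Y : ℕ → Ω → ℕ} {H : ℕ → Ω → ℝ≥0∞}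
    (hpath : ∀ᵐ ω ∂P, IsJumpPath (fun k => Y k ω) (fun k => H k ω) (fun t => Z t ω)) :
    ∀ᵐ ω ∂P, ∀ v, Ncount Z M v ω = ((jumpIndex (fun k => H k ω) v + M v ω : ℕ) : ℕ∞) := by
  filter_upwards [hpath] with ω hω v
  rw [Ncount, hω.births_add_deaths, Nat.cast_add]

/-- `births` and `deaths` involve left limits at uncountably many times. Counting measurable jump
times gives a version that agrees almost surely for all `v` at once. -/
lemma aemeasurable_Ncount {P : Measure Ω} {Z M : ℝ≥0 → Ω → ℕ} {Y : ℕ → Ω → ℕ}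
    {H : ℕ → Ω → ℝ≥0∞} (hH : ∀ k, Measurable (H k)) (hMm : ∀ v, Measurable (M v))
    (hpath : ∀ᵐ ω ∂P, IsJumpPath (fun k => Y k ω) (fun k => H k ω) (fun t => Z t ω)) :
    AEMeasurable (fun ω v => Ncount Z M v ω) P := by
  refine ⟨fun ω v => {n | jumpTime (fun k => H k ω) (n + 1) ≤ v}.encard + (M v ω : ℕ∞),
    measurable_pi_lambda _ fun v => ?_, ?_⟩
  · refine Measurable.add (measurable_encard.comp
      (measurable_set_iff.2 fun n => measurableSet_setOfPred.1 ?_)) (measurable_from_nat.comp (hMm v))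
    exact measurableSet_le (Finset.measurable_sum _ fun k _ => hH k) measurable_const
  · filter_upwards [ae_Ncount_eq hpath, hpath] with ω h hω
    funext v
    rw [h v, Nat.cast_add]
    congr 1
    have : {n | jumpTime (fun k => H k ω) (n + 1) ≤ v} =
        (Finset.range (jumpIndex (fun k => H k ω) v) : Set ℕ) := by
      ext n
      simp [hω.jumpTime_le_iff]
    rw [this, Set.encard_coe_eq_coe_finsetCard, Finset.card_range]

/-- The identity in law, for a walk with measurable increments. -/
lemma identDistrib_Ndes_Ncount (P : Measure Ω) [IsProbabilityMeasure P] {X : ℕ → Ω → ℝ}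
    (hXm : ∀ i, Measurable (X i)) (hXlaw : ∀ i, P.map (X i) = laplaceMeasure) (hX : iIndepFun X P)
    {Ω' : Type*} [MeasurableSpace Ω'] (P' : Measure Ω') [IsProbabilityMeasure P']
    {Z M : ℝ≥0 → Ω' → ℕ} {Y : ℕ → Ω' → ℕ} {H : ℕ → Ω' → ℝ≥0∞}
    (hJ : IsJumpHold P' 1 fairStep (fun i => holdLaw i) Y H)
    (hpath : ∀ᵐ ω ∂P', IsJumpPath (fun k => Y k ω) (fun k => H k ω) (fun t => Z t ω))
    (hM : IsCoxProcess P' (fun t ω => (Z t ω : ℝ≥0)) M) :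
    IdentDistrib (fun ω v => Ndes X v ω) (fun ω v => Ncount Z M v ω) P[|{ω | 0 ≤ X 0 ω}] P' := by
  have hhalf := measure_zero_le hXm hXlaw hX
  have : IsProbabilityMeasure P[|{ω | 0 ≤ X 0 ω}] :=
    cond_isProbabilityMeasure (by rw [hhalf]; simp)
  have hN' := aemeasurable_Ncount hJ.measurable_hold hM.measurable hpath
  have hN := (measurable_Ndes hXm).aemeasurable (μ := P[|{ω | 0 ≤ X 0 ω}])
  refine identDistrib_of_moments hN hN' fun I m => ?_
  obtain ⟨t, m', ht, ht0, hprod⟩ := exists_monotone_enum I m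
  have e := fun ω => hprod fun v k => (halfPow (Ndes X v ω) : ℝ) ^ k
  have e' := fun ω => hprod fun v k => (halfPow (Ncount Z M v ω) : ℝ) ^ k
  simp only [e, e']
  rw [integral_prod_eq_toReal hN I.card (fun i => t (i + 1)) m',
    integral_prod_eq_toReal hN' I.card (fun i => t (i + 1)) m']
  congr 1
  obtain ⟨r, hr, h⟩ := exists_isRiccati_lintegral_Ndes hXm hXlaw hX I.card ht m'
  have hb0 : ∀ i, (0 : ℝ) ≤ (1 / 2) ^ m' i := fun i => by positivity
  -- Conditioning divides `r 0 / 2` by the probability `1 / 2`, leaving the `r 0` of the birth-death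
  -- side for the same `r`.
  rw [ProbabilityTheory.cond, lintegral_smul_measure, h, hhalf, ← lintegral_jumps_marks hJ hpath hM ht ht0 hb0
    (fun i => pow_le_one₀ (by norm_num) (by norm_num)) hr, smul_eq_mul, one_div, inv_inv,
    ENNReal.mul_div_cancel (by simp) (by simp)]
  refine lintegral_congr_ae ?_
  filter_upwards [ae_Ncount_eq hpath] with ω hω
  rw [ENNReal.ofReal_prod_of_nonneg fun i _ => pow_nonneg (halfPow _).2.1 _]
  refine Finset.prod_congr rfl fun i _ => ?_
  rw [hω, coe_halfPow_natCast, ← ENNReal.ofReal_pow (hb0 i), ← pow_mul, ← pow_mul, mul_comm]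

end IdentityInLaw

theorem mainTheorem4
    {Ω : Type*} [MeasurableSpace Ω] (P : Measure Ω) [IsProbabilityMeasure P]
    (X : ℕ → Ω → ℝ) (hXlaw : ∀ i, HasLaw (X i) laplaceMeasure P) (hXindep : iIndepFun X P)
    {Ω' : Type*} [MeasurableSpace Ω'] (P' : Measure Ω') [IsProbabilityMeasure P']
    (Z M : ℝ≥0 → Ω' → ℕ)
    (hZ : IsBirthDeathProcess P' (fun j => (j : ℝ≥0) / 2) (fun j => (j : ℝ≥0) / 2) 1 Z)
    (hM : IsCoxProcess P' (fun t ω => (Z t ω : ℝ≥0)) M) :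
    (∀ᵐ ω ∂P', ∀ v : ℝ≥0,
      births (fun s => Z s ω) v < ⊤ ∧ deaths (fun s => Z s ω) v < ⊤ ∧
      (Z v ω : ℕ∞) + deaths (fun s => Z s ω) v = 1 + births (fun s => Z s ω) v) ∧
    P {ω | 1 ≤ nu X ω} ≠ 0 ∧
    IdentDistrib (fun ω v => Ndes X v ω) (fun ω v => Ncount Z M v ω)
      P[|{ω | 1 ≤ nu X ω}] P' := by
  obtain ⟨Y, H, hJ, hpath⟩ := hZ.exists_isJumpPath
  -- `HasLaw` gives only almost everywhere measurable increments. Measurable versions change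
  -- countably many variables on null sets, hence change neither the counts almost surely nor the
  -- conditioning.
  let X' : ℕ → Ω → ℝ := fun i => (hXlaw i).aemeasurable.mk (X i)
  have hX'm : ∀ i, Measurable (X' i) := fun i => (hXlaw i).aemeasurable.measurable_mk
  have hae : ∀ i, X i =ᵐ[P] X' i := fun i => (hXlaw i).aemeasurable.ae_eq_mk
  have hX'law : ∀ i, P.map (X' i) = laplaceMeasure := fun i =>
    (Measure.map_congr (hae i)).symm.trans (hXlaw i).map_eq
  have hX' : iIndepFun X' P := hXindep.congr hae
  have hall : ∀ᵐ ω ∂P, ∀ v, Ndes X v ω = Ndes X' v ω := by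
    filter_upwards [ae_all_iff.2 hae] with ω hω v
    have hwalk : ∀ k, walk X k ω = walk X' k ω := fun k => Finset.sum_congr rfl fun i _ => hω i
    simp only [Ndes_eq_encard, visitSet, hwalk]
  have hset : {ω | 1 ≤ nu X ω} =ᵐ[P] {ω | 0 ≤ X' 0 ω} := by
    filter_upwards [hae 0] with ω hω
    refine propext ?_
    change 1 ≤ nu X ω ↔ 0 ≤ X' 0 ω
    rw [one_le_nu_iff, hω]
  refine ⟨?_, ?_, ?_⟩
  · filter_upwards [hpath] with ω hω v
    refine ⟨?_, ?_, hω.state_add_deaths v⟩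
    · rw [hω.births_eq]
      exact ENat.natCast_lt_top _
    · rw [hω.deaths_eq]
      exact ENat.natCast_lt_top _
  · rw [measure_congr hset, measure_zero_le hX'm hX'law hX']
    simp
  · have hcond : P[|{ω | 1 ≤ nu X ω}] = P[|{ω | 0 ≤ X' 0 ω}] := by
      rw [ProbabilityTheory.cond, ProbabilityTheory.cond, measure_congr hset, Measure.restrict_congr_set hset]
    rw [hcond]
    have h := identDistrib_Ndes_Ncount P hX'm hX'law hX' P' hJ hpath hM
    have hc : (fun ω v => Ndes X' v ω) =ᵐ[P[|{ω | 0 ≤ X' 0 ω}]] fun ω v => Ndes X v ω := by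
      filter_upwards [cond_absolutelyContinuous.ae_le hall] with ω hω
      funext v
      exact (hω v).symm
    exact ⟨h.aemeasurable_fst.congr hc, h.aemeasurable_snd,
      (Measure.map_congr hc).symm.trans h.map_eq⟩
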